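/- **Setting.** Let $w$ be a complex weight on the unit circle $\mathbb T$ with zero winding number, $w(z)=\exp\big(\sum_{p\in\mathbb Z}c_pz^p\big)$ for $|z|=1$, where $\sum_p|c_p|<\infty$ and $\sum_p|p|\,|c_p|^2<\infty$. Let $$f_+(z)=\exp\Big(-\tfrac{c_0}{2}-\sum_{p\ge1}c_pz^p\Big),\qquad f_-(z)=\exp\Big(-\tfrac{c_0}{2}-\sum_{p\ge1}c_{-p}z^{-p}\Big)$$ be its Jost functions (so $w=1/(f_+f_-)$ on $\mathbb T$ and $f_+(0)=f_-(\infty)$), $\kappa_\infty=f_+(0)$, $S=f_- /f_+$, and $$F_m=\int_{\mathbb T}\frac{dz}{2\pi iz}z^mS(z),\qquad \bar F_m=\int_{\mathbb T}\frac{dz}{2\pi iz}\frac{z^{-m}}{S(z)},\qquad G_{l,m}=-\sum_{m'\ge1}\bar F_{l+m'}F_{m+m'},\qquad \bar G_{l,m}=-\sum_{m'\ge1}F_{l+m'}\bar F_{m+m'} .$$ For $\lambda\in\mathbb C$ and $n\ge0$ let $\det[1+\lambda^2G]^\infty_n$ be the determinant of the infinite matrix $1+\lambda^2G$ with rows and columns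 $n,n+1,n+2,\dots$, and let $D_n(\lambda)$ be the determinant of the same matrix with its first row replaced by $(\lambda F_{n+1},\lambda F_{n+2},\lambda F_{n+3},\dots)$; let $\bar D_n(\lambda)$ be defined likewise from $\bar G,\bar F$. An infinite determinant is the limit of the determinants of the upper left $N\times N$ corners. A solution of the *$\lambda$-extended discrete Marchenko equations* of level $n\ge 0$ consists of $\kappa_n\ne0$ and square summable sequences $A_1(n,\cdot),A_2(n,\cdot),\bar A_1(n,\cdot),\bar A_2(n,\cdot)$ with $$\begin{aligned} \tfrac{\kappa_n}{\kappa_\infty}\delta_{m,n}&=A_1(n,m)+\sum_{n'\ge1}\bar A_2(n,n')\bar F_{n'+m}\quad(m\ge n), & 0&=\bar A_2(n,m)+\lambda^2\sum_{n'\ge n}A_1(n,n')F_{n'+m}\quad(m\ge1),\\ \tfrac{\kappa_n}{\kappa_\infty}\delta_{m,n}&=\bar A_1(n,m)+\lambda^2\sum_{n'\ge1}A_2(n,n')F_{n'+m}\quad(m\ge n), & 0&=A_2(n,m)+\sum_{n'\ge n}\bar A_1(n,n')\bar F_{n'+m}\quad(m\ge1), \end{aligned}$$ and $A_1(n,n)=\kappa_\infty/\kappa_n$.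 For $\lambda\neq0$ its reflection coefficients are $$r_{n+1}=-\frac{\lambda^{-1}\bar A_2(n,1)}{\bar A_1(n,n)},\qquad \bar r_{n+1}=-\frac{\lambda A_2(n,1)}{A_1(n,n)} .$$ **Proposition.** 1. The series for $G_{l,m}$ ($l,m\ge0$) converges absolutely, all the infinite determinants above converge, and $\det[1+\lambda^2\bar G]^\infty_n=\det[1+\lambda^2G]^\infty_n$. 2. For $\lambda\ne0$, $(\kappa_n,A_1,A_2,\bar A_1,\bar A_2)$ solves the $\lambda$-extended system if and only if $(\kappa_n,A_1,\lambda A_2,\bar A_1,\lambda^{-1}\bar A_2)$ solves the unextended system ($\lambda=1$) with $F,\bar F$ replaced by $\lambda F,\lambda\bar F$. 3. If $\det[1+\lambda^2G]^\infty_n\ne0$ and $\det[1+\lambda^2G]^\infty_{n+1}\neq0$, then the $\lambda$-extended system of level $n$ has a solution. 4. If $\lambda\ne0$ and $\det[1+\lambda^2G]^\infty_{n+1}\ne0$, then for every solution of level $n$: $\det[1+\lambda^2G]^\infty_n\ne0$, $\bar A_1(n,n)=\kappa_\infty/\kappa_n$, and $$\frac{\kappa_\infty^2}{\kappa_n^2}=\frac{\det[1+\lambda^2G]^\infty_{n+1}}{\det[1+\lambda^2G]^\infty_n},\qquad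 r_{n+1}=\frac{D_n(\lambda)}{\det[1+\lambda^2G]^\infty_{n+1}},\qquad \bar r_{n+1}=\frac{\bar D_n(\lambda)}{\det[1+\lambda^2\bar G]^\infty_{n+1}} .$$ 5. For every $n\ge 0$ there is $\delta>0$ such that for $0<|\lambda|<\delta$ both determinants in 3 are nonzero and, for every solution of level $n$, $$\frac{\kappa_\infty^2}{\kappa_n^2}=1-\lambda^2G_{n,n}+\lambda^4\sum_{n_1\ge n}G_{n,n_1}G_{n_1,n}+\cdots,$$ $$r_{n+1}=\lambda F_{n+1}-\lambda^3\sum_{n_1\ge n+1}F_{n_1+1}G_{n_1,n}+\cdots,\qquad \bar r_{n+1}=\lambda\bar F_{n+1}-\lambda^3\sum_{n_1\ge n+1}\bar F_{n_1+1}\bar G_{n_1,n}+\cdots,$$ where the right-hand sides are convergent power series in $\lambda$, the first in even powers and the other two in odd powers only, with coefficients that do not depend on $\lambda$ or on the solution, and where the sums over $n_1$ converge. 6. If for some $\lambda$ there are solutions with norms $\kappa_n$ for all levels $n\ge0$, then $\det[1+\lambda^2G]^\infty_n\ne0$ for all $n\geq 0$, and the extended Toeplitz determinants, defined by $I_{n+1}/I_n=1/\kappa_n^2$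 from any initial value $I_0$ (that is, $I_n=I_0\prod_{j<n}\kappa_j^{-2}$), are $$I_n=\frac{I_0}{\kappa_\infty^{2n}}\frac{\det[1+\lambda^2G]^\infty_n}{\det[1+\lambda^2G]^\infty_0}\qquad(n\ge0).$$ 7. For $\lambda=1$ this formula holds for the Toeplitz determinants of $w$ itself: if $I_n[w]=\det[w_{j-k}]_{0\le j,k\le n-1}$, $w_k=\int_{\mathbb T}\frac{dz}{2\pi iz}w(z)z^{-k}$, is nonzero for all $n\ge1$, then $\det[1+G]^\infty_n\neq0$ and $I_n[w]=\frac{I_0[w]}{\kappa_\infty^{2n}}\frac{\det[1+G]^\infty_n}{\det[1+G]^\infty_0}$ for all $n\ge0$ (with $I_0[w]=1$). -/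

import Mathlib

open Filter Topology

noncomputable section

/-! ### The weight, the Jost functions and the scattering data -/

/-- The Jost function `f₊` (boundary values included) of the weight whose logarithm has the Fourier
coefficients `c`: the interior factor of `w = 1 / (f₊ f₋)`, normalised by `f₊(0) = f₋(∞)`. -/
def jostPlus (c : ℤ → ℂ) (z : ℂ) : ℂ :=
  Complex.exp (-(c 0 / 2) - ∑' p : ℕ, c ((p : ℤ) + 1) * z ^ (p + 1))

/-- The Jost function `f₋`, the exterior factor of `w = 1 / (f₊ f₋)`. -/
def jostMinus (c : ℤ → ℂ) (z : ℂ) : ℂ :=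
  Complex.exp (-(c 0 / 2) - ∑' p : ℕ, c (-((p : ℤ) + 1)) * (z⁻¹) ^ (p + 1))

/-- `κ_∞ = f₊(0) = f₋(∞)`. -/
def kappaInf (c : ℤ → ℂ) : ℂ := jostPlus c 0

/-- The scattering function `S = f₋ / f₊` on the unit circle. -/
def scatteringS (c : ℤ → ℂ) (z : ℂ) : ℂ := jostMinus c z / jostPlus c z

/-- The mean `∮ h(z) dz / (2 π i z)` over the unit circle. -/
def circleMean (h : ℂ → ℂ) : ℂ :=
  (2 * (Real.pi : ℂ) * Complex.I)⁻¹ * ∮ z in C(0, 1), h z / z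

/-- `F_m = ∮ z^m S(z) dz / (2 π i z)`. -/
def scatF (c : ℤ → ℂ) (m : ℤ) : ℂ := circleMean fun z => z ^ m * scatteringS c z

/-- `F̄_m = ∮ z^{-m} S(z)⁻¹ dz / (2 π i z)`. -/
def scatFbar (c : ℤ → ℂ) (m : ℤ) : ℂ := circleMean fun z => z ^ (-m) * (scatteringS c z)⁻¹

/-- `G_{l,m} = -∑_{m' ≥ 1} F̄_{l+m'} F_{m+m'}`. The companion `Ḡ` is `kernelG Fbar F`, with the
roles of `F` and `F̄` exchanged. -/
def kernelG (F Fbar : ℤ → ℂ) (l m : ℤ) : ℂ :=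
  -∑' k : ℕ, Fbar (l + (k + 1)) * F (m + (k + 1))

/-- The Toeplitz determinant `I_n[w] = det [w_{j-k}]_{0 ≤ j,k ≤ n-1}`, where
`w_k = ∮ w(z) z^{-k} dz / (2 π i z)`. -/
def toeplitzDet (w : ℂ → ℂ) (n : ℕ) : ℂ :=
  (Matrix.of fun j k : Fin n => circleMean fun z => w z * z ^ (-((j : ℤ) - (k : ℤ)))).det

/-! ### Infinite determinants -/

/-- The determinant of the `N × N` upper left corner of an infinite matrix. -/
def cornerDet (M : ℕ → ℕ → ℂ) (N : ℕ) : ℂ := (Matrix.of fun i j : Fin N => M i j).det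

/-- The determinant of an infinite matrix: the limit of the determinants of its corners. -/
def infDet (M : ℕ → ℕ → ℂ) : ℂ := limUnder atTop (cornerDet M)

/-- The matrix `1 + lam² G` with rows and columns `n, n+1, n+2, …`. -/
def extMatrix (lam : ℂ) (G : ℤ → ℤ → ℂ) (n : ℕ) (i j : ℕ) : ℂ :=
  (if i = j then 1 else 0) + lam ^ 2 * G ((n : ℤ) + i) ((n : ℤ) + j)

/-- The matrix `1 + lam² G` with rows and columns `n, n+1, n+2, …` whose first row has been
replaced by `lam F_{n+1}, lam F_{n+2}, lam F_{n+3}, …`. -/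
def extBordered (lam : ℂ) (F : ℤ → ℂ) (G : ℤ → ℤ → ℂ) (n : ℕ) (i j : ℕ) : ℂ :=
  if i = 0 then lam * F ((n : ℤ) + 1 + j) else extMatrix lam G n i j

/-- `det [1 + lam² G]_n^∞`. -/
def extDet (lam : ℂ) (G : ℤ → ℤ → ℂ) (n : ℕ) : ℂ := infDet (extMatrix lam G n)

/-! ### The discrete Marchenko equations -/

/-- `kap` (that is, `κ_n`) and the sequences `A1 n'`, `Ab1 n'` (for `n' ≥ n`), `A2 n'`, `Ab2 n'`
(for `n' ≥ 1`) solve the `lam`-extended discrete Marchenko equations of level `n`; here `A1 n'`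
stands for `A₁(n,n')`, and so on. The sequences are square summable, and the norm `κ_n` is read off
from the leading coefficient, `A₁(n,n) = κ_∞ / κ_n`. The case `lam = 1` is the unextended system. -/
structure IsMarchenkoSolution (lam : ℂ) (F Fbar : ℤ → ℂ) (kinf : ℂ) (n : ℕ) (kap : ℂ)
    (A1 A2 Ab1 Ab2 : ℕ → ℂ) : Prop where
  kap_ne_zero : kap ≠ 0
  summable_A1 : Summable fun j => ‖A1 j‖ ^ 2
  summable_A2 : Summable fun j => ‖A2 j‖ ^ 2
  summable_Ab1 : Summable fun j => ‖Ab1 j‖ ^ 2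
  summable_Ab2 : Summable fun j => ‖Ab2 j‖ ^ 2
  norm_eq : A1 n = kinf / kap
  eq_a : ∀ m : ℕ, n ≤ m → (if m = n then kap / kinf else 0) =
    A1 m + ∑' j : ℕ, Ab2 (j + 1) * Fbar (((j : ℤ) + 1) + m)
  eq_b : ∀ m : ℕ, 1 ≤ m → 0 =
    Ab2 m + lam ^ 2 * ∑' j : ℕ, A1 (n + j) * F (((n : ℤ) + j) + m)
  eq_c : ∀ m : ℕ, n ≤ m → (if m = n then kap / kinf else 0) =
    Ab1 m + lam ^ 2 * ∑' j : ℕ, A2 (j + 1) * F (((j : ℤ) + 1) + m)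
  eq_d : ∀ m : ℕ, 1 ≤ m → 0 =
    A2 m + ∑' j : ℕ, Ab1 (n + j) * Fbar (((n : ℤ) + j) + m)

/-- The reflection coefficient `r_{n+1}` of a solution of the `lam`-extended system of level `n`:
`-Ā₂(n,1) / Ā₁(n,n)` for the solution `lam⁻¹ Ā₂` of the system with `F, F̄` replaced by
`lam F, lam F̄`. -/
def reflCoeff (lam : ℂ) (n : ℕ) (Ab1 Ab2 : ℕ → ℂ) : ℂ := -(lam⁻¹ * Ab2 1) / Ab1 n

/-- The reflection coefficient `r̄_{n+1}` of a solution of the `lam`-extended system of level `n`: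
`-A₂(n,1) / A₁(n,n)` for the solution `lam A₂` of the system with `F, F̄` replaced by
`lam F, lam F̄`. -/
def reflCoeffBar (lam : ℂ) (n : ℕ) (A1 A2 : ℕ → ℂ) : ℂ := -(lam * A2 1) / A1 n

/-- The extended Toeplitz determinants: `I_{n+1} / I_n = 1 / κ_n²` with initial value `I_0`. -/
def extToeplitz (I0 : ℂ) (kap : ℕ → ℂ) (n : ℕ) : ℂ := I0 * ∏ j ∈ Finset.range n, (kap j ^ 2)⁻¹

end

noncomputable section

/-! ### A Hadamard type bound -/

/-! The core is Cramer's rule for an infinite matrix. Eliminating `Ab2` from the first pair of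
Marchenko equations leaves `(1 + lam² G) v = s e₀` for `v j = A1 (n + j)`, with `s = kap / kinf`;
eliminating `A2` from the second pair gives the same system for `Ab1`, with `G` replaced by its
transpose `Ḡ`. Deleting the first row and column of the matrix of level `n` produces level `n + 1`,
so with `D n = extDet lam G n` Cramer's rule says `D n * v 0 = s * D (n + 1)`. Combined with `A1 n =
kinf / kap` this is the norm formula. Replacing the first row by `lam F` gives the reflection
coefficients, because the pairing of that row with `v` is `-lam⁻¹ * Ab2 1`. These identities involve
no division by a determinant (`DomPert.infDet_mul_apply_zero`,
`DomPert.infDet_rowReplace_mul_apply_zero`).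

Cramer's rule passes to the limit because `G` is entrywise dominated by a rank one matrix `α i * β
j` with square summable factors. A determinant bound uniform in the corner size
(`norm_cornerDet_le_detBound`) makes consecutive corners differ by `O(α N * β N)` and makes
truncation errors vanish. Limits of Cramer numerators also provide a solution
(`DomPert.exists_solution`), hence existence.

The domination follows by Cauchy–Schwarz, `-G` being a product of two Hankel matrices, once these
are square summable. Square summability amounts to `∑ |k| |a k|² < ∞` for the coefficients of `S`
and `1 / S`. Absolutely summable sequences with this property form an algebra closed under
exponentials (`besovSq_conv_le`, `HasFourier.besovSq_convExp_ne_top`), and `log S` lies in it by the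
hypotheses on `c`.

For small `lam` the ratios of determinants are entries of, or pairings with, Neumann series of `(1 +
lam² G)⁻¹`. If solutions exist at all levels, the norm formula propagates a zero of `D` to every
later level, contradicting `D n → 1`; the product formula then telescopes.

For the Toeplitz determinants of `w`, the last column of the adjugate of the Toeplitz matrix is an
unnormalised orthogonal polynomial `P`. Factoring `w = 1 / (f₊ f₋)` turns the vanishing of the
Fourier coefficients of `P w` between `0` and `n - 1` into the system `(1 + G) v = s e₀`, where `v
0` is `κ_∞ I_{n+1}` and `s` is `I_n / κ_∞` (`toeplitzDet_extDet`). -/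

open scoped ComplexOrder in
-- The eigenvalues `x` of `Aᴴ A` multiply to `‖det A‖²` and add up to the squared Frobenius norm; `x
-- ≤ exp (x - 1)` compares the two. The subtracted dimension is what keeps the bound finite for
-- perturbations of the identity of growing size.
theorem Matrix.norm_det_sq_le_exp {n : Type*} [Fintype n] [DecidableEq n] (A : Matrix n n ℂ) :
    ‖A.det‖ ^ 2 ≤ Real.exp (∑ i, ∑ j, ‖A i j‖ ^ 2 - Fintype.card n) := by
  have hH : (A.conjTranspose * A).IsHermitian := Matrix.isHermitian_conjTranspose_mul_self A
  have hpos : (A.conjTranspose * A).PosSemidef := Matrix.posSemidef_conjTranspose_mul_self A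
  have h1 : (‖A.det‖ ^ 2 : ℝ) = ∏ i, hH.eigenvalues i := by
    have := hH.det_eq_prod_eigenvalues
    rw [Matrix.det_mul, Matrix.det_conjTranspose] at this
    have h2 : (starRingEnd ℂ) A.det * A.det = ((‖A.det‖ ^ 2 : ℝ) : ℂ) := by
      rw [Complex.conj_mul']; push_cast; rfl
    rw [show star A.det = (starRingEnd ℂ) A.det from rfl, h2] at this
    apply Complex.ofReal_injective
    rw [this]
    push_cast
    rfl
  have h3 : ∑ i, hH.eigenvalues i = ∑ i, ∑ j, ‖A i j‖ ^ 2 := by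
    have := hH.trace_eq_sum_eigenvalues
    rw [Matrix.trace] at this
    have h4 : ∑ i, (A.conjTranspose * A).diag i = ((∑ i, ∑ j, ‖A i j‖ ^ 2 : ℝ) : ℂ) := by
      rw [Finset.sum_comm]
      push_cast
      refine Finset.sum_congr rfl fun i _ => ?_
      rw [Matrix.diag_apply, Matrix.mul_apply]
      refine Finset.sum_congr rfl fun j _ => ?_
      rw [Matrix.conjTranspose_apply]
      exact Complex.conj_mul' _
    rw [h4] at this
    apply Complex.ofReal_injective
    rw [this]
    push_cast
    rfl
  rw [h1, ← h3]
  calc ∏ i, hH.eigenvalues i ≤ ∏ i, Real.exp (hH.eigenvalues i - 1) := by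
        refine Finset.prod_le_prod (fun i _ => hpos.eigenvalues_nonneg i) fun i _ => ?_
        have := Real.add_one_le_exp (hH.eigenvalues i - 1)
        linarith
    _ = _ := by
        rw [← Real.exp_sum, Finset.sum_sub_distrib]
        simp

/-- The ones on the diagonal add up to `N` and cancel the dimension term, so the bound does not
depend on `N`. -/
theorem norm_cornerDet_le_exp {X : ℕ → ℕ → ℂ} {a b c : ℕ → ℝ} {N : ℕ}
    (ha : ∀ i, 0 ≤ a i) (hb : ∀ i, 0 ≤ b i) (hc : ∀ i, 0 ≤ c i)
    (sa : Summable a) (sb : Summable b) (sc : Summable c)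
    (hX : ∀ i < N, ∀ j < N, ‖X i j‖ ^ 2 ≤ a i * b j + if i = j then 1 + c i else 0) :
    ‖cornerDet X N‖ ≤ Real.exp (((∑' i, a i) * (∑' i, b i) + ∑' i, c i) / 2) := by
  have h1 := Matrix.norm_det_sq_le_exp (Matrix.of fun i j : Fin N => X i j)
  have h2 : ∑ i : Fin N, ∑ j : Fin N, ‖X i j‖ ^ 2 - N ≤
      (∑' i, a i) * (∑' i, b i) + ∑' i, c i := by
    have h3 : ∑ i : Fin N, ∑ j : Fin N, ‖X i j‖ ^ 2 ≤
        ∑ i : Fin N, ∑ j : Fin N, (a i * b j + if i = j then 1 + c i else 0) := by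
      refine Finset.sum_le_sum fun i _ => Finset.sum_le_sum fun j _ => ?_
      have := hX i i.2 j j.2
      simpa [Fin.ext_iff] using this
    have h4 : ∑ i : Fin N, ∑ j : Fin N, (a i * b j + if i = j then 1 + c i else 0) =
        (∑ i ∈ Finset.range N, a i) * (∑ i ∈ Finset.range N, b i) +
          (N + ∑ i ∈ Finset.range N, c i) := by
      simp_rw [Finset.sum_add_distrib]
      rw [← Finset.sum_mul_sum]
      simp [Finset.sum_add_distrib, Finset.sum_range]
    have h5 := mul_le_mul (sa.sum_le_tsum (Finset.range N) fun i _ => ha i)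
      (sb.sum_le_tsum (Finset.range N) fun i _ => hb i) (Finset.sum_nonneg fun i _ => hb i)
      (tsum_nonneg ha)
    have h6 := sc.sum_le_tsum (Finset.range N) fun i _ => hc i
    linarith
  rw [← abs_of_nonneg (norm_nonneg _), ← abs_of_nonneg (Real.exp_nonneg _)]
  refine sq_le_sq.mp ?_
  rw [← Real.exp_nat_mul]
  refine h1.trans (Real.exp_le_exp.mpr ?_)
  simp only [Matrix.of_apply, Fintype.card_fin]
  push_cast
  linarith

/-! ### Matrices dominated by a rank one matrix -/

/-- `M - 1` is entrywise bounded by the rank one matrix `α i * β j`, with `α` and `β` square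
summable. -/
structure DomPert (M : ℕ → ℕ → ℂ) (α β : ℕ → ℝ) : Prop where
  nonneg_left : ∀ i, 0 ≤ α i
  nonneg_right : ∀ i, 0 ≤ β i
  sq_left : Summable fun i => α i ^ 2
  sq_right : Summable fun i => β i ^ 2
  bound : ∀ i j, ‖M i j - (if i = j then 1 else 0)‖ ≤ α i * β j

/-- A bound for the corner determinants of matrices dominated by `α` and `β`. -/
def detBound (α β : ℕ → ℝ) : ℝ :=
  Real.exp (((∑' i, α i ^ 2 + 2) * (∑' i, β i ^ 2 + 1) + (∑' i, α i ^ 2 + ∑' i, β i ^ 2)) / 2)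

theorem detBound_pos (α β : ℕ → ℝ) : 0 < detBound α β := Real.exp_pos _

theorem detBound_mono {α β α' β' : ℕ → ℝ} (hα : ∑' i, α i ^ 2 ≤ ∑' i, α' i ^ 2)
    (hβ : ∑' i, β i ^ 2 ≤ ∑' i, β' i ^ 2) : detBound α β ≤ detBound α' β' := by
  have h1 : 0 ≤ ∑' i, α i ^ 2 := tsum_nonneg fun i => sq_nonneg _
  have h2 : 0 ≤ ∑' i, β i ^ 2 := tsum_nonneg fun i => sq_nonneg _
  unfold detBound
  gcongr

theorem summable_mul_of_sq {ι : Type*} {f g : ι → ℝ} (hf : Summable fun i => f i ^ 2)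
    (hg : Summable fun i => g i ^ 2) : Summable fun i => f i * g i := by
  refine Summable.of_norm_bounded ((hf.add hg)) fun i => ?_
  rw [Real.norm_eq_abs, abs_le]
  constructor <;> nlinarith [sq_nonneg (f i + g i), sq_nonneg (f i - g i), sq_nonneg (f i),
    sq_nonneg (g i)]

/-- The indices `k` and `l` leave room for modified rows and a modified column of `M`; their
indicators account for the constants `2` and `1` in `detBound`. -/
theorem norm_cornerDet_le_detBound {X : ℕ → ℕ → ℂ} {α β : ℕ → ℝ} {N : ℕ} (k l : ℕ)
    (sα : Summable fun i => α i ^ 2) (sβ : Summable fun i => β i ^ 2)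
    (hX : ∀ i < N, ∀ j < N, ‖X i j‖ ^ 2 ≤
      (α i ^ 2 + (if i = k then 1 else 0) + (if i = l then 1 else 0)) *
        (β j ^ 2 + (if j = k then 1 else 0)) + if i = j then 1 + (α i ^ 2 + β i ^ 2) else 0) :
    ‖cornerDet X N‖ ≤ detBound α β := by
  have hs : ∀ m : ℕ, HasSum (fun i : ℕ => if i = m then (1 : ℝ) else 0) 1 :=
    fun m => hasSum_ite_eq m 1
  have ha := (sα.hasSum.add (hs k)).add (hs l)
  have hb := sβ.hasSum.add (hs k)
  have hc := sα.hasSum.add sβ.hasSum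
  refine (norm_cornerDet_le_exp (fun i => ?_) (fun i => ?_) (fun i => ?_) ha.summable hb.summable
    hc.summable hX).trans_eq ?_
  · positivity
  · positivity
  · positivity
  · rw [ha.tsum_eq, hb.tsum_eq, hc.tsum_eq, detBound]
    ring_nf

theorem DomPert.entry {M : ℕ → ℕ → ℂ} {α β : ℕ → ℝ} (h : DomPert M α β) (i j : ℕ) :
    ‖M i j‖ ^ 2 ≤ α i ^ 2 * β j ^ 2 + if i = j then 1 + (α i ^ 2 + β i ^ 2) else 0 := by
  have hb := h.bound i j
  split_ifs at hb ⊢ with hij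
  · subst hij
    have h1 : ‖M i i‖ ≤ 1 + α i * β i := by
      calc ‖M i i‖ = ‖1 + (M i i - 1)‖ := by ring_nf
        _ ≤ ‖(1 : ℂ)‖ + ‖M i i - 1‖ := norm_add_le _ _
        _ ≤ _ := by simpa using hb
    have h2 : ‖M i i‖ ^ 2 ≤ (1 + α i * β i) ^ 2 := by gcongr
    nlinarith [sq_nonneg (α i - β i)]
  · rw [sub_zero] at hb
    have : ‖M i j‖ ^ 2 ≤ (α i * β j) ^ 2 := by gcongr
    rw [add_zero, ← mul_pow]
    exact this

/-- `M` with column `k` replaced by `u`. -/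
def colReplace (M : ℕ → ℕ → ℂ) (k : ℕ) (u : ℕ → ℂ) (i j : ℕ) : ℂ := if j = k then u i else M i j

theorem cornerDet_colReplace (M : ℕ → ℕ → ℂ) {k N : ℕ} (hk : k < N) (u : ℕ → ℂ) :
    cornerDet (colReplace M k u) N =
      Matrix.cramer (Matrix.of fun i j : Fin N => M i j) (fun i => u i) ⟨k, hk⟩ := by
  rw [Matrix.cramer_apply, cornerDet]
  congr 1
  ext i j
  simp [colReplace, Matrix.updateCol_apply, Fin.ext_iff]

theorem cornerDet_scale (r s : ℕ → ℂ) (X : ℕ → ℕ → ℂ) (N : ℕ) :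
    cornerDet (fun i j => r i * (s j * X i j)) N =
      (∏ i ∈ Finset.range N, r i) * ((∏ j ∈ Finset.range N, s j) * cornerDet X N) := by
  rw [Finset.prod_range, Finset.prod_range, cornerDet, cornerDet, ← Matrix.det_mul_row,
    ← Matrix.det_mul_column]
  rfl

theorem cornerDet_succ_colReplace_zero (M : ℕ → ℕ → ℂ) (N : ℕ) (s : ℂ) :
    cornerDet (colReplace M 0 fun i => if i = 0 then s else 0) (N + 1) =
      s * cornerDet (fun i j => M (i + 1) (j + 1)) N := by
  rw [cornerDet, Matrix.det_succ_column_zero, Fin.sum_univ_succ]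
  simp [colReplace, cornerDet, Matrix.submatrix]

/-- The smaller corner is the larger one with its last column replaced by a unit vector; the
determinant is linear in that column. -/
theorem cornerDet_succ_sub (M : ℕ → ℕ → ℂ) (N : ℕ) :
    cornerDet M (N + 1) - cornerDet M N =
      cornerDet (colReplace M N fun i => M i N - if i = N then 1 else 0) (N + 1) := by
  have h : ∀ u : ℕ → ℂ, cornerDet (colReplace M N u) (N + 1) =
      ∑ i : Fin (N + 1), (-1) ^ ((i : ℕ) + N) * u i *
        ((Matrix.of fun i j : Fin (N + 1) => M i j).submatrix i.succAbove
          (Fin.last N).succAbove).det := by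
    intro u
    rw [cornerDet, Matrix.det_succ_column _ (Fin.last N)]
    refine Finset.sum_congr rfl fun i _ => ?_
    congr 2
    · simp [colReplace]
    · ext a b
      have : (b : ℕ) ≠ N := b.2.ne
      simp [colReplace, this]
  have h0 : cornerDet M (N + 1) = cornerDet (colReplace M N fun i => M i N) (N + 1) := by
    congr 1
    ext i j
    simp only [colReplace]
    split_ifs with hj
    · rw [hj]
    · rfl
  rw [h0, h, h, sub_eq_iff_eq_add, ← sub_eq_iff_eq_add', ← Finset.sum_sub_distrib,
    Fin.sum_univ_castSucc]
  have h1 : ∀ i : Fin N, (i : ℕ) ≠ N := fun i => i.2.ne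
  simp only [Fin.val_castSucc, h1, Fin.val_last, if_true, if_false]
  simp only [sub_zero, sub_self, Finset.sum_const_zero, zero_add]
  rw [← sub_mul, ← mul_sub, sub_sub_cancel, mul_one, ← two_mul, pow_mul]
  simp [cornerDet, Matrix.submatrix]

/-! ### Convergence of the corner determinants. -/

namespace DomPert

variable {M : ℕ → ℕ → ℂ} {α β : ℕ → ℝ}

theorem summable_mul (h : DomPert M α β) : Summable fun i => α i * β i :=
  summable_mul_of_sq h.sq_left h.sq_right

/-- After subtracting the unit vector, row `N` is `O(α N)` and column `N` is `O(β N)`. Both factors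
are pulled out, and what remains still satisfies the uniform determinant bound. -/
theorem norm_cornerDet_succ_sub_le (h : DomPert M α β) (N : ℕ) :
    ‖cornerDet M (N + 1) - cornerDet M N‖ ≤ detBound α β * (α N * β N) := by
  rw [cornerDet_succ_sub]
  set Z := colReplace M N fun i => M i N - if i = N then 1 else 0 with hZ
  set r : ℕ → ℂ := fun i => if i = N then (α N : ℂ) else 1 with hr
  set s : ℕ → ℂ := fun i => if i = N then (β N : ℂ) else 1 with hs
  have hZr : ∀ j, ‖Z N j‖ ≤ α N * β j := by
    intro j
    have := h.bound N j
    by_cases hj : j = N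
    · simpa [hZ, colReplace, hj] using this
    · simpa [hZ, colReplace, hj, Ne.symm hj] using this
  have hZc : ∀ i, ‖Z i N‖ ≤ α i * β N := by
    intro i
    simpa [hZ, colReplace] using h.bound i N
  have hα := h.nonneg_left N
  have hβ := h.nonneg_right N
  set X : ℕ → ℕ → ℂ := fun i j => Z i j / (r i * s j) with hX
  have h1 : Z = fun i j => r i * (s j * X i j) := by
    ext i j
    -- If `α N` or `β N` vanishes, so does the corresponding row or column of `Z`; the division by
    -- zero then returns the correct value `0`.
    by_cases h0 : r i * s j = 0
    · have hz : Z i j = 0 := by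
        rcases mul_eq_zero.mp h0 with h0 | h0
        · by_cases hi : i = N
          · have : α N = 0 := by simpa [hr, hi] using h0
            simpa [this, hi] using hZr j
          · simp [hr, hi] at h0
        · by_cases hj : j = N
          · have : β N = 0 := by simpa [hs, hj] using h0
            simpa [this, hj] using hZc i
          · simp [hs, hj] at h0
      simp [hX, hz]
    · rw [← mul_assoc, hX, mul_div_cancel₀ _ h0]
  have hbd : ‖cornerDet X (N + 1)‖ ≤ detBound α β := by
    refine norm_cornerDet_le_detBound N N h.sq_left h.sq_right fun i _ j _ => ?_
    by_cases hi : i = N <;> by_cases hj : j = N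
    · subst hi; subst hj
      have h2 : ‖X j j‖ ≤ 1 := by
        simp only [hX, hr, hs, if_true, norm_div, norm_mul, Complex.norm_real, Real.norm_eq_abs,
          abs_of_nonneg hα, abs_of_nonneg hβ]
        exact div_le_one_of_le₀ (hZr j) (mul_nonneg hα hβ)
      have h3 : ‖X j j‖ ^ 2 ≤ 1 := pow_le_one₀ (norm_nonneg _) h2
      simp only [if_true]
      nlinarith [sq_nonneg (α j), sq_nonneg (β j), mul_nonneg (sq_nonneg (α j)) (sq_nonneg (β j))]
    · subst hi
      have h2 : ‖X i j‖ ≤ β j := by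
        simp only [hX, hr, hs, hj, if_true, if_false, mul_one, norm_div, Complex.norm_real,
          Real.norm_eq_abs, abs_of_nonneg hα]
        exact div_le_of_le_mul₀ hα (h.nonneg_right j) (by linarith [hZr j])
      have h3 : ‖X i j‖ ^ 2 ≤ β j ^ 2 := by gcongr
      simp only [if_true, hj, Ne.symm hj, if_false]
      nlinarith [sq_nonneg (β j), mul_nonneg (sq_nonneg (α i)) (sq_nonneg (β j))]
    · subst hj
      have h2 : ‖X i j‖ ≤ α i := by
        simp only [hX, hr, hs, hi, if_true, if_false, one_mul, norm_div, Complex.norm_real,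
          Real.norm_eq_abs, abs_of_nonneg hβ]
        exact div_le_of_le_mul₀ hβ (h.nonneg_left i) (hZc i)
      have h3 : ‖X i j‖ ^ 2 ≤ α i ^ 2 := by
        have := h.nonneg_left i
        gcongr
      simp only [if_true, hi, if_false]
      nlinarith [sq_nonneg (α i), mul_nonneg (sq_nonneg (α i)) (sq_nonneg (β j))]
    · have h2 : X i j = M i j := by simp [hX, hr, hs, hi, hj, hZ, colReplace]
      simpa [h2, hi, hj] using h.entry i j
  have hpr : ∏ i ∈ Finset.range (N + 1), r i = α N := by
    rw [Finset.prod_range_succ, Finset.prod_eq_one]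
    · simp [hr]
    · intro i hi
      simp [hr, (Finset.mem_range.mp hi).ne]
  have hps : ∏ i ∈ Finset.range (N + 1), s i = β N := by
    rw [Finset.prod_range_succ, Finset.prod_eq_one]
    · simp [hs]
    · intro i hi
      simp [hs, (Finset.mem_range.mp hi).ne]
  rw [h1, cornerDet_scale, hpr, hps, norm_mul, norm_mul, Complex.norm_real, Complex.norm_real,
    Real.norm_of_nonneg hα, Real.norm_of_nonneg hβ]
  calc α N * (β N * ‖cornerDet X (N + 1)‖) ≤ α N * (β N * detBound α β) := by gcongr
    _ = _ := by ring

theorem tendsto_infDet (h : DomPert M α β) :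
    Tendsto (cornerDet M) atTop (𝓝 (infDet M)) := by
  refine tendsto_nhds_limUnder (cauchySeq_tendsto_of_complete
    (cauchySeq_of_dist_le_of_summable (fun N => detBound α β * (α N * β N)) (fun N => ?_)
      (h.summable_mul.mul_left _)))
  rw [dist_comm, dist_eq_norm]
  exact h.norm_cornerDet_succ_sub_le N

theorem norm_infDet_sub_one_le (h : DomPert M α β) :
    ‖infDet M - 1‖ ≤ detBound α β * ∑' i, α i * β i := by
  have := dist_le_tsum_of_dist_le_of_tendsto₀ (f := cornerDet M)
    (fun N => detBound α β * (α N * β N)) (fun N => by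
      rw [dist_comm, dist_eq_norm]
      exact h.norm_cornerDet_succ_sub_le N) (h.summable_mul.mul_left _) h.tendsto_infDet
  rw [tsum_mul_left, dist_comm, dist_eq_norm] at this
  simpa [cornerDet] using this

theorem shift (h : DomPert M α β) (n : ℕ) :
    DomPert (fun i j => M (i + n) (j + n)) (fun i => α (i + n)) (fun i => β (i + n)) where
  nonneg_left i := h.nonneg_left _
  nonneg_right i := h.nonneg_right _
  sq_left := (summable_nat_add_iff (f := fun i => α i ^ 2) n).mpr h.sq_left
  sq_right := (summable_nat_add_iff (f := fun i => β i ^ 2) n).mpr h.sq_right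
  bound i j := by simpa using h.bound (i + n) (j + n)

/-- The distance to `1` is controlled by a tail of `∑ α i * β i`, while `detBound` only decreases
under shifts. -/
theorem tendsto_infDet_shift (h : DomPert M α β) :
    Tendsto (fun n => infDet fun i j => M (i + n) (j + n)) atTop (𝓝 1) := by
  rw [tendsto_iff_norm_sub_tendsto_zero]
  have h0 := (tendsto_sum_nat_add fun i => α i * β i).const_mul (detBound α β)
  rw [mul_zero] at h0
  refine squeeze_zero (fun _ => norm_nonneg _) (fun n => ?_) h0
  refine (h.shift n).norm_infDet_sub_one_le.trans ?_
  refine mul_le_mul_of_nonneg_right (detBound_mono ?_ ?_)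
    (tsum_nonneg fun i => mul_nonneg (h.nonneg_left _) (h.nonneg_right _))
  · rw [← h.sq_left.sum_add_tsum_nat_add n]
    exact le_add_of_nonneg_left (Finset.sum_nonneg fun i _ => sq_nonneg _)
  · rw [← h.sq_right.sum_add_tsum_nat_add n]
    exact le_add_of_nonneg_left (Finset.sum_nonneg fun i _ => sq_nonneg _)

/-! ### Cramer's rule -/

theorem summable_mulVec (h : DomPert M α β) {v : ℕ → ℂ} (hv : Summable fun i => ‖v i‖ ^ 2)
    (i : ℕ) : Summable fun j => M i j * v j := by
  have h1 : Summable fun j => (M i j - if i = j then 1 else 0) * v j := by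
    refine Summable.of_norm_bounded ((summable_mul_of_sq h.sq_right hv).mul_left (α i))
      fun j => ?_
    rw [norm_mul, ← mul_assoc]
    gcongr
    exact h.bound i j
  have h2 : Summable fun j => (if i = j then (1 : ℂ) else 0) * v j :=
    summable_of_ne_finset_zero (s := {i}) fun j hj => by
      have : i ≠ j := fun e => hj (by simp [e])
      simp [this]
  exact (h1.add h2).congr fun j => by ring

/-- A factor `ε` comes out of column `k`, which is then bounded by `α` and allowed by
`norm_cornerDet_le_detBound`. This controls truncation errors in Cramer's rule. -/
theorem norm_cornerDet_colReplace_le (h : DomPert M α β) {k N : ℕ} (hk : k < N) {ε : ℝ}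
    (hε : 0 ≤ ε) {t : ℕ → ℂ} (ht : ∀ i < N, ‖t i‖ ≤ α i * ε) :
    ‖cornerDet (colReplace M k t) N‖ ≤ ε * detBound α β := by
  have h1 : ∀ i : Fin N, t i = (ε : ℂ) * (t i / ε) := by
    intro i
    rcases eq_or_ne ε 0 with h0 | h0
    · have := ht i i.2
      rw [h0, mul_zero] at this
      simp [h0, norm_le_zero_iff.mp this]
    · rw [mul_div_cancel₀]
      exact_mod_cast h0
  have h2 : (fun i : Fin N => t i) = (ε : ℂ) • fun i : Fin N => t i / (ε : ℂ) := by
    ext i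
    exact h1 i
  rw [cornerDet_colReplace M hk, h2, map_smul, Pi.smul_apply, norm_smul, Complex.norm_real,
    Real.norm_of_nonneg hε]
  refine mul_le_mul_of_nonneg_left ?_ hε
  rw [← cornerDet_colReplace M hk fun i => t i / ε]
  refine norm_cornerDet_le_detBound k k h.sq_left h.sq_right fun i hi j hj => ?_
  have hk0 : (0 : ℝ) ≤ if i = k then 1 else 0 := by positivity
  have hd0 : (0 : ℝ) ≤ if i = j then 1 + (α i ^ 2 + β i ^ 2) else 0 := by positivity
  by_cases hjk : j = k
  · have h3 : ‖t i / ε‖ ≤ α i := by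
      rw [norm_div, Complex.norm_real, Real.norm_of_nonneg hε]
      exact div_le_of_le_mul₀ hε (h.nonneg_left i) (ht i hi)
    have h4 : ‖t i / ε‖ ^ 2 ≤ α i ^ 2 := by gcongr
    simp only [colReplace, hjk, if_true] at hd0 ⊢
    nlinarith [mul_nonneg hk0 (sq_nonneg (β k)), mul_nonneg (sq_nonneg (α i)) (sq_nonneg (β k))]
  · have h4 := h.entry i j
    simp only [colReplace, hjk, if_false]
    nlinarith [mul_nonneg hk0 (sq_nonneg (β j))]

/-- For `k ≠ 0` the replaced column removes the diagonal entry of row `k`, so that the whole row is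
`O(α k)`. The resulting bound is square summable in `k` and uniform in `N`. -/
theorem norm_cornerDet_colReplace_single_le (h : DomPert M α β) {k N : ℕ} (hk : k < N) :
    ‖cornerDet (colReplace M k fun i => if i = 0 then 1 else 0) N‖ ≤
      detBound α β * (α k + if k = 0 then 1 else 0) := by
  rcases eq_or_ne k 0 with h0 | h0
  · subst h0
    have h1 : ‖cornerDet (colReplace M 0 fun i => if i = 0 then 1 else 0) N‖ ≤ detBound α β := by
      refine norm_cornerDet_le_detBound 0 0 h.sq_left h.sq_right fun i hi j hj => ?_
      by_cases hj0 : j = 0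
      · subst hj0
        by_cases hi0 : i = 0
        · subst hi0
          simp only [colReplace, if_true, norm_one]
          nlinarith [sq_nonneg (α 0), sq_nonneg (β 0), mul_nonneg (sq_nonneg (α 0)) (sq_nonneg (β 0))]
        · simp [colReplace, hi0]
          positivity
      · have h4 := h.entry i j
        have hk0 : (0 : ℝ) ≤ if i = 0 then 1 else 0 := by positivity
        simp only [colReplace, hj0, if_false]
        nlinarith [mul_nonneg hk0 (sq_nonneg (β j))]
    have h2 := mul_nonneg (detBound_pos α β).le (h.nonneg_left 0)
    simp only [if_true]
    linarith
  · set Z := colReplace M k fun i => if i = 0 then 1 else 0 with hZ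
    set r : ℕ → ℂ := fun i => if i = k then (α k : ℂ) else 1 with hr
    have hZr : ∀ j, ‖Z k j‖ ≤ α k * β j := by
      intro j
      have := h.bound k j
      rw [hZ, colReplace]
      split_ifs with hj
      · simpa using mul_nonneg (h.nonneg_left k) (h.nonneg_right j)
      · simpa [Ne.symm hj] using this
    have hα := h.nonneg_left k
    set X : ℕ → ℕ → ℂ := fun i j => Z i j / r i with hX
    have h1 : Z = fun i j => r i * (1 * X i j) := by
      ext i j
      by_cases hr0 : r i = 0
      · have hz : Z i j = 0 := by
          by_cases hi : i = k
          · have : α k = 0 := by simpa [hr, hi] using hr0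
            simpa [this, hi] using hZr j
          · simp [hr, hi] at hr0
        simp [hX, hz]
      · rw [one_mul, hX, mul_div_cancel₀ _ hr0]
    have hbd : ‖cornerDet X N‖ ≤ detBound α β := by
      refine norm_cornerDet_le_detBound k 0 h.sq_left h.sq_right fun i _ j _ => ?_
      by_cases hi : i = k
      · subst hi
        have h2 : ‖X i j‖ ≤ β j := by
          simp only [hX, hr, if_true, norm_div, Complex.norm_real, Real.norm_of_nonneg hα]
          exact div_le_of_le_mul₀ hα (h.nonneg_right j) (by linarith [hZr j])
        have h3 : ‖X i j‖ ^ 2 ≤ β j ^ 2 := by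
          gcongr
        have hk0 : (0 : ℝ) ≤ if j = i then 1 else 0 := by positivity
        have hd0 : (0 : ℝ) ≤ if i = j then 1 + (α i ^ 2 + β i ^ 2) else 0 := by positivity
        simp only [if_true, h0, if_false]
        nlinarith [mul_nonneg (sq_nonneg (α i)) hk0,
          mul_nonneg (sq_nonneg (α i)) (sq_nonneg (β j))]
      · have h2 : X i j = Z i j := by simp [hX, hr, hi]
        rw [h2]
        by_cases hj : j = k
        · subst hj
          by_cases hi0 : i = 0
          · subst hi0
            simp only [hZ, colReplace, if_true, hi, if_false, norm_one]
            nlinarith [mul_nonneg (sq_nonneg (α 0)) (sq_nonneg (β j)), sq_nonneg (α 0),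
              sq_nonneg (β j)]
          · simp only [hZ, colReplace, if_true, hi0, hi, if_false, norm_zero]
            rw [zero_pow two_ne_zero]
            positivity
        · have h4 := h.entry i j
          have hk0 : (0 : ℝ) ≤ if i = 0 then 1 else 0 := by positivity
          simp only [hZ, colReplace, hj, hi, if_false]
          nlinarith [mul_nonneg hk0 (sq_nonneg (β j))]
    have hpr : ∏ i ∈ Finset.range N, r i = α k := by
      rw [Finset.prod_eq_single_of_mem k (Finset.mem_range.mpr hk)]
      · simp [hr]
      · intro i _ hi
        simp [hr, hi]
    rw [h1, cornerDet_scale, hpr, norm_mul, Complex.norm_real, Real.norm_of_nonneg hα]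
    simp only [Finset.prod_const_one, one_mul, h0, if_false, add_zero]
    rw [mul_comm]
    gcongr

/-- The truncation of `v` solves the `N × N` system up to the tails `t`. Finite Cramer's rule gives
the exact value `det * v k` plus the Cramer numerator of `t`, which is small because the tail of `∑
β j * ‖v j‖` is. -/
theorem tendsto_cramer (h : DomPert M α β) {v u : ℕ → ℂ} (hv : Summable fun i => ‖v i‖ ^ 2)
    (hu : ∀ i, ∑' j, M i j * v j = u i) (k : ℕ) :
    Tendsto (fun N => cornerDet (colReplace M k u) N - cornerDet M N * v k) atTop (𝓝 0) := by
  have hβv : Summable fun j => β j * ‖v j‖ := summable_mul_of_sq h.sq_right hv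
  set ε : ℕ → ℝ := fun N => ∑' j, β (j + N) * ‖v (j + N)‖ with hε
  have hε0 : ∀ N, 0 ≤ ε N := fun N =>
    tsum_nonneg fun j => mul_nonneg (h.nonneg_right _) (norm_nonneg _)
  have hlim : Tendsto (fun N => ε N * detBound α β) atTop (𝓝 0) := by
    simpa using (tendsto_sum_nat_add fun j => β j * ‖v j‖).mul_const (detBound α β)
  refine squeeze_zero_norm' ?_ hlim
  filter_upwards [eventually_gt_atTop k] with N hN
  set t : ℕ → ℂ := fun i => ∑' j, M i (j + N) * v (j + N) with ht
  have hsplit : ∀ i : Fin N, u i = (∑ j : Fin N, M i j * v j) + t i := by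
    intro i
    rw [← hu i, ← (h.summable_mulVec hv i).sum_add_tsum_nat_add N, Finset.sum_range]
  have h1 : (fun i : Fin N => u i) =
      (Matrix.of fun i j : Fin N => M i j).mulVec (fun j => v j) + fun i : Fin N => t i := by
    ext i
    exact hsplit i
  have h2 : cornerDet (colReplace M k u) N - cornerDet M N * v k =
      cornerDet (colReplace M k t) N := by
    rw [cornerDet_colReplace M hN, cornerDet_colReplace M hN, h1, map_add, Pi.add_apply,
      Matrix.cramer_eq_adjugate_mulVec, Matrix.mulVec_mulVec, Matrix.adjugate_mul,
      Matrix.smul_mulVec, Matrix.one_mulVec]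
    simp [cornerDet]
  rw [h2]
  refine h.norm_cornerDet_colReplace_le hN (hε0 N) fun i hi => ?_
  have hs : Summable fun j => α i * (β (j + N) * ‖v (j + N)‖) :=
    ((summable_nat_add_iff (f := fun j => β j * ‖v j‖) N).mpr hβv).mul_left _
  rw [hε, ← tsum_mul_left]
  refine tsum_of_norm_bounded hs.hasSum fun j => ?_
  -- The tail never meets the diagonal, so only the small entries of `M` enter it.
  have hij : i ≠ j + N := by omega
  have := h.bound i (j + N)
  rw [if_neg hij, sub_zero] at this
  rw [norm_mul, ← mul_assoc]
  gcongr

/-- The Cramer numerator for a multiple of `e₀` is a principal minor. The identity holds for every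
square summable solution and also when `infDet M = 0`. -/
theorem infDet_mul_apply_zero (h : DomPert M α β) {v : ℕ → ℂ} {s : ℂ}
    (hv : Summable fun i => ‖v i‖ ^ 2) (hu : ∀ i, ∑' j, M i j * v j = if i = 0 then s else 0) :
    infDet M * v 0 = s * infDet fun i j => M (i + 1) (j + 1) := by
  have h1 := (h.tendsto_cramer hv hu 0).comp (tendsto_add_atTop_nat 1)
  have h2 : Tendsto (fun N => cornerDet M (N + 1) * v 0) atTop (𝓝 (infDet M * v 0)) :=
    (h.tendsto_infDet.comp (tendsto_add_atTop_nat 1)).mul_const _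
  have h3 := ((h.shift 1).tendsto_infDet).const_mul s
  have h4 := h1.add h2
  rw [zero_add] at h4
  refine tendsto_nhds_unique h4 (h3.congr fun N => ?_)
  simp only [Function.comp_apply]
  rw [cornerDet_succ_colReplace_zero]
  ring

theorem colReplace_single (h : DomPert M α β) (k : ℕ) :
    DomPert (colReplace M k fun i => if i = 0 then 1 else 0)
      (fun i => α i + ((if i = 0 then 1 else 0) + if i = k then 1 else 0))
      (fun j => β j + if j = k then 1 else 0) where
  nonneg_left i := by
    have := h.nonneg_left i
    positivity
  nonneg_right i := by
    have := h.nonneg_right i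
    positivity
  sq_left := by
    refine (summable_nat_add_iff (k + 1)).mp
      (((summable_nat_add_iff (k + 1)).mpr h.sq_left).congr fun i => ?_)
    have h2 : i + (k + 1) ≠ k := by omega
    simp [h2]
  sq_right := by
    refine (summable_nat_add_iff (k + 1)).mp
      (((summable_nat_add_iff (k + 1)).mpr h.sq_right).congr fun i => ?_)
    have h2 : i + (k + 1) ≠ k := by omega
    simp [h2]
  bound i j := by
    have hα := h.nonneg_left i
    have hβ := h.nonneg_right j
    by_cases hj : j = k
    · subst hj
      simp only [colReplace, if_true]
      have h1 : ‖(if i = 0 then (1 : ℂ) else 0) - if i = j then 1 else 0‖ ≤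
          (if i = 0 then 1 else 0) + if i = j then 1 else 0 := by
        refine (norm_sub_le _ _).trans (add_le_add ?_ ?_) <;> split_ifs <;> simp
      have h2 : (0 : ℝ) ≤ (if i = 0 then 1 else 0) + if i = j then 1 else 0 := by positivity
      refine h1.trans ?_
      nlinarith [mul_nonneg hα hβ, mul_nonneg h2 hβ]
    · have h2 : (0 : ℝ) ≤ (if i = 0 then 1 else 0) + if i = k then 1 else 0 := by positivity
      simp only [colReplace, hj, if_false, add_zero]
      refine (h.bound i j).trans ?_
      gcongr
      linarith

/-- The solution is the limit of the first columns of the adjugates of the corners. No determinant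
is inverted, so nothing needs to be nonzero here. -/
theorem exists_solution (h : DomPert M α β) :
    ∃ v : ℕ → ℂ, (Summable fun i => ‖v i‖ ^ 2) ∧
      (∀ i, ∑' j, M i j * v j = if i = 0 then infDet M else 0) ∧
      v 0 = infDet fun i j => M (i + 1) (j + 1) := by
  set e : ℕ → ℂ := fun i => if i = 0 then 1 else 0 with he
  have hlim : ∀ k, Tendsto (cornerDet (colReplace M k e)) atTop (𝓝 (infDet (colReplace M k e))) :=
    fun k => (h.colReplace_single k).tendsto_infDet
  set C := detBound α β with hC
  have hC0 : 0 ≤ C := (detBound_pos α β).le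
  set γ : ℕ → ℝ := fun k => C * (α k + if k = 0 then 1 else 0) with hγ
  have hγ0 : ∀ k, 0 ≤ γ k := fun k => by
    have := h.nonneg_left k
    positivity
  have hγs : Summable fun k => γ k ^ 2 := by
    refine (summable_nat_add_iff 1).mp
      ((((summable_nat_add_iff 1).mpr h.sq_left).mul_left (C ^ 2)).congr fun i => ?_)
    simp [hγ, mul_pow]
  have hle : ∀ k, ‖infDet (colReplace M k e)‖ ≤ γ k := fun k =>
    le_of_tendsto (hlim k).norm (by
      filter_upwards [eventually_gt_atTop k] with N hN
      exact h.norm_cornerDet_colReplace_single_le hN)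
  refine ⟨fun k => infDet (colReplace M k e), ?_, fun i => ?_, ?_⟩
  · refine Summable.of_nonneg_of_le (fun _ => sq_nonneg _) (fun k => ?_) hγs
    have := hle k
    gcongr
  · have hbd : Summable fun j => ‖M i j‖ * γ j := by
      have := h.summable_mulVec (v := fun j => (γ j : ℂ)) (by simpa using hγs) i
      refine this.norm.congr fun j => ?_
      rw [norm_mul, Complex.norm_real, Real.norm_of_nonneg (hγ0 j)]
    -- The finite Cramer vectors, extended by zero beyond `N`, are dominated by `γ`; hence the limit
    -- can be taken inside the row sum.
    have h1 : Tendsto (fun N => ∑' j, if j < N then M i j * cornerDet (colReplace M j e) N else 0)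
        atTop (𝓝 (∑' j, M i j * infDet (colReplace M j e))) := by
      refine tendsto_tsum_of_dominated_convergence hbd (fun j => ?_)
        (Eventually.of_forall fun N j => ?_)
      · refine ((hlim j).const_mul (M i j)).congr' ?_
        filter_upwards [eventually_gt_atTop j] with N hN
        simp [hN]
      · split_ifs with hj
        · rw [norm_mul]
          gcongr
          exact h.norm_cornerDet_colReplace_single_le hj
        · simpa using mul_nonneg (norm_nonneg (M i j)) (hγ0 j)
    have h2 : Tendsto (fun N => cornerDet M N * e i) atTop (𝓝 (infDet M * e i)) :=
      h.tendsto_infDet.mul_const _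
    have h3 : infDet M * e i = if i = 0 then infDet M else 0 := by simp [he]
    rw [← h3]
    refine tendsto_nhds_unique (h1.congr' ?_) h2
    filter_upwards [eventually_gt_atTop i] with N hN
    rw [tsum_eq_sum (s := Finset.range N) fun j hj => by
      simp [Finset.mem_range.not.mp hj], Finset.sum_range]
    have h4 := congrFun (Matrix.mulVec_cramer (Matrix.of fun i j : Fin N => M i j)
      (fun i => e i)) ⟨i, hN⟩
    simp only [Matrix.mulVec, dotProduct, Pi.smul_apply, smul_eq_mul, Matrix.of_apply] at h4
    rw [cornerDet, ← h4]
    refine Finset.sum_congr rfl fun j _ => ?_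
    rw [if_pos j.2, cornerDet_colReplace M j.2]
  · have h1 := (hlim 0).comp (tendsto_add_atTop_nat 1)
    refine tendsto_nhds_unique h1 ((h.shift 1).tendsto_infDet.congr fun N => ?_)
    simp only [Function.comp_apply]
    rw [he, cornerDet_succ_colReplace_zero, one_mul]

end DomPert

/-- `M` with its first row replaced by `f`. -/
def rowReplace (M : ℕ → ℕ → ℂ) (f : ℕ → ℂ) (i j : ℕ) : ℂ := if i = 0 then f j else M i j

namespace DomPert

variable {M : ℕ → ℕ → ℂ} {α β : ℕ → ℝ}

theorem rowReplace (h : DomPert M α β) {f : ℕ → ℂ} (hf : Summable fun j => ‖f j‖ ^ 2) :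
    DomPert (rowReplace M f) (fun i => α i + if i = 0 then 1 else 0)
      (fun j => β j + (‖f j‖ + if j = 0 then 1 else 0)) where
  nonneg_left i := by
    have := h.nonneg_left i
    positivity
  nonneg_right i := by
    have := h.nonneg_right i
    positivity
  sq_left := by
    refine (summable_nat_add_iff 1).mp
      (((summable_nat_add_iff 1).mpr h.sq_left).congr fun i => ?_)
    simp
  sq_right := by
    refine (summable_nat_add_iff 1).mp ?_
    have h1 := ((summable_nat_add_iff (f := fun j => β j ^ 2) 1).mpr h.sq_right).mul_left 2
    have h2 := ((summable_nat_add_iff (f := fun j => ‖f j‖ ^ 2) 1).mpr hf).mul_left 2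
    refine Summable.of_nonneg_of_le (fun _ => sq_nonneg _) (fun j => ?_) (h1.add h2)
    simp only [Nat.succ_ne_zero, if_false, add_zero]
    nlinarith [sq_nonneg (β (j + 1) - ‖f (j + 1)‖)]
  bound i j := by
    have hα := h.nonneg_left i
    have hβ := h.nonneg_right j
    have h2 : (0 : ℝ) ≤ ‖f j‖ + if j = 0 then 1 else 0 := by positivity
    by_cases hi : i = 0
    · subst hi
      simp only [_root_.rowReplace, if_true]
      have h1 : ‖f j - if 0 = j then 1 else 0‖ ≤ ‖f j‖ + if j = 0 then 1 else 0 := by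
        refine (norm_sub_le _ _).trans (add_le_add le_rfl ?_)
        by_cases hj : j = 0
        · simp [hj]
        · simp [hj, Ne.symm hj]
      refine h1.trans ?_
      nlinarith [mul_nonneg hα hβ, mul_nonneg hα h2]
    · simp only [_root_.rowReplace, hi, if_false, add_zero]
      refine (h.bound i j).trans ?_
      gcongr
      linarith

/-- With its first row replaced, the matrix sends `v` to a multiple of `e₀`, and the minor obtained
by deleting the first row and column is unchanged. -/
theorem infDet_rowReplace_mul_apply_zero (h : DomPert M α β) {f : ℕ → ℂ}
    (hf : Summable fun j => ‖f j‖ ^ 2) {v : ℕ → ℂ} (hv : Summable fun i => ‖v i‖ ^ 2)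
    (hu : ∀ i, i ≠ 0 → ∑' j, M i j * v j = 0) :
    infDet (_root_.rowReplace M f) * v 0 =
      (∑' j, f j * v j) * infDet fun i j => M (i + 1) (j + 1) := by
  have := (h.rowReplace hf).infDet_mul_apply_zero (v := v) (s := ∑' j, f j * v j) hv fun i => ?_
  · simpa [_root_.rowReplace] using this
  · by_cases hi : i = 0
    · simp [_root_.rowReplace, hi]
    · simpa [_root_.rowReplace, hi] using hu i hi

end DomPert

/-! ### Absolutely convergent Fourier series on the unit circle -/

/-- On the unit circle `h` is the sum of the absolutely convergent series `∑ a k z ^ k`. -/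
structure HasFourier (h : ℂ → ℂ) (a : ℤ → ℂ) : Prop where
  summable : Summable fun k => ‖a k‖
  hasSum : ∀ z : ℂ, ‖z‖ = 1 → HasSum (fun k => a k * z ^ k) (h z)

theorem circleMean_eq_intervalIntegral (h : ℂ → ℂ) :
    circleMean h = (2 * (Real.pi : ℂ))⁻¹ * ∫ θ in (0 : ℝ)..2 * Real.pi, h (circleMap 0 1 θ) := by
  have h1 : ∀ θ : ℝ, deriv (circleMap 0 1) θ • (h (circleMap 0 1 θ) / circleMap 0 1 θ) =
      Complex.I * h (circleMap 0 1 θ) := by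
    intro θ
    have : circleMap 0 1 θ ≠ 0 := circleMap_ne_center one_ne_zero
    rw [deriv_circleMap, smul_eq_mul]
    field_simp
  rw [circleMean, circleIntegral]
  simp_rw [h1]
  rw [intervalIntegral.integral_const_mul, ← mul_assoc]
  congr 1
  have := Complex.I_ne_zero
  field_simp

theorem circleMean_zpow (k : ℤ) : circleMean (fun z => z ^ k) = if k = 0 then 1 else 0 := by
  have h1 : ∀ z ∈ Metric.sphere (0 : ℂ) 1, z ^ k / z = (z - 0) ^ (k - 1) := by
    intro z hz
    have : z ≠ 0 := by
      rintro rfl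
      simp at hz
    rw [sub_zero, zpow_sub_one₀ this, div_eq_mul_inv]
  rw [circleMean, circleIntegral.integral_congr zero_le_one h1]
  split_ifs with hk
  · subst hk
    have h2 : ∀ z : ℂ, (z - 0) ^ ((0 : ℤ) - 1) = (z - 0)⁻¹ := fun z => by simp
    simp_rw [h2]
    rw [circleIntegral.integral_sub_center_inv 0 one_ne_zero, inv_mul_cancel₀]
    exact Complex.two_pi_I_ne_zero
  · rw [circleIntegral.integral_sub_zpow_of_ne (by omega), mul_zero]

theorem norm_zpow_eq_one {z : ℂ} (hz : ‖z‖ = 1) (k : ℤ) : ‖z ^ k‖ = 1 := by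
  rw [norm_zpow, hz, one_zpow]

namespace HasFourier

variable {g h : ℂ → ℂ} {a b : ℤ → ℂ}

theorem circleMean_eq (H : HasFourier h a) (m : ℤ) :
    circleMean (fun z => h z * z ^ (-m)) = a m := by
  have h1 : HasSum (fun k => (2 * (Real.pi : ℂ))⁻¹ * ∫ θ in (0 : ℝ)..2 * Real.pi,
      a k * (circleMap 0 1 θ) ^ k * (circleMap 0 1 θ) ^ (-m))
      (circleMean fun z => h z * z ^ (-m)) := by
    rw [circleMean_eq_intervalIntegral]
    refine HasSum.mul_left _ (intervalIntegral.hasSum_integral_of_dominated_convergence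
      (fun k _ => ‖a k‖) (fun k => ?_) (fun k => ?_) ?_ ?_ ?_)
    · refine Continuous.aestronglyMeasurable ?_
      have hc : ∀ j : ℤ, Continuous fun θ : ℝ => circleMap 0 1 θ ^ j := fun j =>
        (continuous_circleMap 0 1).zpow₀ j fun θ => Or.inl (circleMap_ne_center one_ne_zero)
      exact (continuous_const.mul (hc k)).mul (hc (-m))
    · refine Eventually.of_forall fun θ _ => ?_
      rw [norm_mul, norm_mul, norm_zpow_eq_one (by simp), norm_zpow_eq_one (by simp), mul_one,
        mul_one]
    · exact Eventually.of_forall fun θ _ => H.summable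
    · exact intervalIntegrable_const
    · exact Eventually.of_forall fun θ _ => (H.hasSum _ (by simp)).mul_right _
  have h2 : ∀ k : ℤ, ((2 * (Real.pi : ℂ))⁻¹ * ∫ θ in (0 : ℝ)..2 * Real.pi,
      a k * (circleMap 0 1 θ) ^ k * (circleMap 0 1 θ) ^ (-m)) = if k = m then a m else 0 := by
    intro k
    have h3 : ∀ θ : ℝ, a k * (circleMap 0 1 θ) ^ k * (circleMap 0 1 θ) ^ (-m) =
        a k * (circleMap 0 1 θ) ^ (k - m) := by
      intro θ
      rw [mul_assoc, ← zpow_add₀ (circleMap_ne_center one_ne_zero), sub_eq_add_neg]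
    simp_rw [h3]
    rw [intervalIntegral.integral_const_mul, mul_left_comm,
      ← circleMean_eq_intervalIntegral fun z => z ^ (k - m), circleMean_zpow]
    by_cases hk : k = m
    · simp [hk]
    · simp [hk, sub_eq_zero]
  simp_rw [h2] at h1
  exact h1.unique (hasSum_ite_eq m (a m))

theorem congr (H : HasFourier h a) (hgh : ∀ z : ℂ, ‖z‖ = 1 → h z = g z) : HasFourier g a :=
  ⟨H.summable, fun z hz => hgh z hz ▸ H.hasSum z hz⟩

theorem unique (H : HasFourier h a) (H' : HasFourier g b) (hgh : ∀ z : ℂ, ‖z‖ = 1 → h z = g z) :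
    a = b := by
  ext m
  rw [← H.circleMean_eq m, ← (H'.congr fun z hz => (hgh z hz).symm).circleMean_eq m]

theorem add (H : HasFourier h a) (H' : HasFourier g b) : HasFourier (h + g) (a + b) where
  summable := Summable.of_nonneg_of_le (fun _ => norm_nonneg _) (fun _ => norm_add_le _ _)
    (H.summable.add H'.summable)
  hasSum z hz := by simpa [add_mul] using (H.hasSum z hz).add (H'.hasSum z hz)

theorem neg (H : HasFourier h a) : HasFourier (-h) (-a) where
  summable := by simpa using H.summable
  hasSum z hz := by simpa using (H.hasSum z hz).neg

theorem sub (H : HasFourier h a) (H' : HasFourier g b) : HasFourier (h - g) (a - b) := by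
  simpa [sub_eq_add_neg] using H.add H'.neg

theorem reflect (H : HasFourier h a) : HasFourier (fun z => h z⁻¹) (fun k => a (-k)) where
  summable := (Equiv.neg ℤ).summable_iff.mpr H.summable
  hasSum z hz := by
    have := (Equiv.neg ℤ).hasSum_iff.mpr (H.hasSum z⁻¹ (by simp [hz]))
    simpa [Function.comp_def] using this

end HasFourier

theorem hasFourier_of_summable {a : ℤ → ℂ} (ha : Summable fun k => ‖a k‖) :
    HasFourier (fun z => ∑' k, a k * z ^ k) a where
  summable := ha
  hasSum z hz := by
    refine Summable.hasSum (Summable.of_norm (ha.congr fun k => ?_))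
    rw [norm_mul, norm_zpow_eq_one hz, mul_one]

/-- The convolution of two sequences on `ℤ`. -/
def conv (a b : ℤ → ℂ) (k : ℤ) : ℂ := ∑' j, a j * b (k - j)

theorem summable_conv_prod {a b : ℤ → ℂ} (ha : Summable fun k => ‖a k‖)
    (hb : Summable fun k => ‖b k‖) : Summable fun p : ℤ × ℤ => ‖a p.2 * b (p.1 - p.2)‖ := by
  have h1 : Summable fun p : ℤ × ℤ => ‖a p.1 * b p.2‖ :=
    (ha.mul_of_nonneg hb (fun _ => norm_nonneg _) fun _ => norm_nonneg _).congr fun p => by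
      simp
  let e : ℤ × ℤ ≃ ℤ × ℤ :=
    { toFun := fun p => (p.2, p.1 - p.2)
      invFun := fun p => (p.1 + p.2, p.1)
      left_inv := fun p => by simp
      right_inv := fun p => by simp }
  exact (e.summable_iff (f := fun p : ℤ × ℤ => ‖a p.1 * b p.2‖)).mpr h1

theorem norm_tsum_prod_le {ι κ : Type*} {f : ι × κ → ℂ} (hf : Summable fun p => ‖f p‖) (i : ι) :
    ‖∑' k, f (i, k)‖ ≤ ∑' k, ‖f (i, k)‖ :=
  norm_tsum_le_tsum_norm (hf.prod_factor i)

theorem summable_norm_tsum_prod {ι κ : Type*} {f : ι × κ → ℂ} (hf : Summable fun p => ‖f p‖) :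
    Summable fun i => ‖∑' k, f (i, k)‖ :=
  Summable.of_nonneg_of_le (fun _ => norm_nonneg _) (norm_tsum_prod_le hf) hf.prod

theorem summable_norm_conv {a b : ℤ → ℂ} (ha : Summable fun k => ‖a k‖)
    (hb : Summable fun k => ‖b k‖) : Summable fun k => ‖conv a b k‖ := by
  unfold conv
  exact summable_norm_tsum_prod (f := fun p : ℤ × ℤ => a p.2 * b (p.1 - p.2)) (summable_conv_prod ha hb)

theorem summable_conv_apply {a b : ℤ → ℂ} (ha : Summable fun k => ‖a k‖)
    (hb : Summable fun k => ‖b k‖) (k : ℤ) : Summable fun j => a j * b (k - j) :=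
  ((summable_conv_prod ha hb).prod_factor k).of_norm

theorem tsum_norm_conv_le {a b : ℤ → ℂ} (ha : Summable fun k => ‖a k‖)
    (hb : Summable fun k => ‖b k‖) :
    ∑' k, ‖conv a b k‖ ≤ (∑' k, ‖a k‖) * ∑' k, ‖b k‖ := by
  have h1 := summable_conv_prod ha hb
  have h2 := summable_norm_conv ha hb
  unfold conv at h2 ⊢
  calc ∑' k, ‖∑' j, a j * b (k - j)‖ ≤ ∑' k, ∑' j, ‖a j * b (k - j)‖ :=
        h2.tsum_le_tsum
          (norm_tsum_prod_le (f := fun p : ℤ × ℤ => a p.2 * b (p.1 - p.2)) h1) h1.prod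
    _ = ∑' j, ∑' k, ‖a j * b (k - j)‖ := by
        rw [← h1.tsum_prod, ← (Equiv.prodComm ℤ ℤ).tsum_eq, Summable.tsum_prod]
        · rfl
        · exact (Equiv.prodComm ℤ ℤ).summable_iff.mpr h1
    _ = _ := by
        rw [← tsum_mul_right]
        refine tsum_congr fun j => ?_
        simp_rw [norm_mul]
        rw [tsum_mul_left]
        congr 1
        exact (Equiv.subRight j).tsum_eq fun k => ‖b k‖

/-- Fubini for an absolutely convergent double series whose value is known from summing in one
order. -/
theorem hasSum_of_prod_fiberwise {ι κ : Type*} {f : ι × κ → ℂ} (hf : Summable f) {g : ι → ℂ}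
    {r : κ → ℂ} {s : ℂ} (hg : ∀ i, HasSum (fun k => f (i, k)) (g i))
    (hr : ∀ k, HasSum (fun i => f (i, k)) (r k)) (hs : HasSum g s) : HasSum r s := by
  have h1 : HasSum g (∑' p, f p) := hf.hasSum.prod_fiberwise hg
  have h2 : HasSum (fun p : κ × ι => f (p.2, p.1)) (∑' p, f p) :=
    (Equiv.prodComm κ ι).hasSum_iff.mpr hf.hasSum
  rw [hs.unique h1]
  exact HasSum.prod_fiberwise h2 hr

theorem HasFourier.mul {g h : ℂ → ℂ} {a b : ℤ → ℂ} (H : HasFourier h a) (H' : HasFourier g b) :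
    HasFourier (h * g) (conv a b) where
  summable := summable_norm_conv H.summable H'.summable
  hasSum z hz := by
    have hz0 : z ≠ 0 := by
      rintro rfl
      simp at hz
    have hsum : Summable fun p : ℤ × ℤ => a p.1 * b (p.2 - p.1) * z ^ p.2 := by
      have h0 : Summable fun p : ℤ × ℤ => ‖a p.1 * b (p.2 - p.1)‖ :=
        (Equiv.prodComm ℤ ℤ).summable_iff.mpr (summable_conv_prod H.summable H'.summable)
      refine Summable.of_norm (h0.congr fun p => ?_)
      rw [norm_mul _ (z ^ _), norm_zpow_eq_one hz, mul_one]
    refine hasSum_of_prod_fiberwise (f := fun p : ℤ × ℤ => a p.1 * b (p.2 - p.1) * z ^ p.2)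
      (g := fun j => a j * z ^ j * g z) (r := fun k => conv a b k * z ^ k) hsum (fun j => ?_)
      (fun k => ?_) ((H.hasSum z hz).mul_right (g z))
    · have h3 := ((Equiv.subRight j).hasSum_iff.mpr (H'.hasSum z hz)).mul_left (a j * z ^ j)
      have h4 : (fun k => (a j * z ^ j) * ((fun k => b k * z ^ k) ∘ (Equiv.subRight j)) k) =
          fun k => a j * b (k - j) * z ^ k := by
        ext k
        have h5 : z ^ k = z ^ j * z ^ (k - j) := by
          rw [← zpow_add₀ hz0, add_sub_cancel]
        simp only [Function.comp_apply, Equiv.subRight_apply, h5]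
        ring
      rw [h4] at h3
      exact h3
    · unfold conv
      exact (summable_conv_apply H.summable H'.summable k).hasSum.mul_right (z ^ k)

/-! ### Exponentials -/

/-- The convolution powers of a sequence. -/
def convPow (a : ℤ → ℂ) : ℕ → ℤ → ℂ
  | 0 => fun k => if k = 0 then 1 else 0
  | n + 1 => conv a (convPow a n)

/-- The Fourier coefficients of the exponential of `∑ a k z ^ k`. -/
def convExp (a : ℤ → ℂ) (k : ℤ) : ℂ := ∑' n : ℕ, convPow a n k / (n.factorial : ℂ)

theorem HasFourier.pow {h : ℂ → ℂ} {a : ℤ → ℂ} (H : HasFourier h a) (n : ℕ) :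
    HasFourier (h ^ n) (convPow a n) := by
  induction n with
  | zero =>
    refine ⟨?_, fun z hz => ?_⟩
    · exact summable_of_ne_finset_zero (s := {0}) fun k hk => by
        have : k ≠ 0 := by simpa using hk
        simp [convPow, this]
    · have h0 : (fun k : ℤ => convPow a 0 k * z ^ k) = fun k => if k = 0 then 1 else 0 := by
        ext k
        by_cases hk : k = 0 <;> simp [convPow, hk]
      rw [h0, pow_zero]
      exact hasSum_ite_eq 0 1
  | succ n ih =>
    rw [pow_succ']
    exact H.mul ih

theorem tsum_norm_convPow_le {h : ℂ → ℂ} {a : ℤ → ℂ} (H : HasFourier h a) (n : ℕ) :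
    ∑' k, ‖convPow a n k‖ ≤ (∑' k, ‖a k‖) ^ n := by
  induction n with
  | zero =>
    rw [tsum_eq_single 0 fun k hk => by simp [convPow, hk]]
    simp [convPow]
  | succ n ih =>
    rw [pow_succ']
    refine (tsum_norm_conv_le H.summable (H.pow n).summable).trans ?_
    gcongr

theorem HasFourier.summable_convPow_div {h : ℂ → ℂ} {a : ℤ → ℂ} (H : HasFourier h a) :
    Summable fun p : ℕ × ℤ => ‖convPow a p.1 p.2 / (p.1.factorial : ℂ)‖ := by
  rw [summable_prod_of_nonneg fun _ => norm_nonneg _]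
  have h1 : ∀ n : ℕ, ∑' k, ‖convPow a n k / (n.factorial : ℂ)‖ =
      (∑' k, ‖convPow a n k‖) / n.factorial := by
    intro n
    rw [← tsum_div_const]
    simp
  constructor
  · intro n
    simpa using (H.pow n).summable.div_const (n.factorial : ℝ)
  · refine Summable.of_nonneg_of_le (fun n => tsum_nonneg fun _ => norm_nonneg _) (fun n => ?_)
      (Real.summable_pow_div_factorial (∑' k, ‖a k‖))
    simp only [h1]
    gcongr
    exact tsum_norm_convPow_le H n

theorem HasFourier.exp {h : ℂ → ℂ} {a : ℤ → ℂ} (H : HasFourier h a) :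
    HasFourier (fun z => Complex.exp (h z)) (convExp a) where
  summable := by
    have h1 : Summable fun p : ℤ × ℕ => ‖convPow a p.2 p.1 / (p.2.factorial : ℂ)‖ :=
      (Equiv.prodComm ℤ ℕ).summable_iff.mpr H.summable_convPow_div
    unfold convExp
    exact summable_norm_tsum_prod
      (f := fun p : ℤ × ℕ => convPow a p.2 p.1 / (p.2.factorial : ℂ)) h1
  hasSum z hz := by
    have h0 := H.summable_convPow_div
    have hsum : Summable fun p : ℕ × ℤ => convPow a p.1 p.2 / (p.1.factorial : ℂ) * z ^ p.2 := by
      refine Summable.of_norm (h0.congr fun p => ?_)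
      rw [norm_mul _ (z ^ _), norm_zpow_eq_one hz, mul_one]
    have h3 : HasSum (fun n : ℕ => (h z) ^ n / (n.factorial : ℂ)) (Complex.exp (h z)) := by
      rw [Complex.exp_eq_exp_ℂ]
      exact NormedSpace.expSeries_div_hasSum_exp (h z)
    refine hasSum_of_prod_fiberwise
      (f := fun p : ℕ × ℤ => convPow a p.1 p.2 / (p.1.factorial : ℂ) * z ^ p.2)
      (r := fun k => convExp a k * z ^ k) hsum (fun n => ?_) (fun k => ?_) h3
    · have := ((H.pow n).hasSum z hz).div_const (n.factorial : ℂ)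
      simpa [div_mul_eq_mul_div] using this
    · have h4 : Summable fun p : ℤ × ℕ => ‖convPow a p.2 p.1 / (p.2.factorial : ℂ)‖ :=
        (Equiv.prodComm ℤ ℕ).summable_iff.mpr h0
      unfold convExp
      exact (h4.prod_factor k).of_norm.hasSum.mul_right (z ^ k)

/-- The sequence vanishes on one side of the origin: at the `k` with `σ * k < 0`. -/
def OneSided (σ : ℤ) (a : ℤ → ℂ) : Prop := ∀ k, σ * k < 0 → a k = 0

theorem OneSided.conv {σ : ℤ} {a b : ℤ → ℂ} (ha : OneSided σ a) (hb : OneSided σ b) :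
    OneSided σ (conv a b) := by
  intro k hk
  refine (tsum_congr fun j => ?_).trans tsum_zero
  by_cases hj : σ * j < 0
  · rw [ha j hj, zero_mul]
  · rw [hb (k - j) (by rw [mul_sub]; omega), mul_zero]

/-- Only `j = 0` avoids both vanishing half-lines, so the constant coefficient is multiplicative;
this yields `f₊(0)` and `f₋(∞)` after exponentiation. -/
theorem OneSided.conv_zero {σ : ℤ} (hσ : σ ≠ 0) {a b : ℤ → ℂ} (ha : OneSided σ a)
    (hb : OneSided σ b) : _root_.conv a b 0 = a 0 * b 0 := by
  rw [_root_.conv, tsum_eq_single 0, sub_zero]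
  intro j hj
  have h0 : σ * j ≠ 0 := mul_ne_zero hσ hj
  by_cases hj : σ * j < 0
  · rw [ha j hj, zero_mul]
  · rw [hb (0 - j) (by rw [mul_sub]; omega), mul_zero]

theorem OneSided.convPow {σ : ℤ} {a : ℤ → ℂ} (ha : OneSided σ a) (n : ℕ) :
    OneSided σ (convPow a n) := by
  induction n with
  | zero =>
    intro k hk
    have : k ≠ 0 := by
      rintro rfl
      simp at hk
    simp [_root_.convPow, this]
  | succ n ih => exact ha.conv ih

theorem OneSided.convPow_zero {σ : ℤ} (hσ : σ ≠ 0) {a : ℤ → ℂ} (ha : OneSided σ a) (n : ℕ) :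
    _root_.convPow a n 0 = a 0 ^ n := by
  induction n with
  | zero => simp [_root_.convPow]
  | succ n ih => rw [pow_succ', ← ih, _root_.convPow, ha.conv_zero hσ (ha.convPow n)]

theorem OneSided.convExp {σ : ℤ} {a : ℤ → ℂ} (ha : OneSided σ a) : OneSided σ (convExp a) := by
  intro k hk
  refine (tsum_congr fun n => ?_).trans tsum_zero
  rw [ha.convPow n k hk, zero_div]

theorem OneSided.convExp_zero {σ : ℤ} (hσ : σ ≠ 0) {a : ℤ → ℂ} (ha : OneSided σ a) :
    _root_.convExp a 0 = Complex.exp (a 0) := by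
  simp_rw [_root_.convExp, ha.convPow_zero hσ, Complex.exp_eq_exp_ℂ]
  exact (NormedSpace.expSeries_div_hasSum_exp (a 0)).tsum_eq

theorem OneSided.neg {σ : ℤ} {a : ℤ → ℂ} (ha : OneSided σ a) : OneSided σ (-a) := by
  intro k hk
  simp [ha k hk]

/-! ### The Besov type seminorm -/

/-- `∑ |k| |a k|²`. -/
def besovSq (a : ℤ → ℂ) : ENNReal := ∑' k : ℤ, (k.natAbs : ENNReal) * ‖a k‖ₑ ^ 2

theorem ENNReal.two_mul_le_add_sq' (x y : ENNReal) : 2 * (x * y) ≤ x ^ 2 + y ^ 2 := by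
  rcases eq_or_ne x ⊤ with rfl | hx
  · simp
  rcases eq_or_ne y ⊤ with rfl | hy
  · simp
  lift x to NNReal using hx
  lift y to NNReal using hy
  have := two_mul_le_add_sq x y
  rw [mul_assoc] at this
  exact_mod_cast this

/-- Cauchy–Schwarz with respect to the weights `y`, obtained by expanding the square and using `2 f
i f j ≤ f i² + f j²`. -/
theorem ENNReal.tsum_mul_sq_le {ι : Type*} (f y : ι → ENNReal) :
    (∑' i, f i * y i) ^ 2 ≤ (∑' i, f i ^ 2 * y i) * ∑' i, y i := by
  have h1 : 2 * (∑' i, f i * y i) ^ 2 ≤ 2 * ((∑' i, f i ^ 2 * y i) * ∑' i, y i) := by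
    calc 2 * (∑' i, f i * y i) ^ 2 = ∑' i, ∑' j, 2 * (f i * f j) * (y i * y j) := by
          rw [sq, ← ENNReal.tsum_mul_right, ← ENNReal.tsum_mul_left]
          refine tsum_congr fun i => ?_
          rw [← ENNReal.tsum_mul_left, ← ENNReal.tsum_mul_left]
          refine tsum_congr fun j => ?_
          ring
      _ ≤ ∑' i, ∑' j, (f i ^ 2 + f j ^ 2) * (y i * y j) := by
          refine ENNReal.tsum_le_tsum fun i => ENNReal.tsum_le_tsum fun j => ?_
          gcongr
          exact ENNReal.two_mul_le_add_sq' _ _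
      _ = _ := by
          have h2 : ∀ i j, (f i ^ 2 + f j ^ 2) * (y i * y j) =
              f i ^ 2 * y i * y j + y i * (f j ^ 2 * y j) := fun i j => by ring
          simp_rw [h2, ENNReal.tsum_add, ENNReal.tsum_mul_left, ENNReal.tsum_mul_right]
          ring
  exact (ENNReal.mul_le_mul_iff_right two_ne_zero ENNReal.ofNat_ne_top).mp h1

/-- Young's inequality for `ℓ² * ℓ¹ ⊆ ℓ²`. -/
theorem tsum_young_le (f y : ℤ → ENNReal) :
    ∑' k, (∑' j, f j * y (k - j)) ^ 2 ≤ (∑' j, f j ^ 2) * (∑' j, y j) ^ 2 := by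
  have hy : ∀ k, ∑' j, y (k - j) = ∑' j, y j := fun k => (Equiv.subLeft k).tsum_eq y
  have hy' : ∀ j, ∑' k, y (k - j) = ∑' j, y j := fun j => (Equiv.subRight j).tsum_eq y
  calc ∑' k, (∑' j, f j * y (k - j)) ^ 2 ≤ ∑' k, (∑' j, f j ^ 2 * y (k - j)) * ∑' j, y j :=
        ENNReal.tsum_le_tsum fun k => by
          rw [← hy k]
          exact ENNReal.tsum_mul_sq_le f fun j => y (k - j)
    _ = _ := by
        rw [ENNReal.tsum_mul_right, ENNReal.tsum_comm]
        simp_rw [ENNReal.tsum_mul_left, hy', ENNReal.tsum_mul_right]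
        ring

theorem NNReal.sqrt_natAbs_le (k j : ℤ) : NNReal.sqrt (k.natAbs : NNReal) ≤
    NNReal.sqrt (j.natAbs : NNReal) + NNReal.sqrt ((k - j).natAbs : NNReal) := by
  rw [NNReal.sqrt_le_iff_le_sq, add_sq, NNReal.sq_sqrt, NNReal.sq_sqrt]
  have h1 : k.natAbs ≤ j.natAbs + (k - j).natAbs := by omega
  have h2 : (k.natAbs : NNReal) ≤ j.natAbs + (k - j).natAbs := by exact_mod_cast h1
  refine h2.trans ?_
  rw [add_right_comm]
  exact le_self_add

theorem ENNReal.add_sq_le' (x y : ENNReal) : (x + y) ^ 2 ≤ 2 * x ^ 2 + 2 * y ^ 2 := by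
  have := ENNReal.two_mul_le_add_sq' x y
  calc (x + y) ^ 2 = x ^ 2 + y ^ 2 + 2 * (x * y) := by ring
    _ ≤ x ^ 2 + y ^ 2 + (x ^ 2 + y ^ 2) := by gcongr
    _ = _ := by ring

/-- Since `√|k| ≤ √|j| + √|k - j|`, the weight can be moved onto one of the two factors; Young's
inequality then handles each term. -/
theorem besovSq_conv_le (a b : ℤ → ℂ) : besovSq (conv a b) ≤
    2 * besovSq a * (∑' k, ‖b k‖ₑ) ^ 2 + 2 * besovSq b * (∑' k, ‖a k‖ₑ) ^ 2 := by
  set s : ℤ → ENNReal := fun k => (NNReal.sqrt (k.natAbs : NNReal) : ENNReal) with hs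
  have hs2 : ∀ k, s k ^ 2 = (k.natAbs : ENNReal) := by
    intro k
    rw [hs]
    simp only
    rw [← ENNReal.coe_pow, NNReal.sq_sqrt]
    simp
  have hle : ∀ k j, s k ≤ s j + s (k - j) := by
    intro k j
    simp only [hs]
    exact_mod_cast NNReal.sqrt_natAbs_le k j
  have hab : ∀ x : ℤ → ℂ, ∑' j, (s j * ‖x j‖ₑ) ^ 2 = besovSq x := by
    intro x
    simp_rw [mul_pow, hs2]
    rfl
  have h1 : ∀ k, (k.natAbs : ENNReal) * ‖conv a b k‖ₑ ^ 2 ≤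
      2 * (∑' j, (s j * ‖a j‖ₑ) * ‖b (k - j)‖ₑ) ^ 2 +
        2 * (∑' j, (s j * ‖b j‖ₑ) * ‖a (k - j)‖ₑ) ^ 2 := by
    intro k
    refine le_trans ?_ (ENNReal.add_sq_le' _ _)
    rw [← hs2, ← mul_pow]
    gcongr
    have h2 : ‖conv a b k‖ₑ ≤ ∑' j, ‖a j‖ₑ * ‖b (k - j)‖ₑ := by
      refine (enorm_tsum_le_tsum_enorm).trans_eq ?_
      simp
    have h3 : ∑' j, (s j * ‖b j‖ₑ) * ‖a (k - j)‖ₑ =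
        ∑' j, (s (k - j) * ‖b (k - j)‖ₑ) * ‖a j‖ₑ := by
      rw [← (Equiv.subLeft k).tsum_eq]
      simp
    rw [h3, ← ENNReal.tsum_add]
    refine (mul_le_mul_right h2 _).trans ?_
    rw [← ENNReal.tsum_mul_left]
    refine ENNReal.tsum_le_tsum fun j => ?_
    calc s k * (‖a j‖ₑ * ‖b (k - j)‖ₑ) ≤ (s j + s (k - j)) * (‖a j‖ₑ * ‖b (k - j)‖ₑ) := by
          gcongr
          exact hle k j
      _ = _ := by ring
  refine (ENNReal.tsum_le_tsum h1).trans ?_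
  rw [ENNReal.tsum_add, ENNReal.tsum_mul_left, ENNReal.tsum_mul_left, mul_assoc, mul_assoc]
  gcongr
  · rw [← hab a]
    exact tsum_young_le (fun j => s j * ‖a j‖ₑ) fun j => ‖b j‖ₑ
  · rw [← hab b]
    exact tsum_young_le (fun j => s j * ‖b j‖ₑ) fun j => ‖a j‖ₑ

theorem besovSq_convPow_le (a : ℤ → ℂ) (n : ℕ)
    (hA : ∀ n, ∑' k, ‖convPow a n k‖ₑ ≤ (∑' k, ‖a k‖ₑ) ^ n) :
    besovSq (convPow a n) ≤ (2 * (∑' k, ‖a k‖ₑ) ^ 2 + 2) ^ n * besovSq a := by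
  induction n with
  | zero =>
    have : besovSq (convPow a 0) = 0 := by
      refine ENNReal.tsum_eq_zero.mpr fun k => ?_
      by_cases hk : k = 0 <;> simp [convPow, hk]
    simp [this]
  | succ n ih =>
    set A := ∑' k, ‖a k‖ₑ with hAdef
    have h1 : (∑' k, ‖convPow a n k‖ₑ) ^ 2 ≤ (2 * A ^ 2 + 2) ^ n := by
      calc (∑' k, ‖convPow a n k‖ₑ) ^ 2 ≤ (A ^ n) ^ 2 := by
            gcongr
            exact hA n
        _ = (A ^ 2) ^ n := by rw [← pow_mul, ← pow_mul, mul_comm]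
        _ ≤ _ := by
            gcongr
            calc A ^ 2 ≤ A ^ 2 + (A ^ 2 + 2) := le_self_add
              _ = _ := by ring
    calc besovSq (convPow a (n + 1)) ≤
          2 * besovSq a * (∑' k, ‖convPow a n k‖ₑ) ^ 2 + 2 * besovSq (convPow a n) * A ^ 2 :=
          besovSq_conv_le _ _
      _ ≤ 2 * besovSq a * (2 * A ^ 2 + 2) ^ n +
          2 * ((2 * A ^ 2 + 2) ^ n * besovSq a) * A ^ 2 := by gcongr
      _ = _ := by ring

theorem HasFourier.tsum_enorm_ne_top {h : ℂ → ℂ} {a : ℤ → ℂ} (H : HasFourier h a) :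
    ∑' k, ‖a k‖ₑ ≠ ⊤ :=
  tsum_enorm_ne_top_iff_summable_norm.mpr H.summable

theorem HasFourier.tsum_enorm_eq {h : ℂ → ℂ} {a : ℤ → ℂ} (H : HasFourier h a) :
    ∑' k, ‖a k‖ₑ = ENNReal.ofReal (∑' k, ‖a k‖) := by
  rw [ENNReal.ofReal_tsum_of_nonneg (fun _ => norm_nonneg _) H.summable]
  simp_rw [ofReal_norm]

/-- The seminorms of the convolution powers grow at most geometrically, so the weights `1 / n!` beat
them. Cauchy–Schwarz with these weights moves the square inside the exponential series. -/
theorem HasFourier.besovSq_convExp_ne_top {h : ℂ → ℂ} {a : ℤ → ℂ} (H : HasFourier h a)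
    (ha : besovSq a ≠ ⊤) : besovSq (convExp a) ≠ ⊤ := by
  have hA : ∀ n, ∑' k, ‖convPow a n k‖ₑ ≤ (∑' k, ‖a k‖ₑ) ^ n := by
    intro n
    rw [(H.pow n).tsum_enorm_eq, H.tsum_enorm_eq,
      ← ENNReal.ofReal_pow (tsum_nonneg fun _ => norm_nonneg _)]
    exact ENNReal.ofReal_le_ofReal (tsum_norm_convPow_le H n)
  set y : ℕ → ENNReal := fun n => ENNReal.ofReal (1 / n.factorial) with hy
  have hexp : ∀ x : ENNReal, x ≠ ⊤ → ∑' n, x ^ n * y n ≠ ⊤ := by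
    intro x hx
    have h1 := Real.summable_pow_div_factorial x.toReal
    have h2 : ∀ n, x ^ n * y n = ENNReal.ofReal (x.toReal ^ n / n.factorial) := by
      intro n
      rw [div_eq_mul_one_div, ENNReal.ofReal_mul (by positivity),
        ENNReal.ofReal_pow ENNReal.toReal_nonneg, ENNReal.ofReal_toReal hx]
    simp_rw [h2]
    rw [← ENNReal.ofReal_tsum_of_nonneg (fun n => by positivity) h1]
    exact ENNReal.ofReal_ne_top
  have hy1 : ∑' n, y n ≠ ⊤ := by simpa using hexp 1 ENNReal.one_ne_top
  have h1 : ∀ k, (k.natAbs : ENNReal) * ‖convExp a k‖ₑ ^ 2 ≤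
      ∑' n, (k.natAbs : ENNReal) * ‖convPow a n k‖ₑ ^ 2 * y n * ∑' n, y n := by
    intro k
    have h2 : ‖convExp a k‖ₑ ≤ ∑' n, ‖convPow a n k‖ₑ * y n := by
      refine enorm_tsum_le_tsum_enorm.trans_eq (tsum_congr fun n => ?_)
      rw [div_eq_mul_one_div, enorm_mul, hy]
      congr 1
      rw [← ofReal_norm]
      simp
    calc (k.natAbs : ENNReal) * ‖convExp a k‖ₑ ^ 2 ≤
          k.natAbs * ((∑' n, ‖convPow a n k‖ₑ ^ 2 * y n) * ∑' n, y n) := by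
          gcongr
          exact (pow_le_pow_left' h2 2).trans (ENNReal.tsum_mul_sq_le _ _)
      _ = _ := by
          have h3 : ∑' n, (k.natAbs : ENNReal) * ‖convPow a n k‖ₑ ^ 2 * y n =
              k.natAbs * ∑' n, ‖convPow a n k‖ₑ ^ 2 * y n := by
            rw [← ENNReal.tsum_mul_left]
            simp_rw [mul_assoc]
          rw [← mul_assoc, ← h3, ← ENNReal.tsum_mul_right]
  refine ne_top_of_le_ne_top ?_ (ENNReal.tsum_le_tsum h1)
  simp_rw [ENNReal.tsum_mul_right]
  refine ENNReal.mul_ne_top ?_ hy1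
  rw [ENNReal.tsum_comm]
  simp_rw [ENNReal.tsum_mul_right]
  set K := 2 * (∑' k, ‖a k‖ₑ) ^ 2 + 2 with hK
  have hKt : K ≠ ⊤ := ENNReal.add_ne_top.mpr ⟨ENNReal.mul_ne_top ENNReal.ofNat_ne_top
    (ENNReal.pow_ne_top H.tsum_enorm_ne_top), ENNReal.ofNat_ne_top⟩
  refine ne_top_of_le_ne_top (ENNReal.mul_ne_top (hexp K hKt) ha) ?_
  rw [← ENNReal.tsum_mul_right]
  refine ENNReal.tsum_le_tsum fun n => ?_
  refine (mul_le_mul_left (besovSq_convPow_le a n hA) _).trans_eq ?_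
  ring

/-- The Hankel matrix built from the negative Fourier coefficients is square summable. -/
theorem summable_hankel {a : ℤ → ℂ} (ha : besovSq a ≠ ⊤) :
    Summable fun p : ℕ × ℕ => ‖a (-((p.1 : ℤ) + p.2 + 1))‖ ^ 2 := by
  have h1 : ∑' p : ℕ × ℕ, ‖a (-((p.1 : ℤ) + p.2 + 1))‖ₑ ^ 2 ≤ besovSq a := by
    -- The Hankel matrix is constant on antidiagonals, and the `n`-th one has `n + 1` entries, which
    -- is exactly the weight of the index `-(n + 1)`.
    rw [← (Finset.HasAntidiagonal.sigmaAntidiagonalEquivProd (A := ℕ)).tsum_eq, ENNReal.tsum_sigma']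
    have h2 : ∀ n : ℕ, (∑' q : Finset.HasAntidiagonal.antidiagonal n, ‖a (-(((Finset.HasAntidiagonal.sigmaAntidiagonalEquivProd
        ⟨n, q⟩).1 : ℤ) + (Finset.HasAntidiagonal.sigmaAntidiagonalEquivProd ⟨n, q⟩).2 + 1))‖ₑ ^ 2) =
        ((-((n : ℤ) + 1)).natAbs : ENNReal) * ‖a (-((n : ℤ) + 1))‖ₑ ^ 2 := by
      intro n
      have h3 : ∀ q : Finset.HasAntidiagonal.antidiagonal n, ‖a (-(((Finset.HasAntidiagonal.sigmaAntidiagonalEquivProd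
          ⟨n, q⟩).1 : ℤ) + (Finset.HasAntidiagonal.sigmaAntidiagonalEquivProd ⟨n, q⟩).2 + 1))‖ₑ ^ 2 =
          ‖a (-((n : ℤ) + 1))‖ₑ ^ 2 := by
        intro q
        have := Finset.HasAntidiagonal.mem_antidiagonal.mp q.2
        simp only [Finset.HasAntidiagonal.sigmaAntidiagonalEquivProd_apply]
        congr 4
        push_cast [← this]
        ring
      simp_rw [h3]
      rw [tsum_fintype, Finset.sum_const, nsmul_eq_mul]
      congr 2
      simp
      omega
    simp_rw [h2]
    exact ENNReal.tsum_comp_le_tsum_of_injective (f := fun n : ℕ => -((n : ℤ) + 1))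
      (fun m n h => by simpa using h) fun k => (k.natAbs : ENNReal) * ‖a k‖ₑ ^ 2
  have h2 := ENNReal.summable_toReal (ne_top_of_le_ne_top ha h1)
  refine h2.congr fun p => ?_
  rw [ENNReal.toReal_pow, toReal_enorm]

/-! ### Products of Hankel matrices -/

theorem tsum_mul_le_sqrt_mul_sqrt {ι : Type*} {f g : ι → ℝ} (hf0 : ∀ i, 0 ≤ f i)
    (hg0 : ∀ i, 0 ≤ g i) (hf : Summable fun i => f i ^ 2) (hg : Summable fun i => g i ^ 2) :
    ∑' i, f i * g i ≤ √(∑' i, f i ^ 2) * √(∑' i, g i ^ 2) := by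
  refine Real.tsum_le_of_sum_le (fun i => mul_nonneg (hf0 i) (hg0 i)) fun s => ?_
  refine (Real.sum_mul_le_sqrt_mul_sqrt s f g).trans ?_
  gcongr
  · exact hf.sum_le_tsum s fun i _ => sq_nonneg _
  · exact hg.sum_le_tsum s fun i _ => sq_nonneg _

theorem norm_tsum_mul_le_sqrt {ι : Type*} {f g : ι → ℂ} (hf : Summable fun i => ‖f i‖ ^ 2)
    (hg : Summable fun i => ‖g i‖ ^ 2) :
    ‖∑' i, f i * g i‖ ≤ √(∑' i, ‖f i‖ ^ 2) * √(∑' i, ‖g i‖ ^ 2) := by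
  have h1 : Summable fun i => ‖f i * g i‖ := by
    simpa using summable_mul_of_sq hf hg
  refine (norm_tsum_le_tsum_norm h1).trans ?_
  simp_rw [norm_mul]
  exact tsum_mul_le_sqrt_mul_sqrt (fun _ => norm_nonneg _) (fun _ => norm_nonneg _) hf hg

/-- The Hankel matrix with entries `F (l + m)`, `l ≥ 0`, `m ≥ 1`, is square summable. -/
def HankelSq (F : ℤ → ℂ) : Prop :=
  Summable fun p : ℕ × ℕ => ‖F ((p.1 : ℤ) + ((p.2 : ℤ) + 1))‖ ^ 2

/-- The norm of a row of the Hankel matrix of `F`. -/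
def hankelRow (F : ℤ → ℂ) (l : ℕ) : ℝ := √(∑' k : ℕ, ‖F ((l : ℤ) + ((k : ℤ) + 1))‖ ^ 2)

theorem hankelRow_nonneg (F : ℤ → ℂ) (l : ℕ) : 0 ≤ hankelRow F l := Real.sqrt_nonneg _

theorem hankelRow_sq (F : ℤ → ℂ) (l : ℕ) :
    hankelRow F l ^ 2 = ∑' k : ℕ, ‖F ((l : ℤ) + ((k : ℤ) + 1))‖ ^ 2 :=
  Real.sq_sqrt (tsum_nonneg fun _ => sq_nonneg _)

namespace HankelSq

variable {F Fbar : ℤ → ℂ}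

theorem row (hF : HankelSq F) (l : ℕ) : Summable fun k : ℕ => ‖F ((l : ℤ) + ((k : ℤ) + 1))‖ ^ 2 :=
  hF.prod_factor l

theorem summable_row_sq (hF : HankelSq F) : Summable fun l => hankelRow F l ^ 2 := by
  simp_rw [hankelRow_sq]
  exact hF.prod

theorem summable_row_sq_add (hF : HankelSq F) (n : ℕ) :
    Summable fun l => hankelRow F (n + l) ^ 2 := by
  simp_rw [add_comm n]
  exact (summable_nat_add_iff (f := fun l => hankelRow F l ^ 2) n).mpr hF.summable_row_sq

theorem summable_succ_sq (hF : HankelSq F) (n : ℕ) :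
    Summable fun j : ℕ => ‖F ((n : ℤ) + 1 + j)‖ ^ 2 :=
  (hF.row n).congr fun j => by rw [add_assoc, add_comm (1 : ℤ)]

theorem summable_kernel (hF : HankelSq F) (hFbar : HankelSq Fbar) (l m : ℕ) :
    Summable fun k : ℕ => Fbar ((l : ℤ) + (k + 1)) * F ((m : ℤ) + (k + 1)) :=
  Summable.of_norm (by simpa using summable_mul_of_sq (hFbar.row l) (hF.row m))

theorem norm_kernelG_le (hF : HankelSq F) (hFbar : HankelSq Fbar) (l m : ℕ) :
    ‖kernelG F Fbar l m‖ ≤ hankelRow Fbar l * hankelRow F m := by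
  rw [kernelG, norm_neg]
  exact norm_tsum_mul_le_sqrt (hFbar.row l) (hF.row m)

/-- Cauchy–Schwarz bounds each entry of `G` by a product of row norms of two Hankel matrices, and
square summability of these norms is square summability of the matrices. -/
theorem domPert (hF : HankelSq F) (hFbar : HankelSq Fbar) (lam : ℂ) (n : ℕ) :
    DomPert (extMatrix lam (kernelG F Fbar) n) (fun i => ‖lam‖ ^ 2 * hankelRow Fbar (n + i))
      (fun j => hankelRow F (n + j)) where
  nonneg_left i := mul_nonneg (sq_nonneg _) (hankelRow_nonneg _ _)
  nonneg_right i := hankelRow_nonneg _ _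
  sq_left := by
    simp_rw [mul_pow]
    exact (hFbar.summable_row_sq_add n).mul_left _
  sq_right := hF.summable_row_sq_add n
  bound i j := by
    rw [extMatrix, add_sub_cancel_left, norm_mul, norm_pow, mul_assoc]
    gcongr
    exact_mod_cast hF.norm_kernelG_le hFbar (n + i) (n + j)

end HankelSq

/-! ### Infinite determinants and linear systems for the Hankel kernel. -/

theorem kernelG_swap (F Fbar : ℤ → ℂ) (l m : ℤ) : kernelG Fbar F l m = kernelG F Fbar m l := by
  simp only [kernelG, mul_comm]

theorem extMatrix_kernelG_swap (F Fbar : ℤ → ℂ) (lam : ℂ) (n : ℕ) :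
    extMatrix lam (kernelG Fbar F) n = fun i j => extMatrix lam (kernelG F Fbar) n j i := by
  ext i j
  simp only [extMatrix, kernelG_swap, eq_comm]

theorem cornerDet_transpose (M : ℕ → ℕ → ℂ) (N : ℕ) :
    cornerDet (fun i j => M j i) N = cornerDet M N := by
  rw [cornerDet, cornerDet, ← Matrix.det_transpose]
  rfl

theorem extDet_kernelG_swap (F Fbar : ℤ → ℂ) (lam : ℂ) (n : ℕ) :
    extDet lam (kernelG Fbar F) n = extDet lam (kernelG F Fbar) n := by
  rw [extDet, extDet, infDet, infDet, extMatrix_kernelG_swap]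
  congr 1
  ext N
  exact cornerDet_transpose _ N

theorem extMatrix_shift (lam : ℂ) (G : ℤ → ℤ → ℂ) (n k : ℕ) :
    (fun i j => extMatrix lam G n (i + k) (j + k)) = extMatrix lam G (n + k) := by
  ext i j
  simp only [extMatrix, add_left_inj]
  push_cast
  congr 3 <;> ring

namespace HankelSq

variable {F Fbar : ℤ → ℂ}

theorem summable_scaled_succ_sq (hF : HankelSq F) (lam : ℂ) (n : ℕ) :
    Summable fun j : ℕ => ‖lam * F ((n : ℤ) + 1 + j)‖ ^ 2 := by
  simp_rw [norm_mul, mul_pow]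
  exact (hF.summable_succ_sq n).mul_left _

theorem tendsto_extDet (hF : HankelSq F) (hFbar : HankelSq Fbar) (lam : ℂ) (n : ℕ) :
    Tendsto (cornerDet (extMatrix lam (kernelG F Fbar) n)) atTop
      (𝓝 (extDet lam (kernelG F Fbar) n)) :=
  (hF.domPert hFbar lam n).tendsto_infDet

theorem tendsto_extBordered (hF : HankelSq F) (hFbar : HankelSq Fbar) (lam : ℂ) (n : ℕ) :
    Tendsto (cornerDet (extBordered lam F (kernelG F Fbar) n)) atTop
      (𝓝 (infDet (extBordered lam F (kernelG F Fbar) n))) :=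
  ((hF.domPert hFbar lam n).rowReplace (hF.summable_scaled_succ_sq lam n)).tendsto_infDet

theorem tendsto_extDet_atTop (hF : HankelSq F) (hFbar : HankelSq Fbar) (lam : ℂ) :
    Tendsto (extDet lam (kernelG F Fbar)) atTop (𝓝 1) := by
  refine (hF.domPert hFbar lam 0).tendsto_infDet_shift.congr fun n => ?_
  rw [extMatrix_shift, zero_add, extDet]

theorem extDet_mul_apply_zero (hF : HankelSq F) (hFbar : HankelSq Fbar) {lam s : ℂ} {n : ℕ}
    {v : ℕ → ℂ} (hv : Summable fun i => ‖v i‖ ^ 2)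
    (hu : ∀ i, ∑' j, extMatrix lam (kernelG F Fbar) n i j * v j = if i = 0 then s else 0) :
    extDet lam (kernelG F Fbar) n * v 0 = s * extDet lam (kernelG F Fbar) (n + 1) := by
  have := (hF.domPert hFbar lam n).infDet_mul_apply_zero hv hu
  rwa [extMatrix_shift] at this

theorem infDet_extBordered_mul_apply_zero (hF : HankelSq F) (hFbar : HankelSq Fbar) {lam : ℂ}
    {n : ℕ} {v : ℕ → ℂ} (hv : Summable fun i => ‖v i‖ ^ 2)
    (hu : ∀ i, i ≠ 0 → ∑' j, extMatrix lam (kernelG F Fbar) n i j * v j = 0) :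
    infDet (extBordered lam F (kernelG F Fbar) n) * v 0 =
      (∑' j : ℕ, lam * F ((n : ℤ) + 1 + j) * v j) * extDet lam (kernelG F Fbar) (n + 1) := by
  have := (hF.domPert hFbar lam n).infDet_rowReplace_mul_apply_zero
    (hF.summable_scaled_succ_sq lam n) hv hu
  rwa [extMatrix_shift] at this

theorem summable_hankel_add (hF : HankelSq F) (n : ℕ) :
    Summable fun p : ℕ × ℕ => ‖F (((n : ℤ) + p.1) + ((p.2 : ℤ) + 1))‖ ^ 2 := by
  have hinj : Function.Injective fun p : ℕ × ℕ => (n + p.1, p.2) := by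
    rintro ⟨a, b⟩ ⟨c, d⟩ h
    simpa using h
  refine (hF.comp_injective hinj).congr fun p => ?_
  simp

/-- Fubini applies because the summand is a product of two square summable families on `ℕ × ℕ`: the
rank one family `x j * Fbar (m + k + 1)` and the Hankel matrix of `F`. -/
theorem kernelG_mulVec (hF : HankelSq F) (hFbar : HankelSq Fbar) (m n : ℕ) {x : ℕ → ℂ}
    (hx : Summable fun i => ‖x i‖ ^ 2) :
    ∑' j : ℕ, kernelG F Fbar m ((n : ℤ) + j) * x j =
      -∑' k : ℕ, Fbar ((m : ℤ) + ((k : ℤ) + 1)) *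
        ∑' j : ℕ, F (((n : ℤ) + j) + ((k : ℤ) + 1)) * x j := by
  have h1 : Summable fun p : ℕ × ℕ => ‖x p.1 * Fbar ((m : ℤ) + ((p.2 : ℤ) + 1))‖ ^ 2 := by
    simp_rw [norm_mul, mul_pow]
    exact hx.mul_of_nonneg (hFbar.row m) (fun _ => sq_nonneg _) fun _ => sq_nonneg _
  have h2 : Summable fun p : ℕ × ℕ => Fbar ((m : ℤ) + ((p.2 : ℤ) + 1)) *
      (F (((n : ℤ) + p.1) + ((p.2 : ℤ) + 1)) * x p.1) := by
    refine Summable.of_norm ((summable_mul_of_sq h1 (hF.summable_hankel_add n)).congr fun p => ?_)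
    simp only [norm_mul]
    ring
  have h3 : ∀ j : ℕ, kernelG F Fbar m ((n : ℤ) + j) * x j =
      -∑' k : ℕ, Fbar ((m : ℤ) + ((k : ℤ) + 1)) * (F (((n : ℤ) + j) + ((k : ℤ) + 1)) * x j) := by
    intro j
    rw [kernelG, neg_mul, ← tsum_mul_right]
    simp_rw [mul_assoc]
  simp_rw [h3]
  rw [tsum_neg]
  congr 1
  simp_rw [← tsum_mul_left]
  exact (Summable.tsum_comm (f := fun j k : ℕ => Fbar ((m : ℤ) + ((k : ℤ) + 1)) *
      (F (((n : ℤ) + j) + ((k : ℤ) + 1)) * x j)) h2).symm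

theorem extMatrix_mulVec (hF : HankelSq F) (hFbar : HankelSq Fbar) (lam : ℂ) (n i : ℕ) {x : ℕ → ℂ}
    (hx : Summable fun i => ‖x i‖ ^ 2) :
    ∑' j : ℕ, extMatrix lam (kernelG F Fbar) n i j * x j =
      x i - lam ^ 2 * ∑' k : ℕ, Fbar ((n : ℤ) + i + ((k : ℤ) + 1)) *
        ∑' j : ℕ, F (((n : ℤ) + j) + ((k : ℤ) + 1)) * x j := by
  have h1 := (hF.domPert hFbar lam n).summable_mulVec hx i
  have h2 : HasSum (fun j => (if i = j then (1 : ℂ) else 0) * x j) (x i) := by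
    have := hasSum_ite_eq i (x i)
    convert this using 2 with j
    by_cases hj : j = i
    · simp [hj]
    · simp [hj, Ne.symm hj]
  have h3 : ∀ j, extMatrix lam (kernelG F Fbar) n i j * x j -
      (if i = j then (1 : ℂ) else 0) * x j =
        lam ^ 2 * (kernelG F Fbar ((n + i : ℕ) : ℤ) ((n : ℤ) + j) * x j) := by
    intro j
    rw [extMatrix]
    push_cast
    ring
  have h4 := h1.hasSum.sub h2
  simp_rw [h3] at h4
  have h5 := h4.tsum_eq
  rw [tsum_mul_left, hF.kernelG_mulVec hFbar (n + i) n hx] at h5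
  push_cast at h5
  linear_combination -h5

end HankelSq

/-! ### The Marchenko equations -/

namespace IsMarchenkoSolution

variable {lam kinf kap : ℂ} {F Fbar : ℤ → ℂ} {n : ℕ} {A1 A2 Ab1 Ab2 : ℕ → ℂ}

theorem summable_shift_A1 (h : IsMarchenkoSolution lam F Fbar kinf n kap A1 A2 Ab1 Ab2) :
    Summable fun j => ‖A1 (n + j)‖ ^ 2 := by
  simp_rw [add_comm n]
  exact (summable_nat_add_iff (f := fun j => ‖A1 j‖ ^ 2) n).mpr h.summable_A1

theorem summable_shift_Ab1 (h : IsMarchenkoSolution lam F Fbar kinf n kap A1 A2 Ab1 Ab2) :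
    Summable fun j => ‖Ab1 (n + j)‖ ^ 2 := by
  simp_rw [add_comm n]
  exact (summable_nat_add_iff (f := fun j => ‖Ab1 j‖ ^ 2) n).mpr h.summable_Ab1

/-- Substituting `eq_b` into `eq_a` eliminates `Ab2`. -/
theorem mulVec_A1 (h : IsMarchenkoSolution lam F Fbar kinf n kap A1 A2 Ab1 Ab2)
    (hF : HankelSq F) (hFbar : HankelSq Fbar) (i : ℕ) :
    ∑' j : ℕ, extMatrix lam (kernelG F Fbar) n i j * A1 (n + j) =
      if i = 0 then kap / kinf else 0 := by
  have ha := h.eq_a (n + i) (by omega)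
  simp only [Nat.add_eq_left] at ha
  rw [hF.extMatrix_mulVec hFbar lam n i h.summable_shift_A1, ha, sub_eq_add_neg]
  congr 1
  rw [← tsum_mul_left, ← tsum_neg]
  refine tsum_congr fun k => ?_
  have hb := h.eq_b (k + 1) (by omega)
  rw [add_comm (Ab2 (k + 1)), ← sub_eq_iff_eq_add, zero_sub] at hb
  have hb' : Ab2 (k + 1) = -(lam ^ 2 * ∑' j : ℕ, F (((n : ℤ) + j) + ((k : ℤ) + 1)) * A1 (n + j)) := by
    rw [← neg_eq_iff_eq_neg, hb]
    push_cast
    simp_rw [mul_comm (A1 _)]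
  rw [hb', show ((k : ℤ) + 1) + ((n + i : ℕ) : ℤ) = (n : ℤ) + i + ((k : ℤ) + 1) by push_cast; ring]
  ring

theorem mulVec_Ab1 (h : IsMarchenkoSolution lam F Fbar kinf n kap A1 A2 Ab1 Ab2)
    (hF : HankelSq F) (hFbar : HankelSq Fbar) (i : ℕ) :
    ∑' j : ℕ, extMatrix lam (kernelG Fbar F) n i j * Ab1 (n + j) =
      if i = 0 then kap / kinf else 0 := by
  have ha := h.eq_c (n + i) (by omega)
  simp only [Nat.add_eq_left] at ha
  rw [hFbar.extMatrix_mulVec hF lam n i h.summable_shift_Ab1, ha, sub_eq_add_neg]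
  congr 1
  rw [← mul_neg, ← tsum_neg]
  congr 1
  refine tsum_congr fun k => ?_
  have hb := h.eq_d (k + 1) (by omega)
  have hb' : A2 (k + 1) = -(∑' j : ℕ, Fbar (((n : ℤ) + j) + ((k : ℤ) + 1)) * Ab1 (n + j)) := by
    rw [eq_neg_iff_add_eq_zero, hb]
    push_cast
    simp_rw [mul_comm (Ab1 _)]
  rw [hb', show ((k : ℤ) + 1) + ((n + i : ℕ) : ℤ) = (n : ℤ) + i + ((k : ℤ) + 1) by push_cast; ring]
  ring

/-- Cramer's rule with `s = kap / kinf` and `v 0 = kinf / kap`. No determinant is assumed to be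
nonzero, so the relation can be used as a recurrence. -/
theorem extDet_mul (h : IsMarchenkoSolution lam F Fbar kinf n kap A1 A2 Ab1 Ab2)
    (hF : HankelSq F) (hFbar : HankelSq Fbar) (hk : kinf ≠ 0) :
    extDet lam (kernelG F Fbar) n * (kinf ^ 2 / kap ^ 2) = extDet lam (kernelG F Fbar) (n + 1) := by
  have h1 := hF.extDet_mul_apply_zero hFbar h.summable_shift_A1 (h.mulVec_A1 hF hFbar)
  have h0 := h.kap_ne_zero
  rw [add_zero, h.norm_eq] at h1
  field_simp at h1 ⊢
  exact h1

/-- Both leading coefficients satisfy the same Cramer identity, the determinants of `G` and of its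
transpose being equal. -/
theorem Ab1_eq (h : IsMarchenkoSolution lam F Fbar kinf n kap A1 A2 Ab1 Ab2)
    (hF : HankelSq F) (hFbar : HankelSq Fbar)
    (hD : extDet lam (kernelG F Fbar) n ≠ 0) : Ab1 n = A1 n := by
  have h1 := hF.extDet_mul_apply_zero hFbar h.summable_shift_A1 (h.mulVec_A1 hF hFbar)
  have h2 := hFbar.extDet_mul_apply_zero hF h.summable_shift_Ab1 (h.mulVec_Ab1 hF hFbar)
  rw [extDet_kernelG_swap F Fbar lam n, extDet_kernelG_swap F Fbar lam (n + 1), ← h1] at h2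
  simpa using mul_left_cancel₀ hD h2

/-- By `eq_b` at `m = 1` the bordering row `lam F` pairs with `A1` to `-lam⁻¹ * Ab2 1`. -/
theorem bordered (h : IsMarchenkoSolution lam F Fbar kinf n kap A1 A2 Ab1 Ab2)
    (hF : HankelSq F) (hFbar : HankelSq Fbar) (hlam : lam ≠ 0) :
    infDet (extBordered lam F (kernelG F Fbar) n) * A1 n =
      -(lam⁻¹ * Ab2 1) * extDet lam (kernelG F Fbar) (n + 1) := by
  have h1 := hF.infDet_extBordered_mul_apply_zero hFbar h.summable_shift_A1 fun i hi => by
    rw [h.mulVec_A1 hF hFbar i, if_neg hi]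
  rw [add_zero] at h1
  rw [h1]
  congr 1
  have hb := h.eq_b 1 le_rfl
  have h2 : ∀ j : ℕ, lam * F ((n : ℤ) + 1 + j) * A1 (n + j) =
      lam * (A1 (n + j) * F (((n : ℤ) + j) + (1 : ℕ))) := by
    intro j
    rw [show ((n : ℤ) + j) + (1 : ℕ) = (n : ℤ) + 1 + j by push_cast; ring]
    ring
  simp_rw [h2]
  rw [tsum_mul_left]
  field_simp
  linear_combination -hb

theorem bordered_bar (h : IsMarchenkoSolution lam F Fbar kinf n kap A1 A2 Ab1 Ab2)
    (hF : HankelSq F) (hFbar : HankelSq Fbar) :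
    infDet (extBordered lam Fbar (kernelG Fbar F) n) * Ab1 n =
      -(lam * A2 1) * extDet lam (kernelG Fbar F) (n + 1) := by
  have h1 := hFbar.infDet_extBordered_mul_apply_zero hF h.summable_shift_Ab1 fun i hi => by
    rw [h.mulVec_Ab1 hF hFbar i, if_neg hi]
  rw [add_zero] at h1
  rw [h1]
  congr 1
  have hb := h.eq_d 1 le_rfl
  have h2 : ∀ j : ℕ, lam * Fbar ((n : ℤ) + 1 + j) * Ab1 (n + j) =
      lam * (Ab1 (n + j) * Fbar (((n : ℤ) + j) + (1 : ℕ))) := by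
    intro j
    rw [show ((n : ℤ) + j) + (1 : ℕ) = (n : ℤ) + 1 + j by push_cast; ring]
    ring
  simp_rw [h2]
  rw [tsum_mul_left]
  linear_combination -lam * hb

theorem formulas (h : IsMarchenkoSolution lam F Fbar kinf n kap A1 A2 Ab1 Ab2)
    (hF : HankelSq F) (hFbar : HankelSq Fbar) (hk : kinf ≠ 0) (hlam : lam ≠ 0)
    (hD : extDet lam (kernelG F Fbar) (n + 1) ≠ 0) :
    extDet lam (kernelG F Fbar) n ≠ 0 ∧ Ab1 n = kinf / kap ∧
      kinf ^ 2 / kap ^ 2 =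
        extDet lam (kernelG F Fbar) (n + 1) / extDet lam (kernelG F Fbar) n ∧
      reflCoeff lam n Ab1 Ab2 = 1 / extDet lam (kernelG F Fbar) (n + 1) *
        infDet (extBordered lam F (kernelG F Fbar) n) ∧
      reflCoeffBar lam n A1 A2 = 1 / extDet lam (kernelG Fbar F) (n + 1) *
        infDet (extBordered lam Fbar (kernelG Fbar F) n) := by
  have h1 := h.extDet_mul hF hFbar hk
  have h0 : extDet lam (kernelG F Fbar) n ≠ 0 := by
    intro h2
    rw [h2, zero_mul] at h1
    exact hD h1.symm
  have hA := h.Ab1_eq hF hFbar h0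
  have hA1 : A1 n ≠ 0 := by
    rw [h.norm_eq]
    exact div_ne_zero hk h.kap_ne_zero
  refine ⟨h0, hA.trans h.norm_eq, ?_, ?_, ?_⟩
  · rw [← h1, mul_div_cancel_left₀ _ h0]
  · rw [reflCoeff, hA, div_eq_iff hA1, mul_assoc, h.bordered hF hFbar hlam]
    field_simp
  · have hD' : extDet lam (kernelG Fbar F) (n + 1) ≠ 0 := by rwa [extDet_kernelG_swap]
    rw [reflCoeffBar, div_eq_iff hA1, mul_assoc, ← hA, h.bordered_bar hF hFbar]
    field_simp

end IsMarchenkoSolution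

theorem isMarchenkoSolution_iff_rescaled {lam : ℂ} (hlam : lam ≠ 0) (F Fbar : ℤ → ℂ) (kinf : ℂ)
    (n : ℕ) (kap : ℂ) (A1 A2 Ab1 Ab2 : ℕ → ℂ) :
    IsMarchenkoSolution lam F Fbar kinf n kap A1 A2 Ab1 Ab2 ↔
      IsMarchenkoSolution 1 (fun m => lam * F m) (fun m => lam * Fbar m) kinf n kap
        A1 (fun m => lam * A2 m) Ab1 (fun m => lam⁻¹ * Ab2 m) := by
  have e1 : ∀ x y : ℂ, lam⁻¹ * x * (lam * y) = x * y := fun x y => by field_simp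
  have e2 : ∀ x y : ℂ, lam * x * (lam * y) = lam ^ 2 * (x * y) := fun x y => by ring
  have e3 : ∀ x y : ℂ, x * (lam * y) = lam * (x * y) := fun x y => by ring
  have e4 : ∀ x y : ℂ, 0 = lam⁻¹ * x + lam * y ↔ 0 = x + lam ^ 2 * y := fun x y => by
    rw [← mul_right_inj' hlam (b := 0), mul_add, mul_inv_cancel_left₀ hlam, mul_zero, sq, mul_assoc]
  have e5 : ∀ x y : ℂ, 0 = lam * x + lam * y ↔ 0 = x + y := fun x y => by
    rw [← mul_add, ← mul_right_inj' hlam (b := 0) (c := x + y), mul_zero]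
  have s1 : (Summable fun j => ‖lam * A2 j‖ ^ 2) ↔ Summable fun j => ‖A2 j‖ ^ 2 := by
    simp_rw [norm_mul, mul_pow]
    exact summable_mul_left_iff (by simpa using hlam)
  have s2 : (Summable fun j => ‖lam⁻¹ * Ab2 j‖ ^ 2) ↔ Summable fun j => ‖Ab2 j‖ ^ 2 := by
    simp_rw [norm_mul, mul_pow]
    exact summable_mul_left_iff (by simpa using hlam)
  constructor
  · rintro ⟨h0, h1, h2, h3, h4, h5, ha, hb, hc, hd⟩
    refine ⟨h0, h1, s1.mpr h2, h3, s2.mpr h4, h5, ?_, ?_, ?_, ?_⟩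
    · simpa only [e1] using ha
    · simpa only [e3, one_pow, one_mul, tsum_mul_left, e4] using hb
    · simpa only [e2, one_pow, one_mul, tsum_mul_left] using hc
    · simpa only [e3, tsum_mul_left, e5] using hd
  · rintro ⟨h0, h1, h2, h3, h4, h5, ha, hb, hc, hd⟩
    refine ⟨h0, h1, s1.mp h2, h3, s2.mp h4, h5, ?_, ?_, ?_, ?_⟩
    · simpa only [e1] using ha
    · simpa only [e3, one_pow, one_mul, tsum_mul_left, e4] using hb
    · simpa only [e2, one_pow, one_mul, tsum_mul_left] using hc
    · simpa only [e3, tsum_mul_left, e5] using hd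

/-! ### Existence of solutions -/

theorem HankelSq.summable_mulVec_sq {F : ℤ → ℂ} (hF : HankelSq F) (n : ℕ) {x : ℕ → ℂ}
    (hx : Summable fun i => ‖x i‖ ^ 2) :
    Summable fun k : ℕ => ‖∑' j : ℕ, x j * F (((n : ℤ) + j) + ((k : ℤ) + 1))‖ ^ 2 := by
  have h0 : Summable fun p : ℕ × ℕ => ‖F (((n : ℤ) + p.2) + ((p.1 : ℤ) + 1))‖ ^ 2 :=
    (Equiv.prodComm ℕ ℕ).summable_iff.mpr (hF.summable_hankel_add n)
  refine Summable.of_nonneg_of_le (fun _ => sq_nonneg _) (fun k => ?_)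
    (h0.prod.mul_left (∑' j, ‖x j‖ ^ 2))
  have h1 := norm_tsum_mul_le_sqrt hx (h0.prod_factor k)
  rw [← Real.sqrt_mul (tsum_nonneg fun _ => sq_nonneg _)] at h1
  calc ‖∑' j : ℕ, x j * F (((n : ℤ) + j) + ((k : ℤ) + 1))‖ ^ 2 ≤ _ := by gcongr
    _ = _ := Real.sq_sqrt (mul_nonneg (tsum_nonneg fun _ => sq_nonneg _)
      (tsum_nonneg fun _ => sq_nonneg _))

/-- Solutions of the eliminated systems for `G` and `Ḡ` are rescaled by a common factor; `A2` and
`Ab2` are then defined by `eq_d` and `eq_b`. -/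
theorem exists_isMarchenkoSolution {F Fbar : ℤ → ℂ} (hF : HankelSq F) (hFbar : HankelSq Fbar)
    {kinf : ℂ} (hk : kinf ≠ 0) (lam : ℂ) (n : ℕ) (hD : extDet lam (kernelG F Fbar) n ≠ 0)
    (hD' : extDet lam (kernelG F Fbar) (n + 1) ≠ 0) :
    ∃ (kap : ℂ) (A1 A2 Ab1 Ab2 : ℕ → ℂ),
      IsMarchenkoSolution lam F Fbar kinf n kap A1 A2 Ab1 Ab2 := by
  obtain ⟨v, hv, hMv, hv0⟩ := (hF.domPert hFbar lam n).exists_solution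
  obtain ⟨u, hu, hMu, hu0⟩ := (hFbar.domPert hF lam n).exists_solution
  rw [extMatrix_shift] at hv0 hu0
  change v 0 = extDet lam (kernelG F Fbar) (n + 1) at hv0
  change ∀ i, _ = if i = 0 then extDet lam (kernelG F Fbar) n else 0 at hMv
  change ∀ i, _ = if i = 0 then extDet lam (kernelG Fbar F) n else 0 at hMu
  rw [extDet_kernelG_swap] at hMu
  set D := extDet lam (kernelG F Fbar) n with hDdef
  set D' := extDet lam (kernelG F Fbar) (n + 1) with hDdef'
  -- Scaling by `t` gives `A1 n = t * D'` and `kap / kinf = t * D`; the normalisation `A1 n = kinf /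
  -- kap` thus requires `t² * D * D' = 1`.
  obtain ⟨t, ht⟩ := IsAlgClosed.exists_pow_nat_eq (D * D')⁻¹ two_pos
  have ht0 : t ≠ 0 := by
    rintro rfl
    rw [zero_pow two_ne_zero] at ht
    exact inv_ne_zero (mul_ne_zero hD hD') ht.symm
  -- The sequences are indexed by all of `ℕ` but constrained only from `n` on; they are set to zero
  -- below.
  set pad : (ℕ → ℂ) → ℕ → ℂ := fun x m => if n ≤ m then t * x (m - n) else 0 with hpad
  have hpad_add : ∀ x j, pad x (n + j) = t * x j := fun x j => by simp [hpad]
  have hpads : ∀ x : ℕ → ℂ, (Summable fun i => ‖x i‖ ^ 2) → Summable fun i => ‖pad x i‖ ^ 2 := by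
    intro x hx
    rw [← summable_nat_add_iff n]
    simp_rw [add_comm _ n, hpad_add, norm_mul, mul_pow]
    exact hx.mul_left _
  set hank : (ℤ → ℂ) → (ℕ → ℂ) → ℕ → ℂ :=
    fun E x m => ∑' j : ℕ, pad x (n + j) * E (((n : ℤ) + j) + m) with hhank
  have hhanks : ∀ E : ℤ → ℂ, HankelSq E → ∀ x : ℕ → ℂ, (Summable fun i => ‖x i‖ ^ 2) →
      Summable fun k => ‖hank E x (k + 1)‖ ^ 2 := by
    intro E hE x hx
    have h1 : Summable fun j => ‖pad x (n + j)‖ ^ 2 := by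
      simp_rw [hpad_add, norm_mul, mul_pow]
      exact hx.mul_left _
    refine (hE.summable_mulVec_sq n h1).congr fun k => ?_
    rw [hhank]
    push_cast
    rfl
  have hmul : ∀ E Ebar : ℤ → ℂ, HankelSq E → HankelSq Ebar → ∀ x : ℕ → ℂ,
      (Summable fun i => ‖x i‖ ^ 2) →
      (∀ i, ∑' j, extMatrix lam (kernelG E Ebar) n i j * x j = if i = 0 then D else 0) →
      ∀ m, n ≤ m → (if m = n then t * D else 0) =
        pad x m - lam ^ 2 * ∑' k : ℕ, hank E x (k + 1) * Ebar (((k : ℤ) + 1) + m) := by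
    intro E Ebar hE hEbar x hx hMx m hm
    obtain ⟨i, rfl⟩ := Nat.exists_eq_add_of_le hm
    have h1 := hMx i
    rw [hE.extMatrix_mulVec hEbar lam n i hx] at h1
    have h2 : ∀ k : ℕ, hank E x (k + 1) * Ebar (((k : ℤ) + 1) + ((n + i : ℕ) : ℤ)) =
        t * (Ebar ((n : ℤ) + i + ((k : ℤ) + 1)) *
          ∑' j : ℕ, E (((n : ℤ) + j) + ((k : ℤ) + 1)) * x j) := by
      intro k
      have h3 : hank E x (k + 1) = t * ∑' j : ℕ, E (((n : ℤ) + j) + ((k : ℤ) + 1)) * x j := by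
        rw [hhank, ← tsum_mul_left]
        refine tsum_congr fun j => ?_
        rw [hpad_add]
        push_cast
        ring
      rw [h3, show ((k : ℤ) + 1) + ((n + i : ℕ) : ℤ) = (n : ℤ) + i + ((k : ℤ) + 1) by
        push_cast; ring]
      ring
    simp_rw [h2]
    rw [tsum_mul_left, hpad_add]
    have h3 : (if n + i = n then t * D else 0) = t * if i = 0 then D else 0 := by
      by_cases hi : i = 0 <;> simp [hi]
    rw [h3, ← h1]
    ring
  have hkap : kinf * (t * D) / kinf = t * D := mul_div_cancel_left₀ _ hk
  have hsucc : ∀ {f : ℕ → ℂ}, (Summable fun k => ‖f (k + 1)‖ ^ 2) → Summable fun k => ‖f k‖ ^ 2 :=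
    fun {f} h => (summable_nat_add_iff (f := fun k => ‖f k‖ ^ 2) 1).mp h
  refine ⟨kinf * (t * D), pad v, fun m => -hank Fbar u m, pad u, fun m => -(lam ^ 2 * hank F v m),
    mul_ne_zero hk (mul_ne_zero ht0 hD), hpads v hv, ?_, hpads u hu, ?_, ?_, ?_, ?_, ?_, ?_⟩
  · exact hsucc (by simpa using hhanks Fbar hFbar u hu)
  · refine hsucc ?_
    simp_rw [norm_neg, norm_mul, mul_pow]
    exact (hhanks F hF v hv).mul_left _
  · have h1 := hpad_add v 0
    rw [add_zero] at h1
    rw [h1, hv0]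
    field_simp
    rw [ht]
    field_simp
  · intro m hm
    rw [hkap, hmul F Fbar hF hFbar v hv hMv m hm, sub_eq_add_neg, ← tsum_mul_left, ← tsum_neg]
    congr 1
    refine tsum_congr fun k => ?_
    ring
  · intro m _
    exact (neg_add_cancel _).symm
  · intro m hm
    rw [hkap, hmul Fbar F hFbar hF u hu hMu m hm, sub_eq_add_neg, ← mul_neg, ← tsum_neg]
    simp_rw [neg_mul]
  · intro m _
    exact (neg_add_cancel _).symm

/-! ### Products of solutions -/

/-- A zero would propagate to all higher levels, whereas the determinants tend to `1`. -/
theorem extDet_ne_zero_of_recurrence {F Fbar : ℤ → ℂ} (hF : HankelSq F) (hFbar : HankelSq Fbar)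
    {lam : ℂ} {x : ℕ → ℂ}
    (h : ∀ n, extDet lam (kernelG F Fbar) n * x n = extDet lam (kernelG F Fbar) (n + 1)) (n : ℕ) :
    extDet lam (kernelG F Fbar) n ≠ 0 := by
  intro h0
  have h1 : ∀ k, extDet lam (kernelG F Fbar) (k + n) = 0 := by
    intro k
    induction k with
    | zero => rwa [zero_add]
    | succ k ih => rw [add_right_comm, ← h, ih, zero_mul]
  have h2 := (hF.tendsto_extDet_atTop hFbar lam).comp (tendsto_add_atTop_nat n)
  have h3 : extDet lam (kernelG F Fbar) ∘ (fun k => k + n) = fun _ => 0 := funext h1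
  rw [h3] at h2
  exact zero_ne_one (tendsto_nhds_unique tendsto_const_nhds h2)

theorem extToeplitz_eq {F Fbar : ℤ → ℂ} (hF : HankelSq F) (hFbar : HankelSq Fbar)
    {kinf : ℂ} (hk : kinf ≠ 0) {lam : ℂ} (I0 : ℂ) {kap : ℕ → ℂ}
    (h : ∀ n, extDet lam (kernelG F Fbar) n * (kinf ^ 2 / kap n ^ 2) =
      extDet lam (kernelG F Fbar) (n + 1)) (n : ℕ) :
    extToeplitz I0 kap n = I0 / kinf ^ (2 * n) *
      (extDet lam (kernelG F Fbar) n / extDet lam (kernelG F Fbar) 0) := by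
  have h0 := extDet_ne_zero_of_recurrence hF hFbar h 0
  induction n with
  | zero => simp [extToeplitz, h0]
  | succ n ih =>
    have h1 : extToeplitz I0 kap (n + 1) = extToeplitz I0 kap n * (kap n ^ 2)⁻¹ := by
      rw [extToeplitz, extToeplitz, Finset.prod_range_succ, mul_assoc]
    rw [h1, ih, ← h n, mul_add, pow_add]
    field_simp

/-! ### Neumann series -/

/-- The vectors `T ^ k g`. -/
def mulVecIter (T : ℕ → ℕ → ℂ) (g : ℕ → ℂ) : ℕ → ℕ → ℂ
  | 0 => g
  | k + 1 => fun i => ∑' j, T i j * mulVecIter T g k j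

section Neumann

variable {T : ℕ → ℕ → ℂ} {g : ℕ → ℂ} {α β : ℕ → ℝ}

/-- Each application of a kernel dominated by `α i * β j` reproduces the profile `α` and costs a
factor `∑ α j * β j`. -/
theorem norm_mulVecIter_le (hα : ∀ i, 0 ≤ α i) (hβ : ∀ i, 0 ≤ β i)
    (hs : Summable fun i => α i * β i) (hT : ∀ i j, ‖T i j‖ ≤ α i * β j)
    (hg : ∀ i, ‖g i‖ ≤ α i) (k i : ℕ) :
    ‖mulVecIter T g k i‖ ≤ (∑' j, α j * β j) ^ k * α i := by
  induction k generalizing i with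
  | zero => simpa [mulVecIter] using hg i
  | succ k ih =>
    set q := ∑' j, α j * β j with hq
    have h1 : HasSum (fun j => α i * q ^ k * (α j * β j)) (α i * q ^ k * q) :=
      hs.hasSum.mul_left _
    refine (tsum_of_norm_bounded h1 fun j => ?_).trans_eq (by ring)
    rw [norm_mul]
    calc ‖T i j‖ * ‖mulVecIter T g k j‖ ≤ (α i * β j) * (q ^ k * α j) :=
          mul_le_mul (hT i j) (ih j) (norm_nonneg _) (mul_nonneg (hα i) (hβ j))
      _ = _ := by ring

theorem summable_neumann (hα : ∀ i, 0 ≤ α i) (hβ : ∀ i, 0 ≤ β i)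
    (hs : Summable fun i => α i * β i) (hT : ∀ i j, ‖T i j‖ ≤ α i * β j)
    (hg : ∀ i, ‖g i‖ ≤ α i) {μ : ℂ} (hμ : ‖μ‖ * ∑' j, α j * β j < 1)
    {φ : ℕ → ℂ} (hφ : Summable fun j => ‖φ j‖ * α j) :
    Summable fun p : ℕ × ℕ => φ p.1 * (μ ^ p.2 * mulVecIter T g p.2 p.1) := by
  set q := ∑' j, α j * β j with hq
  have hq0 : 0 ≤ q := tsum_nonneg fun j => mul_nonneg (hα j) (hβ j)
  have h1 : Summable fun k => (‖μ‖ * q) ^ k :=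
    summable_geometric_of_lt_one (mul_nonneg (norm_nonneg _) hq0) hμ
  have h2 := hφ.mul_of_nonneg h1 (fun j => mul_nonneg (norm_nonneg _) (hα j)) fun k =>
    pow_nonneg (mul_nonneg (norm_nonneg _) hq0) k
  refine Summable.of_norm_bounded h2 fun p => ?_
  rw [norm_mul, norm_mul, norm_pow]
  calc ‖φ p.1‖ * (‖μ‖ ^ p.2 * ‖mulVecIter T g p.2 p.1‖) ≤
        ‖φ p.1‖ * (‖μ‖ ^ p.2 * (q ^ p.2 * α p.1)) := by
        gcongr
        exact norm_mulVecIter_le hα hβ hs hT hg p.2 p.1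
    _ = _ := by
        rw [mul_pow]
        ring

/-- The sum of the Neumann series `∑ μ ^ k T ^ k g`. -/
def neumannSum (T : ℕ → ℕ → ℂ) (g : ℕ → ℂ) (μ : ℂ) (i : ℕ) : ℂ :=
  ∑' k, μ ^ k * mulVecIter T g k i

/-- Pairing the Neumann series with a functional `φ` gives a power series in `μ`; the double series
is dominated by a geometric series times `‖φ j‖ * α j`. -/
theorem hasSum_neumannSum_dot (hα : ∀ i, 0 ≤ α i) (hβ : ∀ i, 0 ≤ β i)
    (hs : Summable fun i => α i * β i) (hT : ∀ i j, ‖T i j‖ ≤ α i * β j)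
    (hg : ∀ i, ‖g i‖ ≤ α i) {μ : ℂ} (hμ : ‖μ‖ * ∑' j, α j * β j < 1)
    {φ : ℕ → ℂ} (hφ : Summable fun j => ‖φ j‖ * α j) :
    HasSum (fun k => μ ^ k * ∑' j, φ j * mulVecIter T g k j)
      (∑' j, φ j * neumannSum T g μ j) := by
  have h0 := summable_neumann hα hβ hs hT hg hμ hφ
  have hrow : ∀ j, HasSum (fun k => φ j * (μ ^ k * mulVecIter T g k j))
      (φ j * neumannSum T g μ j) := by
    intro j
    have h2 : HasSum (fun k => φ j * (μ ^ k * mulVecIter T g k j))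
        (∑' k, φ j * (μ ^ k * mulVecIter T g k j)) := (h0.prod_factor j).hasSum
    rwa [tsum_mul_left] at h2
  have h1 : HasSum (fun j => φ j * neumannSum T g μ j)
      (∑' p : ℕ × ℕ, φ p.1 * (μ ^ p.2 * mulVecIter T g p.2 p.1)) := h0.hasSum.prod_fiberwise hrow
  refine hasSum_of_prod_fiberwise h0
    (r := fun k => μ ^ k * ∑' j, φ j * mulVecIter T g k j) hrow (fun k => ?_) h1.summable.hasSum
  have h3 : Summable fun p : ℕ × ℕ => φ p.2 * (μ ^ p.1 * mulVecIter T g p.1 p.2) :=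
    (Equiv.prodComm ℕ ℕ).summable_iff.mpr h0
  have h2 := (h3.prod_factor k).hasSum
  have h4 : ∀ j, φ j * (μ ^ k * mulVecIter T g k j) = μ ^ k * (φ j * mulVecIter T g k j) :=
    fun j => by ring
  simp_rw [h4] at h2 ⊢
  rwa [tsum_mul_left] at h2

theorem hasSum_neumannSum (hα : ∀ i, 0 ≤ α i) (hβ : ∀ i, 0 ≤ β i)
    (hs : Summable fun i => α i * β i) (hT : ∀ i j, ‖T i j‖ ≤ α i * β j)
    (hg : ∀ i, ‖g i‖ ≤ α i) {μ : ℂ} (hμ : ‖μ‖ * ∑' j, α j * β j < 1) (i : ℕ) :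
    HasSum (fun k => μ ^ k * mulVecIter T g k i) (neumannSum T g μ i) := by
  have hφ : Summable fun j => ‖(if j = i then (1 : ℂ) else 0)‖ * α j :=
    summable_of_ne_finset_zero (s := {i}) fun j hj => by
      have : j ≠ i := by simpa using hj
      simp [this]
  simpa using hasSum_neumannSum_dot hα hβ hs hT hg hμ hφ

theorem norm_neumannSum_le (hα : ∀ i, 0 ≤ α i) (hβ : ∀ i, 0 ≤ β i)
    (hs : Summable fun i => α i * β i) (hT : ∀ i j, ‖T i j‖ ≤ α i * β j)
    (hg : ∀ i, ‖g i‖ ≤ α i) {μ : ℂ} (hμ : ‖μ‖ * ∑' j, α j * β j < 1) (i : ℕ) :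
    ‖neumannSum T g μ i‖ ≤ (1 - ‖μ‖ * ∑' j, α j * β j)⁻¹ * α i := by
  set q := ∑' j, α j * β j with hq
  have hq0 : 0 ≤ q := tsum_nonneg fun j => mul_nonneg (hα j) (hβ j)
  have h1 := (hasSum_geometric_of_lt_one (mul_nonneg (norm_nonneg μ) hq0) hμ).mul_right (α i)
  refine tsum_of_norm_bounded h1 fun k => ?_
  rw [norm_mul, norm_pow, mul_pow, mul_assoc]
  gcongr
  exact norm_mulVecIter_le hα hβ hs hT hg k i

theorem neumannSum_eq (hα : ∀ i, 0 ≤ α i) (hβ : ∀ i, 0 ≤ β i)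
    (hs : Summable fun i => α i * β i) (hT : ∀ i j, ‖T i j‖ ≤ α i * β j)
    (hg : ∀ i, ‖g i‖ ≤ α i) {μ : ℂ} (hμ : ‖μ‖ * ∑' j, α j * β j < 1) (i : ℕ) :
    neumannSum T g μ i = g i + μ * ∑' j, T i j * neumannSum T g μ j := by
  have hφ : Summable fun j => ‖T i j‖ * α j := by
    refine Summable.of_nonneg_of_le (fun j => mul_nonneg (norm_nonneg _) (hα j)) (fun j => ?_)
      (hs.mul_left (α i))
    calc ‖T i j‖ * α j ≤ (α i * β j) * α j := by
          gcongr
          · exact hα j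
          · exact hT i j
      _ = _ := by ring
  have h1 := (hasSum_neumannSum_dot hα hβ hs hT hg hμ hφ).mul_left μ
  have h2 := (hasSum_neumannSum hα hβ hs hT hg hμ i)
  have h3 : HasSum (fun k => μ ^ (k + 1) * mulVecIter T g (k + 1) i)
      (μ * ∑' j, T i j * neumannSum T g μ j) := by
    have h6 : (fun k => μ * (μ ^ k * ∑' j, T i j * mulVecIter T g k j)) =
        fun k => μ ^ (k + 1) * mulVecIter T g (k + 1) i := by
      ext k
      rw [pow_succ', mul_assoc]
      rfl
    rwa [h6] at h1
  have h4 := (hasSum_nat_add_iff' 1).mpr h2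
  have h5 := h4.unique h3
  simp only [Finset.range_one, Finset.sum_singleton, pow_zero, one_mul] at h5
  rw [← h5]
  simp [mulVecIter]

end Neumann

theorem HankelSq.extMatrix_mulVec_eq_add {F Fbar : ℤ → ℂ} (hF : HankelSq F) (hFbar : HankelSq Fbar)
    (lam : ℂ) (n i : ℕ) {x : ℕ → ℂ} (hx : Summable fun i => ‖x i‖ ^ 2) :
    ∑' j : ℕ, extMatrix lam (kernelG F Fbar) n i j * x j =
      x i + lam ^ 2 * ∑' j : ℕ, kernelG F Fbar ((n : ℤ) + i) ((n : ℤ) + j) * x j := by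
  have h1 := hF.kernelG_mulVec hFbar (n + i) n hx
  push_cast at h1
  rw [hF.extMatrix_mulVec hFbar lam n i hx, h1]
  ring

/-- The threshold `(q + 1)⁻¹` forces both `‖lam‖ ≤ 1` and `‖lam‖ * q < 1`, so one radius serves for
a bound that is quadratic in `lam`. -/
theorem norm_neg_sq_mul_lt_one {lam : ℂ} {q : ℝ} (hq : 0 ≤ q) (h : ‖lam‖ < (q + 1)⁻¹) :
    ‖-lam ^ 2‖ * q < 1 := by
  have h1 : ‖lam‖ * (q + 1) < 1 := by
    rwa [← one_div, lt_div_iff₀ (by linarith)] at h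
  have h2 : ‖lam‖ ≤ 1 := by nlinarith [norm_nonneg lam]
  rw [norm_neg, norm_pow]
  nlinarith [norm_nonneg lam, mul_nonneg (norm_nonneg lam) hq]

theorem exists_extDet_ne_zero {F Fbar : ℤ → ℂ} (hF : HankelSq F) (hFbar : HankelSq Fbar) (n : ℕ) :
    ∃ δ : ℝ, 0 < δ ∧ ∀ lam : ℂ, ‖lam‖ < δ → extDet lam (kernelG F Fbar) n ≠ 0 := by
  set a : ℕ → ℝ := fun i => hankelRow Fbar (n + i) with ha
  set b : ℕ → ℝ := fun i => hankelRow F (n + i) with hb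
  have hab : 0 ≤ ∑' i, a i * b i :=
    tsum_nonneg fun i => mul_nonneg (hankelRow_nonneg _ _) (hankelRow_nonneg _ _)
  set q := detBound a b * ∑' i, a i * b i with hq
  have hq0 : 0 ≤ q := mul_nonneg (detBound_pos a b).le hab
  refine ⟨(q + 1)⁻¹, by positivity, fun lam hlam h0 => ?_⟩
  have h1 := (hF.domPert hFbar lam n).norm_infDet_sub_one_le
  have h2 := norm_neg_sq_mul_lt_one hq0 hlam
  have h3 : ‖lam‖ ≤ 1 := hlam.le.trans (inv_le_one_of_one_le₀ (by linarith))
  have h4 : detBound (fun i => ‖lam‖ ^ 2 * a i) b ≤ detBound a b := by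
    refine detBound_mono ?_ le_rfl
    simp_rw [mul_pow]
    rw [tsum_mul_left]
    exact mul_le_of_le_one_left (tsum_nonneg fun i => sq_nonneg _)
      (pow_le_one₀ (by positivity) (pow_le_one₀ (norm_nonneg _) h3))
  rw [extDet] at h0
  rw [h0, zero_sub, norm_neg, norm_one] at h1
  simp_rw [mul_assoc] at h1
  rw [tsum_mul_left] at h1
  rw [norm_neg, norm_pow] at h2
  have h5 : detBound (fun i => ‖lam‖ ^ 2 * a i) b * (‖lam‖ ^ 2 * ∑' i, a i * b i) ≤
      detBound a b * (‖lam‖ ^ 2 * ∑' i, a i * b i) := by gcongr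
  have h6 : detBound a b * (‖lam‖ ^ 2 * ∑' i, a i * b i) = ‖lam‖ ^ 2 * q := by
    rw [hq]
    ring
  exact absurd (h1.trans (h5.trans_eq h6)) (not_le.mpr h2)

/-- The ratio `D (n + 1) / D n` is the `(0, 0)` entry of `(1 + lam² G)⁻¹`, that is, the first
component of the Neumann series applied to `e₀`. -/
theorem exists_expansion_ratio {F Fbar : ℤ → ℂ} (hF : HankelSq F) (hFbar : HankelSq Fbar) (n : ℕ) :
    ∃ (a : ℕ → ℂ) (δ : ℝ), 0 < δ ∧ a 0 = 1 ∧ a 1 = -kernelG F Fbar n n ∧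
      a 2 = ∑' j : ℕ, kernelG F Fbar n ((n : ℤ) + j) * kernelG F Fbar ((n : ℤ) + j) n ∧
      ∀ lam : ℂ, ‖lam‖ < δ → ∃ R : ℂ, HasSum (fun k : ℕ => a k * lam ^ (2 * k)) R ∧
        extDet lam (kernelG F Fbar) n * R = extDet lam (kernelG F Fbar) (n + 1) := by
  set T : ℕ → ℕ → ℂ := fun i j => kernelG F Fbar ((n : ℤ) + i) ((n : ℤ) + j) with hT
  set g : ℕ → ℂ := fun i => if i = 0 then 1 else 0 with hg
  -- The extra one at `i = 0` lets the same `α` dominate the kernel and the vector `e₀`.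
  set α : ℕ → ℝ := fun i => hankelRow Fbar (n + i) + if i = 0 then 1 else 0 with hα
  set β : ℕ → ℝ := fun j => hankelRow F (n + j) with hβ
  have hα0 : ∀ i, 0 ≤ α i := fun i => by
    have := hankelRow_nonneg Fbar (n + i)
    positivity
  have hβ0 : ∀ i, 0 ≤ β i := fun i => hankelRow_nonneg _ _
  have hαs : Summable fun i => α i ^ 2 := by
    refine (summable_nat_add_iff 1).mp
      (((summable_nat_add_iff 1).mpr (hFbar.summable_row_sq_add n)).congr fun i => ?_)
    simp [hα]
  have hs : Summable fun i => α i * β i := summable_mul_of_sq hαs (hF.summable_row_sq_add n)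
  have hTb : ∀ i j, ‖T i j‖ ≤ α i * β j := by
    intro i j
    have h1 := hF.norm_kernelG_le hFbar (n + i) (n + j)
    push_cast at h1
    refine h1.trans (mul_le_mul_of_nonneg_right ?_ (hβ0 j))
    exact le_add_of_nonneg_right (by positivity)
  have hgb : ∀ i, ‖g i‖ ≤ α i := by
    intro i
    have h1 := hankelRow_nonneg Fbar (n + i)
    by_cases hi : i = 0
    · simpa [hg, hα, hi] using hankelRow_nonneg Fbar n
    · simpa [hg, hα, hi] using h1
  have hq0 : 0 ≤ ∑' i, α i * β i := tsum_nonneg fun i => mul_nonneg (hα0 i) (hβ0 i)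
  have hit1 : ∀ i, mulVecIter T g 1 i = T i 0 := by
    intro i
    have h1 : ∀ j, T i j * g j = if j = 0 then T i 0 else 0 := fun j => by
      by_cases hj : j = 0 <;> simp [hg, hj]
    simp only [mulVecIter, h1, tsum_ite_eq]
  refine ⟨fun k => (-1) ^ k * mulVecIter T g k 0, (∑' i, α i * β i + 1)⁻¹, by positivity, ?_, ?_, ?_,
    fun lam hlam => ?_⟩
  · simp [mulVecIter, hg]
  · change (-1) ^ 1 * mulVecIter T g 1 0 = _
    rw [hit1]
    simp [hT]
  · have h2 : mulVecIter T g 2 0 = ∑' j, T 0 j * mulVecIter T g 1 j := rfl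
    simp only [h2, hit1]
    simp [hT]
  · have hμ := norm_neg_sq_mul_lt_one hq0 hlam
    refine ⟨neumannSum T g (-lam ^ 2) 0, ?_, ?_⟩
    · have h1 := hasSum_neumannSum hα0 hβ0 hs hTb hgb hμ 0
      have h2 : (fun k => (-1) ^ k * mulVecIter T g k 0 * lam ^ (2 * k)) =
          fun k => (-lam ^ 2) ^ k * mulVecIter T g k 0 := by
        ext k
        rw [neg_pow (lam ^ 2), ← pow_mul]
        ring
      rwa [h2]
    · have hy : Summable fun i => ‖neumannSum T g (-lam ^ 2) i‖ ^ 2 := by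
        refine Summable.of_nonneg_of_le (fun _ => sq_nonneg _) (fun i => ?_)
          (hαs.mul_left ((1 - ‖-lam ^ 2‖ * ∑' j, α j * β j)⁻¹ ^ 2))
        rw [← mul_pow]
        gcongr
        exact norm_neumannSum_le hα0 hβ0 hs hTb hgb hμ i
      have h1 := hF.extDet_mul_apply_zero hFbar (lam := lam) (s := 1) (n := n) hy fun i => by
        rw [hF.extMatrix_mulVec_eq_add hFbar lam n i hy]
        have h3 := neumannSum_eq hα0 hβ0 hs hTb hgb hμ i
        have h4 : (if i = 0 then (1 : ℂ) else 0) = g i := rfl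
        rw [h4]
        linear_combination h3
      rwa [one_mul] at h1

theorem HankelSq.summable_bordered_first {F Fbar : ℤ → ℂ} (hF : HankelSq F) (hFbar : HankelSq Fbar)
    (n : ℕ) : Summable fun j : ℕ =>
      F (((n : ℤ) + 1 + j) + 1) * kernelG F Fbar ((n : ℤ) + 1 + j) n := by
  have h1 := hF.summable_succ_sq (n + 1)
  have h2 : Summable fun j : ℕ => (hankelRow Fbar (n + 1 + j) * hankelRow F n) ^ 2 := by
    simp_rw [mul_pow]
    exact (hFbar.summable_row_sq_add (n + 1)).mul_right _
  refine Summable.of_norm_bounded (summable_mul_of_sq h1 h2) fun j => ?_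
  rw [norm_mul]
  have h3 := hF.norm_kernelG_le hFbar (n + 1 + j) n
  push_cast at h3 ⊢
  rw [show (n : ℤ) + 1 + j + 1 = n + 1 + 1 + j by ring]
  gcongr

theorem HankelSq.summable_kernelG_sq {F Fbar : ℤ → ℂ} (hF : HankelSq F) (hFbar : HankelSq Fbar)
    (n : ℕ) : Summable fun j : ℕ =>
      kernelG F Fbar n ((n : ℤ) + j) * kernelG F Fbar ((n : ℤ) + j) n := by
  have h1 : Summable fun j : ℕ => (hankelRow Fbar n * hankelRow F (n + j)) ^ 2 := by
    simp_rw [mul_pow]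
    exact (hF.summable_row_sq_add n).mul_left _
  have h2 : Summable fun j : ℕ => (hankelRow Fbar (n + j) * hankelRow F n) ^ 2 := by
    simp_rw [mul_pow]
    exact (hFbar.summable_row_sq_add n).mul_right _
  refine Summable.of_norm_bounded (summable_mul_of_sq h1 h2) fun j => ?_
  rw [norm_mul]
  have h3 := hF.norm_kernelG_le hFbar (n + j) n
  have h4 := hF.norm_kernelG_le hFbar n (n + j)
  push_cast at h3 h4
  exact mul_le_mul h4 h3 (norm_nonneg _) (mul_nonneg (hankelRow_nonneg _ _) (hankelRow_nonneg _ _))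

/-- Block elimination: the vector `v = (1, -lam² y)`, with `y = (1 + lam² T)⁻¹ g` and `g` the first
column of `G` below the diagonal, is annihilated by all rows but the first. The bordered Cramer
identity then equates the ratio of determinants with the pairing of `lam F` and `v`. -/
theorem exists_expansion_bordered {F Fbar : ℤ → ℂ} (hF : HankelSq F) (hFbar : HankelSq Fbar)
    (n : ℕ) :
    ∃ (b : ℕ → ℂ) (δ : ℝ), 0 < δ ∧ b 0 = F ((n : ℤ) + 1) ∧
      b 1 = -∑' j : ℕ, F (((n : ℤ) + 1 + j) + 1) * kernelG F Fbar ((n : ℤ) + 1 + j) n ∧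
      ∀ lam : ℂ, ‖lam‖ < δ → ∃ R : ℂ, HasSum (fun k : ℕ => b k * lam ^ (2 * k + 1)) R ∧
        infDet (extBordered lam F (kernelG F Fbar) n) =
          R * extDet lam (kernelG F Fbar) (n + 1) := by
  set T : ℕ → ℕ → ℂ := fun i j => kernelG F Fbar ((n : ℤ) + 1 + i) ((n : ℤ) + 1 + j) with hT
  set g : ℕ → ℂ := fun i => kernelG F Fbar ((n : ℤ) + 1 + i) n with hg
  -- The factor `1 + hankelRow F n` makes `α` dominate both the kernel `T` and the column `g`.
  set α : ℕ → ℝ := fun i => hankelRow Fbar (n + 1 + i) * (1 + hankelRow F n) with hα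
  set β : ℕ → ℝ := fun j => hankelRow F (n + 1 + j) with hβ
  set φ : ℕ → ℂ := fun j => F (((n : ℤ) + 1 + j) + 1) with hφ
  have hn0 := hankelRow_nonneg F n
  have hα0 : ∀ i, 0 ≤ α i := fun i => mul_nonneg (hankelRow_nonneg _ _) (by linarith)
  have hβ0 : ∀ i, 0 ≤ β i := fun i => hankelRow_nonneg _ _
  have hαs : Summable fun i => α i ^ 2 := by
    simp_rw [hα, mul_pow]
    exact (hFbar.summable_row_sq_add (n + 1)).mul_right _
  have hs : Summable fun i => α i * β i := summable_mul_of_sq hαs (hF.summable_row_sq_add (n + 1))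
  have hTb : ∀ i j, ‖T i j‖ ≤ α i * β j := by
    intro i j
    have h1 := hF.norm_kernelG_le hFbar (n + 1 + i) (n + 1 + j)
    push_cast at h1
    refine h1.trans (mul_le_mul_of_nonneg_right ?_ (hβ0 j))
    exact le_mul_of_one_le_right (hankelRow_nonneg _ _) (by linarith)
  have hgb : ∀ i, ‖g i‖ ≤ α i := by
    intro i
    have h1 := hF.norm_kernelG_le hFbar (n + 1 + i) n
    push_cast at h1
    exact h1.trans (mul_le_mul_of_nonneg_left (by linarith) (hankelRow_nonneg _ _))
  have hq0 : 0 ≤ ∑' i, α i * β i := tsum_nonneg fun i => mul_nonneg (hα0 i) (hβ0 i)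
  have hφs : Summable fun j => ‖φ j‖ * α j := by
    refine summable_mul_of_sq ((hF.summable_succ_sq (n + 1)).congr fun j => ?_) hαs
    simp only [hφ]
    push_cast
    rw [show (n : ℤ) + 1 + j + 1 = n + 1 + 1 + j by ring]
  set b : ℕ → ℂ := fun k => match k with
    | 0 => F ((n : ℤ) + 1)
    | k + 1 => (-1) ^ (k + 1) * ∑' j, φ j * mulVecIter T g k j with hb
  refine ⟨b, (∑' i, α i * β i + 1)⁻¹, by positivity, rfl, ?_, fun lam hlam => ?_⟩
  · simp [hb, mulVecIter, hφ, hg]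
  · have hμ := norm_neg_sq_mul_lt_one hq0 hlam
    set y := neumannSum T g (-lam ^ 2) with hydef
    have hy : Summable fun i => ‖y i‖ ^ 2 := by
      refine Summable.of_nonneg_of_le (fun _ => sq_nonneg _) (fun i => ?_)
        (hαs.mul_left ((1 - ‖-lam ^ 2‖ * ∑' j, α j * β j)⁻¹ ^ 2))
      rw [← mul_pow]
      gcongr
      exact norm_neumannSum_le hα0 hβ0 hs hTb hgb hμ i
    set v : ℕ → ℂ := fun k => match k with
      | 0 => 1
      | k + 1 => -lam ^ 2 * y k with hv
    have hvs : Summable fun i => ‖v i‖ ^ 2 := by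
      refine (summable_nat_add_iff 1).mp ?_
      simp only [hv, norm_mul, mul_pow]
      exact hy.mul_left _
    have hMv : ∀ i, i ≠ 0 → ∑' j, extMatrix lam (kernelG F Fbar) n i j * v j = 0 := by
      intro i hi
      obtain ⟨i, rfl⟩ := Nat.exists_eq_succ_of_ne_zero hi
      rw [((hF.domPert hFbar lam n).summable_mulVec hvs _).tsum_eq_zero_add]
      have h1 : ∀ j, extMatrix lam (kernelG F Fbar) n (i + 1) (j + 1) * v (j + 1) =
          -lam ^ 2 * (extMatrix lam (kernelG F Fbar) (n + 1) i j * y j) := by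
        intro j
        rw [← extMatrix_shift]
        simp only [hv]
        ring
      simp only [Nat.succ_eq_add_one, h1]
      rw [tsum_mul_left, hF.extMatrix_mulVec_eq_add hFbar lam (n + 1) i hy]
      have h3 := neumannSum_eq hα0 hβ0 hs hTb hgb hμ i
      have h4 : extMatrix lam (kernelG F Fbar) n (i + 1) 0 * v 0 = lam ^ 2 * g i := by
        simp [extMatrix, hv, hg, add_assoc, add_comm (1 : ℤ)]
      rw [h4]
      push_cast
      change y i = g i + -lam ^ 2 * ∑' j, T i j * y j at h3
      change lam ^ 2 * g i + -lam ^ 2 * (y i + lam ^ 2 * ∑' j, T i j * y j) = 0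
      linear_combination -lam ^ 2 * h3
    have hdet := hF.infDet_extBordered_mul_apply_zero hFbar hvs hMv
    refine ⟨∑' j : ℕ, lam * F ((n : ℤ) + 1 + j) * v j, ?_, by simpa [hv] using hdet⟩
    have h1 : Summable fun j : ℕ => lam * F ((n : ℤ) + 1 + j) * v j :=
      Summable.of_norm (by
        simpa using summable_mul_of_sq (hF.summable_scaled_succ_sq lam n) hvs)
    have h2 : ∀ j : ℕ, lam * F ((n : ℤ) + 1 + (j + 1 : ℕ)) * v (j + 1) = -lam ^ 3 * (φ j * y j) := by
      intro j
      simp only [hv, hφ]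
      push_cast
      rw [← add_assoc]
      ring
    rw [h1.tsum_eq_zero_add]
    simp_rw [h2]
    rw [tsum_mul_left]
    have h3 := (hasSum_neumannSum_dot hα0 hβ0 hs hTb hgb hμ hφs).mul_left (-lam ^ 3)
    refine (hasSum_nat_add_iff' 1).mp ?_
    have h4 : (fun k => b (k + 1) * lam ^ (2 * (k + 1) + 1)) =
        fun k => -lam ^ 3 * ((-lam ^ 2) ^ k * ∑' j, φ j * mulVecIter T g k j) := by
      ext k
      simp only [hb]
      rw [neg_pow (lam ^ 2), ← pow_mul]
      ring
    rw [h4]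
    have h5 : (lam * F ((n : ℤ) + 1 + ((0 : ℕ) : ℤ)) * v 0 + -lam ^ 3 * ∑' j, φ j * y j) -
        ∑ k ∈ Finset.range 1, b k * lam ^ (2 * k + 1) = -lam ^ 3 * ∑' j, φ j * y j := by
      have h6 : b 0 = F ((n : ℤ) + 1) := rfl
      have h7 : v 0 = 1 := rfl
      simp only [Finset.range_one, Finset.sum_singleton, h6, h7]
      push_cast
      ring_nf
    rw [h5]
    exact h3

/-! ### The scattering data of a weight -/

/-- The Fourier coefficients of `log f₊`. -/
def logCoeff (c : ℤ → ℂ) (k : ℤ) : ℂ := if k < 0 then 0 else if k = 0 then -(c 0 / 2) else -c k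

/-- The Fourier coefficients of `log f₋`. -/
def logCoeffMinus (c : ℤ → ℂ) (k : ℤ) : ℂ := logCoeff (fun j => c (-j)) (-k)

/-- `log f₊`. -/
def jostPlusLog (c : ℤ → ℂ) (z : ℂ) : ℂ := -(c 0 / 2) - ∑' p : ℕ, c ((p : ℤ) + 1) * z ^ (p + 1)

/-- `log f₋`. -/
def jostMinusLog (c : ℤ → ℂ) (z : ℂ) : ℂ :=
  -(c 0 / 2) - ∑' p : ℕ, c (-((p : ℤ) + 1)) * (z⁻¹) ^ (p + 1)

theorem jostPlus_eq_exp (c : ℤ → ℂ) (z : ℂ) : jostPlus c z = Complex.exp (jostPlusLog c z) := rfl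

theorem jostMinus_eq_exp (c : ℤ → ℂ) (z : ℂ) : jostMinus c z = Complex.exp (jostMinusLog c z) := rfl

theorem norm_logCoeff_le (c : ℤ → ℂ) (k : ℤ) : ‖logCoeff c k‖ ≤ ‖c k‖ := by
  rw [logCoeff]
  split_ifs with h1 h2
  · simp
  · rw [h2, norm_neg, norm_div, Complex.norm_ofNat]
    linarith [norm_nonneg (c 0)]
  · rw [norm_neg]

theorem hasFourier_jostPlusLog {c : ℤ → ℂ} (hc : Summable fun p : ℤ => ‖c p‖) :
    HasFourier (jostPlusLog c) (logCoeff c) where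
  summable := Summable.of_nonneg_of_le (fun _ => norm_nonneg _) (norm_logCoeff_le c) hc
  hasSum z hz := by
    have h1 : Summable fun p : ℕ => c ((p : ℤ) + 1) * z ^ (p + 1) := by
      refine Summable.of_norm ?_
      have h2 : Summable fun p : ℕ => ‖c ((p : ℤ) + 1)‖ :=
        hc.comp_injective (i := fun p : ℕ => (p : ℤ) + 1) fun a b h => by simpa using h
      refine h2.congr fun p => ?_
      rw [norm_mul, norm_pow, hz, one_pow, mul_one]
    have hpos : HasSum (fun n : ℕ => logCoeff c n * z ^ (n : ℤ)) (jostPlusLog c z) := by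
      rw [← hasSum_nat_add_iff' 1]
      have h3 : ∀ p : ℕ, logCoeff c ((p + 1 : ℕ) : ℤ) * z ^ ((p + 1 : ℕ) : ℤ) =
          -(c ((p : ℤ) + 1) * z ^ (p + 1)) := by
        intro p
        have h4 : ¬(((p + 1 : ℕ) : ℤ) < 0) := by omega
        have h5 : ((p + 1 : ℕ) : ℤ) ≠ 0 := by omega
        rw [logCoeff, if_neg h4, if_neg h5, zpow_natCast]
        push_cast
        ring
      simp_rw [h3]
      convert h1.hasSum.neg using 1
      simp [jostPlusLog, logCoeff]
      ring
    have hneg : HasSum (fun n : ℕ => logCoeff c (-((n : ℤ) + 1)) * z ^ (-((n : ℤ) + 1))) 0 := by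
      have h3 : ∀ n : ℕ, logCoeff c (-((n : ℤ) + 1)) * z ^ (-((n : ℤ) + 1)) = 0 := by
        intro n
        rw [logCoeff, if_pos (by omega), zero_mul]
      simp_rw [h3]
      exact hasSum_zero
    simpa using HasSum.of_nat_of_neg_add_one (f := fun k : ℤ => logCoeff c k * z ^ k) hpos hneg

theorem hasFourier_jostMinusLog {c : ℤ → ℂ} (hc : Summable fun p : ℤ => ‖c p‖) :
    HasFourier (jostMinusLog c) (logCoeffMinus c) := by
  have hc' : Summable fun p : ℤ => ‖c (-p)‖ := (Equiv.neg ℤ).summable_iff.mpr hc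
  refine (hasFourier_jostPlusLog hc').reflect.congr fun z _ => ?_
  simp [jostPlusLog, jostMinusLog]

theorem oneSided_logCoeff (c : ℤ → ℂ) : OneSided 1 (logCoeff c) := fun k hk => by
  rw [logCoeff, if_pos (by omega)]

theorem oneSided_logCoeffMinus (c : ℤ → ℂ) : OneSided (-1) (logCoeffMinus c) := fun k hk => by
  rw [logCoeffMinus, logCoeff, if_pos (by omega)]

theorem logCoeff_add_logCoeffMinus (c : ℤ → ℂ) : -(logCoeff c + logCoeffMinus c) = c := by
  ext k
  simp only [Pi.neg_apply, Pi.add_apply, logCoeff, logCoeffMinus]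
  rcases lt_trichotomy k 0 with h | h | h
  · have h1 : ¬(-k < 0) := by omega
    have h2 : -k ≠ 0 := by omega
    rw [if_pos h, if_neg h1, if_neg h2]
    simp
  · subst h
    simp
  · have h1 : -k < 0 := by omega
    rw [if_neg (by omega), if_neg (by omega), if_pos h1]
    simp

/-- The coefficients of `log S` are `c k` for `k > 0`, `-c k` for `k < 0`, and `0` at `k = 0`, where
the two halves of `c 0` cancel. -/
theorem norm_logCoeffMinus_sub_le (c : ℤ → ℂ) (k : ℤ) :
    ‖(logCoeffMinus c - logCoeff c) k‖ ≤ ‖c k‖ := by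
  simp only [Pi.sub_apply, logCoeff, logCoeffMinus]
  rcases lt_trichotomy k 0 with h | h | h
  · have h1 : ¬(-k < 0) := by omega
    have h2 : -k ≠ 0 := by omega
    rw [if_pos h, if_neg h1, if_neg h2]
    simp
  · subst h
    simp
  · have h1 : -k < 0 := by omega
    have h2 : ¬(k < 0) := by omega
    have h3 : k ≠ 0 := by omega
    rw [if_pos h1, if_neg h2, if_neg h3]
    simp

theorem kappaInf_eq (c : ℤ → ℂ) : kappaInf c = Complex.exp (-(c 0 / 2)) := by
  simp [kappaInf, jostPlus]

theorem besovSq_ne_top {c : ℤ → ℂ} (hs : Summable fun p : ℤ => |(p : ℝ)| * ‖c p‖ ^ 2) {a : ℤ → ℂ}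
    (ha : ∀ k, ‖a k‖ ≤ ‖c k‖) : besovSq a ≠ ⊤ := by
  refine ne_top_of_le_ne_top hs.tsum_ofReal_ne_top (ENNReal.tsum_le_tsum fun k => ?_)
  rw [ENNReal.ofReal_mul (abs_nonneg _), ENNReal.ofReal_pow (norm_nonneg _), ofReal_norm]
  have h1 : (k.natAbs : ENNReal) = ENNReal.ofReal |(k : ℝ)| := by
    rw [← ENNReal.ofReal_natCast, Nat.cast_natAbs, Int.cast_abs]
  rw [h1]
  gcongr
  exact enorm_le_iff_norm_le.mpr (ha k)

section Scattering

variable {c : ℤ → ℂ}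

theorem hasFourier_scatteringS (hc : Summable fun p : ℤ => ‖c p‖) :
    HasFourier (scatteringS c) (convExp (logCoeffMinus c - logCoeff c)) :=
  ((hasFourier_jostMinusLog hc).sub (hasFourier_jostPlusLog hc)).exp.congr fun z _ => by
    rw [scatteringS, jostPlus_eq_exp, jostMinus_eq_exp, ← Complex.exp_sub]
    rfl

theorem hasFourier_scatteringS_inv (hc : Summable fun p : ℤ => ‖c p‖) :
    HasFourier (fun z => (scatteringS c z)⁻¹) (convExp (logCoeff c - logCoeffMinus c)) :=
  ((hasFourier_jostPlusLog hc).sub (hasFourier_jostMinusLog hc)).exp.congr fun z _ => by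
    rw [scatteringS, jostPlus_eq_exp, jostMinus_eq_exp, inv_div, ← Complex.exp_sub]
    rfl

theorem scatF_eq (hc : Summable fun p : ℤ => ‖c p‖) (m : ℤ) :
    scatF c m = convExp (logCoeffMinus c - logCoeff c) (-m) := by
  rw [← (hasFourier_scatteringS hc).circleMean_eq, neg_neg]
  simp_rw [mul_comm (scatteringS c _)]
  rfl

theorem scatFbar_eq (hc : Summable fun p : ℤ => ‖c p‖) (m : ℤ) :
    scatFbar c m = convExp (logCoeff c - logCoeffMinus c) m := by
  rw [← (hasFourier_scatteringS_inv hc).circleMean_eq]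
  simp_rw [mul_comm (scatteringS c _)⁻¹]
  rfl

theorem hankelSq_scatF (hc : Summable fun p : ℤ => ‖c p‖)
    (hs : Summable fun p : ℤ => |(p : ℝ)| * ‖c p‖ ^ 2) : HankelSq (scatF c) := by
  have h1 := ((hasFourier_jostMinusLog hc).sub (hasFourier_jostPlusLog hc)).besovSq_convExp_ne_top
    (besovSq_ne_top hs (norm_logCoeffMinus_sub_le c))
  refine (summable_hankel h1).congr fun p => ?_
  rw [scatF_eq hc, add_assoc]

theorem besovSq_reflect (a : ℤ → ℂ) : besovSq (fun k => a (-k)) = besovSq a := by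
  rw [besovSq, besovSq, ← (Equiv.neg ℤ).tsum_eq]
  simp

theorem hankelSq_scatFbar (hc : Summable fun p : ℤ => ‖c p‖)
    (hs : Summable fun p : ℤ => |(p : ℝ)| * ‖c p‖ ^ 2) : HankelSq (scatFbar c) := by
  have h1 := ((hasFourier_jostPlusLog hc).sub (hasFourier_jostMinusLog hc)).besovSq_convExp_ne_top
    (besovSq_ne_top hs fun k => by
      rw [Pi.sub_apply, norm_sub_rev]
      exact norm_logCoeffMinus_sub_le c k)
  rw [← besovSq_reflect] at h1
  refine (summable_hankel h1).congr fun p => ?_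
  rw [scatFbar_eq hc, neg_neg, add_assoc]

theorem weight_eq {w : ℂ → ℂ} (hc : Summable fun p : ℤ => ‖c p‖)
    (hw : ∀ z : ℂ, ‖z‖ = 1 → w z = Complex.exp (∑' p : ℤ, c p * z ^ p)) {z : ℂ} (hz : ‖z‖ = 1) :
    w z = (jostPlus c z)⁻¹ * (jostMinus c z)⁻¹ := by
  have h1 := ((hasFourier_jostPlusLog hc).add (hasFourier_jostMinusLog hc)).neg
  rw [logCoeff_add_logCoeffMinus] at h1
  rw [hw z hz, (h1.hasSum z hz).tsum_eq, jostPlus_eq_exp, jostMinus_eq_exp, ← Complex.exp_neg,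
    ← Complex.exp_neg, ← Complex.exp_add]
  congr 1
  simp only [Pi.neg_apply, Pi.add_apply]
  ring

theorem hasFourier_weight {w : ℂ → ℂ} (hc : Summable fun p : ℤ => ‖c p‖)
    (hw : ∀ z : ℂ, ‖z‖ = 1 → w z = Complex.exp (∑' p : ℤ, c p * z ^ p)) :
    HasFourier w (convExp c) :=
  (hasFourier_of_summable hc).exp.congr fun z hz => (hw z hz).symm

end Scattering

/-! ### Toeplitz determinants -/

/-- This and the next three lemmas give the support of a product and its extreme coefficient when
both factors are supported on half-lines of the same direction. -/
theorem conv_eq_zero_of_lt {a b : ℤ → ℂ} {n : ℤ} (ha : ∀ k < 0, a k = 0) (hb : ∀ k < n, b k = 0)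
    {m : ℤ} (hm : m < n) : conv a b m = 0 := by
  refine (tsum_congr fun j => ?_).trans tsum_zero
  by_cases hj : j < 0
  · rw [ha j hj, zero_mul]
  · rw [hb (m - j) (by omega), mul_zero]

theorem conv_apply_lowest {a b : ℤ → ℂ} {n : ℤ} (ha : ∀ k < 0, a k = 0) (hb : ∀ k < n, b k = 0) :
    conv a b n = a 0 * b n := by
  rw [conv, tsum_eq_single 0, sub_zero]
  intro j hj
  by_cases hj : j < 0
  · rw [ha j hj, zero_mul]
  · rw [hb (n - j) (by omega), mul_zero]

theorem conv_eq_zero_of_gt {a b : ℤ → ℂ} {n : ℤ} (ha : ∀ k, n < k → a k = 0)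
    (hb : ∀ k, 0 < k → b k = 0) {m : ℤ} (hm : n < m) : conv a b m = 0 := by
  refine (tsum_congr fun j => ?_).trans tsum_zero
  by_cases hj : n < j
  · rw [ha j hj, zero_mul]
  · rw [hb (m - j) (by omega), mul_zero]

theorem conv_apply_highest {a b : ℤ → ℂ} {n : ℤ} (ha : ∀ k, n < k → a k = 0)
    (hb : ∀ k, 0 < k → b k = 0) : conv a b n = a n * b 0 := by
  rw [conv, tsum_eq_single n, sub_self]
  intro j hj
  by_cases hj : n < j
  · rw [ha j hj, zero_mul]
  · rw [hb (n - j) (by omega), mul_zero]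

/-- The coefficients of the polynomial `∑ p k z ^ k`, as a sequence on `ℤ`. -/
def polyCoeff {N : ℕ} (p : Fin N → ℂ) (m : ℤ) : ℂ := ∑ k : Fin N, if m = (k : ℤ) then p k else 0

theorem polyCoeff_eq_zero {N : ℕ} (p : Fin N → ℂ) {m : ℤ} (hm : m < 0 ∨ (N : ℤ) ≤ m) :
    polyCoeff p m = 0 :=
  Finset.sum_eq_zero fun k _ => if_neg (by have := k.2; omega)

theorem polyCoeff_natCast {N : ℕ} (p : Fin N → ℂ) (k : Fin N) : polyCoeff p (k : ℤ) = p k := by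
  rw [polyCoeff, Finset.sum_eq_single k]
  · simp
  · intro j _ hj
    refine if_neg fun h => hj (Fin.ext ?_)
    exact_mod_cast h.symm
  · simp

theorem hasSum_polyCoeff_mul {N : ℕ} (p : Fin N → ℂ) (x : ℤ → ℂ) :
    HasSum (fun m => polyCoeff p m * x m) (∑ k : Fin N, p k * x k) := by
  have h1 : ∀ k : Fin N, HasSum (fun m : ℤ => (if m = (k : ℤ) then p k else 0) * x m)
      (p k * x k) := by
    intro k
    have h2 := hasSum_ite_eq (k : ℤ) (p k * x k)
    convert h2 using 2 with m
    by_cases hm : m = (k : ℤ) <;> simp [hm]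
  have h2 := hasSum_sum fun k (_ : k ∈ Finset.univ) => h1 k
  simpa [polyCoeff, Finset.sum_mul] using h2

theorem hasFourier_polyCoeff {N : ℕ} (p : Fin N → ℂ) :
    HasFourier (fun z => ∑ k : Fin N, p k * z ^ (k : ℤ)) (polyCoeff p) where
  summable := by
    refine summable_of_ne_finset_zero (s := Finset.Ico (0 : ℤ) N) fun m hm => ?_
    rw [polyCoeff_eq_zero, norm_zero]
    rw [Finset.mem_Ico] at hm
    omega
  hasSum z _ := hasSum_polyCoeff_mul p fun m => z ^ m

theorem HasFourier.summable_sq {h : ℂ → ℂ} {a : ℤ → ℂ} (H : HasFourier h a) :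
    Summable fun k => ‖a k‖ ^ 2 := by
  refine Summable.of_nonneg_of_le (fun _ => sq_nonneg _) (fun k => ?_)
    (H.summable.mul_left (∑' k, ‖a k‖))
  rw [sq]
  gcongr
  exact H.summable.le_tsum k fun _ _ => norm_nonneg _

/-- The vector is the last column of the adjugate: an orthogonal polynomial scaled so that no
division by a Toeplitz determinant occurs. -/
theorem exists_toeplitz_vector {w : ℂ → ℂ} {a : ℤ → ℂ} (H : HasFourier w a) (n : ℕ) :
    ∃ p : Fin (n + 1) → ℂ, p (Fin.last n) = toeplitzDet w n ∧
      ∀ j : Fin (n + 1), ∑ k : Fin (n + 1), p k * a ((j : ℤ) - k) =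
        if j = Fin.last n then toeplitzDet w (n + 1) else 0 := by
  have hT : ∀ N, toeplitzDet w N = (Matrix.of fun j k : Fin N => a ((j : ℤ) - k)).det := by
    intro N
    rw [toeplitzDet]
    congr 1
    ext j k
    exact H.circleMean_eq _
  set T := Matrix.of fun j k : Fin (n + 1) => a ((j : ℤ) - k) with hTdef
  refine ⟨fun k => T.adjugate k (Fin.last n), ?_, fun j => ?_⟩
  · change T.adjugate (Fin.last n) (Fin.last n) = _
    rw [Matrix.adjugate_fin_succ_eq_det_submatrix, hT, ← two_mul, pow_mul]
    simp [hTdef, Matrix.submatrix]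
  · have h1 := congrFun (congrFun (Matrix.mul_adjugate T) j) (Fin.last n)
    rw [Matrix.mul_apply] at h1
    simp only [Matrix.smul_apply, Matrix.one_apply, smul_eq_mul, mul_ite, mul_one, mul_zero] at h1
    rw [hT, ← h1]
    exact Finset.sum_congr rfl fun k _ => mul_comm _ _

/-- A Wiener–Hopf argument: `P w` splits into `Ypos`, with frequencies at least `n`, and `Yneg`,
with negative ones. Then `v = f₊ Ypos` and `u = -f₋ Yneg` keep these supports and are linked through
`S` by `v S = P / f₊ + u` and `u / S = v - P / f₋`. -/
theorem toeplitzDet_extDet {w : ℂ → ℂ} {c : ℤ → ℂ} (hc : Summable fun p : ℤ => ‖c p‖)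
    (hs : Summable fun p : ℤ => |(p : ℝ)| * ‖c p‖ ^ 2)
    (hw : ∀ z : ℂ, ‖z‖ = 1 → w z = Complex.exp (∑' p : ℤ, c p * z ^ p)) (n : ℕ) :
    extDet 1 (kernelG (scatF c) (scatFbar c)) n * (kappaInf c * toeplitzDet w (n + 1)) =
      toeplitzDet w n * (kappaInf c)⁻¹ *
        extDet 1 (kernelG (scatF c) (scatFbar c)) (n + 1) := by
  have Hw := hasFourier_weight hc hw
  obtain ⟨p, hpn, hp⟩ := exists_toeplitz_vector Hw n
  have HP := hasFourier_polyCoeff p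
  set P : ℂ → ℂ := fun z => ∑ k : Fin (n + 1), p k * z ^ (k : ℤ) with hP
  have Hy := HP.mul Hw
  set y := conv (polyCoeff p) (convExp c) with hydef
  have hy : ∀ j : Fin (n + 1), y j = if j = Fin.last n then toeplitzDet w (n + 1) else 0 := by
    intro j
    rw [← hp j]
    exact (hasSum_polyCoeff_mul p fun m => convExp c ((j : ℤ) - m)).tsum_eq
  have hyn : y n = toeplitzDet w (n + 1) := by simpa using hy (Fin.last n)
  have hy0 : ∀ m : ℤ, 0 ≤ m → m < n → y m = 0 := by
    intro m h0 h1
    lift m to ℕ using h0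
    have h2 : m < n := by exact_mod_cast h1
    have h3 := hy ⟨m, by omega⟩
    have h4 : (⟨m, by omega⟩ : Fin (n + 1)) ≠ Fin.last n := by
      rw [Ne, Fin.ext_iff]
      simp only [Fin.val_last]
      omega
    rwa [if_neg h4] at h3
  set ypos : ℤ → ℂ := fun m => if (n : ℤ) ≤ m then y m else 0 with hypos
  set yneg : ℤ → ℂ := fun m => if m < 0 then y m else 0 with hyneg
  have hsplit : ypos + yneg = y := by
    ext m
    simp only [Pi.add_apply, hypos, hyneg]
    rcases lt_or_ge m 0 with h | h
    · rw [if_neg (by omega), if_pos h, zero_add]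
    · rcases lt_or_ge m n with h' | h'
      · rw [if_neg (by omega), if_neg (by omega), hy0 m h h', add_zero]
      · rw [if_pos h', if_neg (by omega), add_zero]
  have Hpos := hasFourier_of_summable (a := ypos) (Summable.of_nonneg_of_le
    (fun _ => norm_nonneg _) (fun m => by
      simp only [hypos]
      split_ifs <;> simp) Hy.summable)
  have Hneg := hasFourier_of_summable (a := yneg) (Summable.of_nonneg_of_le
    (fun _ => norm_nonneg _) (fun m => by
      simp only [hyneg]
      split_ifs <;> simp) Hy.summable)
  set Ypos : ℂ → ℂ := fun z => ∑' k, ypos k * z ^ k with hYpos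
  set Yneg : ℂ → ℂ := fun z => ∑' k, yneg k * z ^ k with hYneg
  have hPw : ∀ z : ℂ, ‖z‖ = 1 → P z * w z = Ypos z + Yneg z := by
    intro z hz
    have h1 := (Hpos.add Hneg).hasSum z hz
    rw [hsplit] at h1
    exact (Hy.hasSum z hz).unique h1
  have Hp := (hasFourier_jostPlusLog hc).exp
  have Hpi := (hasFourier_jostPlusLog hc).neg.exp
  have Hm := (hasFourier_jostMinusLog hc).exp
  have Hmi := (hasFourier_jostMinusLog hc).neg.exp
  set fp := convExp (logCoeff c) with hfp
  set fm := convExp (logCoeffMinus c) with hfm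
  have sp : OneSided 1 (logCoeff c) := oneSided_logCoeff c
  have sm : OneSided (-1) (logCoeffMinus c) := oneSided_logCoeffMinus c
  have hfp0 : fp 0 = kappaInf c := by
    rw [hfp, sp.convExp_zero one_ne_zero, kappaInf_eq]
    simp [logCoeff]
  have hfmi0 : convExp (-logCoeffMinus c) 0 = (kappaInf c)⁻¹ := by
    rw [sm.neg.convExp_zero (by norm_num), kappaInf_eq, ← Complex.exp_neg]
    simp [logCoeffMinus, logCoeff]
  have hfpz : ∀ k < 0, fp k = 0 := fun k hk => sp.convExp k (by omega)
  have hfpiz : ∀ k < 0, convExp (-logCoeff c) k = 0 := fun k hk => sp.neg.convExp k (by omega)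
  have hfmz : ∀ k, 0 < k → fm k = 0 := fun k hk => sm.convExp k (by omega)
  have hfmiz : ∀ k, 0 < k → convExp (-logCoeffMinus c) k = 0 := fun k hk =>
    sm.neg.convExp k (by omega)
  have Hv := Hp.mul Hpos
  set v := conv fp ypos with hv
  have Hu := (Hneg.mul Hm).neg
  set u := -conv yneg fm with hu
  have hposz : ∀ k < (n : ℤ), ypos k = 0 := fun k hk => if_neg (by omega)
  have hvz : ∀ k < (n : ℤ), v k = 0 := fun k hk => conv_eq_zero_of_lt hfpz hposz hk
  have hvn : v n = kappaInf c * toeplitzDet w (n + 1) := by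
    rw [hv, conv_apply_lowest hfpz hposz, hfp0, ← hyn]
    simp [hypos]
  have huz : ∀ k, -1 < k → u k = 0 := fun k hk => by
    rw [hu, Pi.neg_apply, conv_eq_zero_of_gt (fun j hj => if_neg (by omega)) hfmz hk, neg_zero]
  have hfp_ne : ∀ z, Complex.exp (jostPlusLog c z) ≠ 0 := fun z => Complex.exp_ne_zero _
  have hfm_ne : ∀ z, Complex.exp (jostMinusLog c z) ≠ 0 := fun z => Complex.exp_ne_zero _
  have hPw' : ∀ z : ℂ, ‖z‖ = 1 → P z = Complex.exp (jostPlusLog c z) *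
      Complex.exp (jostMinusLog c z) * (Ypos z + Yneg z) := by
    intro z hz
    rw [← hPw z hz, weight_eq hc hw hz, jostPlus_eq_exp, jostMinus_eq_exp]
    have h1 := hfp_ne z
    have h2 := hfm_ne z
    field_simp
  have id1 : conv v (convExp (logCoeffMinus c - logCoeff c)) =
      conv (polyCoeff p) (convExp (-logCoeff c)) + u := by
    refine (Hv.mul (hasFourier_scatteringS hc)).unique ((HP.mul Hpi).add Hu) fun z hz => ?_
    simp only [Pi.mul_apply, Pi.add_apply, Pi.neg_apply]
    rw [hPw' z hz, scatteringS, jostPlus_eq_exp, jostMinus_eq_exp, Complex.exp_neg]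
    have h1 := hfp_ne z
    field_simp
    ring
  have id2 : conv u (convExp (logCoeff c - logCoeffMinus c)) =
      v - conv (polyCoeff p) (convExp (-logCoeffMinus c)) := by
    refine (Hu.mul (hasFourier_scatteringS_inv hc)).unique (Hv.sub (HP.mul Hmi)) fun z hz => ?_
    simp only [Pi.mul_apply, Pi.sub_apply, Pi.neg_apply]
    rw [hPw' z hz, scatteringS, jostPlus_eq_exp, jostMinus_eq_exp, Complex.exp_neg, inv_div]
    have h2 := hfm_ne z
    field_simp
    ring
  -- At negative frequencies `P / f₊` has no coefficients, so there the Hankel matrix of `F` maps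
  -- `v` to `u`.
  have hFv : ∀ k : ℕ, ∑' j : ℕ, scatF c (((n : ℤ) + j) + ((k : ℤ) + 1)) * v ((n : ℤ) + j) =
      u (-((k : ℤ) + 1)) := by
    intro k
    have h1 := congrFun id1 (-((k : ℤ) + 1))
    rw [Pi.add_apply, conv_eq_zero_of_lt (n := 0) (fun j hj => polyCoeff_eq_zero p (Or.inl hj)) hfpiz
      (by omega), zero_add] at h1
    rw [← h1, conv]
    have hinj : Function.Injective fun j : ℕ => (n : ℤ) + j := fun a b h => by simpa using h
    rw [← hinj.tsum_eq (f := fun j => v j *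
      convExp (logCoeffMinus c - logCoeff c) (-((k : ℤ) + 1) - j))]
    · refine tsum_congr fun j => ?_
      rw [scatF_eq hc, mul_comm]
      congr 2
      ring
    · intro j hj
      by_contra hcon
      refine hj ?_
      have : v j = 0 := hvz j (by
        by_contra h2
        exact hcon ⟨(j - n).toNat, by simp only; omega⟩)
      simp [this]
  -- At frequencies from `n` on, `P / f₋` has only the coefficient at `n`, equal to the leading
  -- coefficient of `P` times `1 / f₋(∞)`; this is the source term of the linear system.
  have hFu : ∀ i : ℕ, ∑' k : ℕ, scatFbar c ((n : ℤ) + i + ((k : ℤ) + 1)) * u (-((k : ℤ) + 1)) =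
      v ((n : ℤ) + i) - if i = 0 then toeplitzDet w n * (kappaInf c)⁻¹ else 0 := by
    intro i
    have h1 := congrFun id2 ((n : ℤ) + i)
    have hpz : ∀ k, (n : ℤ) < k → polyCoeff p k = 0 := fun k hk =>
      polyCoeff_eq_zero p (Or.inr (by push_cast; omega))
    have h2 : conv (polyCoeff p) (convExp (-logCoeffMinus c)) ((n : ℤ) + i) =
        if i = 0 then toeplitzDet w n * (kappaInf c)⁻¹ else 0 := by
      by_cases hi : i = 0
      · subst hi
        have h3 := polyCoeff_natCast p (Fin.last n)
        rw [Fin.val_last] at h3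
        rw [if_pos rfl, Nat.cast_zero, add_zero, conv_apply_highest hpz hfmiz, hfmi0, h3, hpn]
      · rw [if_neg hi, conv_eq_zero_of_gt hpz hfmiz (by omega)]
    rw [Pi.sub_apply, h2] at h1
    rw [← h1, conv]
    have hinj : Function.Injective fun k : ℕ => -((k : ℤ) + 1) := fun a b h => by simpa using h
    rw [← hinj.tsum_eq (f := fun j => u j *
      convExp (logCoeff c - logCoeffMinus c) ((n : ℤ) + i - j))]
    · refine tsum_congr fun k => ?_
      rw [scatFbar_eq hc, mul_comm, sub_neg_eq_add]
    · intro j hj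
      by_contra hcon
      refine hj ?_
      have : u j = 0 := huz j (by
        by_contra h2
        exact hcon ⟨(-j - 1).toNat, by simp only; omega⟩)
      simp [this]
  have hF := hankelSq_scatF hc hs
  have hFbar := hankelSq_scatFbar hc hs
  have hx : Summable fun j : ℕ => ‖v ((n : ℤ) + j)‖ ^ 2 :=
    Hv.summable_sq.comp_injective (i := fun j : ℕ => (n : ℤ) + j) fun a b h => by simpa using h
  have hfin := hF.extDet_mul_apply_zero hFbar (lam := 1) (n := n)
    (s := toeplitzDet w n * (kappaInf c)⁻¹) hx fun i => by
      rw [hF.extMatrix_mulVec hFbar 1 n i hx]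
      simp_rw [hFv]
      rw [hFu i]
      ring
  rwa [Nat.cast_zero, add_zero, hvn] at hfin

end

/-! ### Assembly of the statements. -/

theorem mainTheorem7
    -- the weight, given on the unit circle by its logarithm with Fourier coefficients c
    (w : ℂ → ℂ) (c : ℤ → ℂ)
    (hc : Summable fun p : ℤ => ‖c p‖)
    (hszego : Summable fun p : ℤ => |(p : ℝ)| * ‖c p‖ ^ 2)
    (hw : ∀ z : ℂ, ‖z‖ = 1 → w z = Complex.exp (∑' p : ℤ, c p * z ^ p))
    -- the scattering data
    (kinf : ℂ) (hkinf : kinf = kappaInf c)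
    (F Fbar : ℤ → ℂ) (hF : F = scatF c) (hFbar : Fbar = scatFbar c)
    (G Gbar : ℤ → ℤ → ℂ) (hG : G = kernelG F Fbar) (hGbar : Gbar = kernelG Fbar F) :
    -- all series and infinite determinants below converge
    ((∀ l m : ℕ, Summable fun k : ℕ => Fbar ((l : ℤ) + (k + 1)) * F ((m : ℤ) + (k + 1))) ∧
      ∀ (lam : ℂ) (n : ℕ),
        Tendsto (cornerDet (extMatrix lam G n)) atTop (𝓝 (extDet lam G n)) ∧
        Tendsto (cornerDet (extMatrix lam Gbar n)) atTop (𝓝 (extDet lam Gbar n)) ∧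
        Tendsto (cornerDet (extBordered lam F G n)) atTop (𝓝 (infDet (extBordered lam F G n))) ∧
        Tendsto (cornerDet (extBordered lam Fbar Gbar n)) atTop
          (𝓝 (infDet (extBordered lam Fbar Gbar n))) ∧
        extDet lam Gbar n = extDet lam G n) ∧
    -- the extended system is the original one for (lam F, lam Fbar), up to rescaling A2 and Ab2
    (∀ (lam : ℂ), lam ≠ 0 → ∀ (n : ℕ) (kap : ℂ) (A1 A2 Ab1 Ab2 : ℕ → ℂ),
      IsMarchenkoSolution lam F Fbar kinf n kap A1 A2 Ab1 Ab2 ↔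
        IsMarchenkoSolution 1 (fun m => lam * F m) (fun m => lam * Fbar m) kinf n kap
          A1 (fun m => lam * A2 m) Ab1 (fun m => lam⁻¹ * Ab2 m)) ∧
    -- solutions exist
    (∀ (lam : ℂ) (n : ℕ), extDet lam G n ≠ 0 → extDet lam G (n + 1) ≠ 0 →
      ∃ (kap : ℂ) (A1 A2 Ab1 Ab2 : ℕ → ℂ),
        IsMarchenkoSolution lam F Fbar kinf n kap A1 A2 Ab1 Ab2) ∧
    -- the determinant formulas for every solution
    (∀ (lam : ℂ), lam ≠ 0 → ∀ (n : ℕ), extDet lam G (n + 1) ≠ 0 →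
      ∀ (kap : ℂ) (A1 A2 Ab1 Ab2 : ℕ → ℂ),
        IsMarchenkoSolution lam F Fbar kinf n kap A1 A2 Ab1 Ab2 →
          extDet lam G n ≠ 0 ∧
          Ab1 n = kinf / kap ∧
          kinf ^ 2 / kap ^ 2 = extDet lam G (n + 1) / extDet lam G n ∧
          reflCoeff lam n Ab1 Ab2 =
            1 / extDet lam G (n + 1) * infDet (extBordered lam F G n) ∧
          reflCoeffBar lam n A1 A2 =
            1 / extDet lam Gbar (n + 1) * infDet (extBordered lam Fbar Gbar n)) ∧
    -- the expansions for small lam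
    (∀ n : ℕ,
      Summable (fun j : ℕ => G n ((n : ℤ) + j) * G ((n : ℤ) + j) n) ∧
      Summable (fun j : ℕ => F (((n : ℤ) + 1 + j) + 1) * G ((n : ℤ) + 1 + j) n) ∧
      Summable (fun j : ℕ => Fbar (((n : ℤ) + 1 + j) + 1) * Gbar ((n : ℤ) + 1 + j) n) ∧
      ∃ (a b bbar : ℕ → ℂ) (δ : ℝ), 0 < δ ∧
        a 0 = 1 ∧ a 1 = -G n n ∧ a 2 = ∑' j : ℕ, G n ((n : ℤ) + j) * G ((n : ℤ) + j) n ∧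
        b 0 = F ((n : ℤ) + 1) ∧
        b 1 = -∑' j : ℕ, F (((n : ℤ) + 1 + j) + 1) * G ((n : ℤ) + 1 + j) n ∧
        bbar 0 = Fbar ((n : ℤ) + 1) ∧
        bbar 1 = -∑' j : ℕ, Fbar (((n : ℤ) + 1 + j) + 1) * Gbar ((n : ℤ) + 1 + j) n ∧
        ∀ lam : ℂ, lam ≠ 0 → ‖lam‖ < δ →
          extDet lam G n ≠ 0 ∧ extDet lam G (n + 1) ≠ 0 ∧
          ∀ (kap : ℂ) (A1 A2 Ab1 Ab2 : ℕ → ℂ),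
            IsMarchenkoSolution lam F Fbar kinf n kap A1 A2 Ab1 Ab2 →
              HasSum (fun k : ℕ => a k * lam ^ (2 * k)) (kinf ^ 2 / kap ^ 2) ∧
              HasSum (fun k : ℕ => b k * lam ^ (2 * k + 1)) (reflCoeff lam n Ab1 Ab2) ∧
              HasSum (fun k : ℕ => bbar k * lam ^ (2 * k + 1)) (reflCoeffBar lam n A1 A2)) ∧
    -- the extended Toeplitz determinants
    (∀ (lam I0 : ℂ) (kap : ℕ → ℂ) (A1 A2 Ab1 Ab2 : ℕ → ℕ → ℂ),
      (∀ n : ℕ, IsMarchenkoSolution lam F Fbar kinf n (kap n) (A1 n) (A2 n) (Ab1 n) (Ab2 n)) →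
        ∀ n : ℕ, extDet lam G n ≠ 0 ∧
          extToeplitz I0 kap n = I0 / kinf ^ (2 * n) * (extDet lam G n / extDet lam G 0)) ∧
    -- the Toeplitz determinants of the weight itself, at lam = 1
    ((∀ n : ℕ, 1 ≤ n → toeplitzDet w n ≠ 0) →
      ∀ n : ℕ, extDet 1 G n ≠ 0 ∧
        toeplitzDet w n = toeplitzDet w 0 / kinf ^ (2 * n) * (extDet 1 G n / extDet 1 G 0)) := by
  subst hkinf hF hFbar hG hGbar
  have hk : kappaInf c ≠ 0 := by
    rw [kappaInf_eq]
    exact Complex.exp_ne_zero _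
  have hF := hankelSq_scatF hc hszego
  have hFbar := hankelSq_scatFbar hc hszego
  refine ⟨⟨fun l m => hF.summable_kernel hFbar l m, fun lam n => ⟨hF.tendsto_extDet hFbar lam n,
    hFbar.tendsto_extDet hF lam n, hF.tendsto_extBordered hFbar lam n,
    hFbar.tendsto_extBordered hF lam n, extDet_kernelG_swap _ _ _ _⟩⟩,
    fun lam hlam n kap A1 A2 Ab1 Ab2 => isMarchenkoSolution_iff_rescaled hlam _ _ _ _ _ _ _ _ _,
    fun lam n => exists_isMarchenkoSolution hF hFbar hk lam n,
    fun lam hlam n hD kap A1 A2 Ab1 Ab2 h => h.formulas hF hFbar hk hlam hD,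
    fun n => ⟨hF.summable_kernelG_sq hFbar n, hF.summable_bordered_first hFbar n,
      hFbar.summable_bordered_first hF n, ?_⟩,
    fun lam I0 kap A1 A2 Ab1 Ab2 h n => ?_, fun hI n => ?_⟩
  · obtain ⟨a, δ₁, hδ₁, ha0, ha1, ha2, ha⟩ := exists_expansion_ratio hF hFbar n
    obtain ⟨b, δ₂, hδ₂, hb0, hb1, hb⟩ := exists_expansion_bordered hF hFbar n
    obtain ⟨d, δ₃, hδ₃, hd0, hd1, hd⟩ := exists_expansion_bordered hFbar hF n
    obtain ⟨δ₄, hδ₄, hD⟩ := exists_extDet_ne_zero hF hFbar n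
    obtain ⟨δ₅, hδ₅, hD'⟩ := exists_extDet_ne_zero hF hFbar (n + 1)
    refine ⟨a, b, d, min δ₁ (min δ₂ (min δ₃ (min δ₄ δ₅))), by positivity, ha0, ha1, ha2, hb0, hb1,
      hd0, hd1, fun lam hlam hlt => ?_⟩
    simp only [lt_min_iff] at hlt
    obtain ⟨h1, h2, h3, h4, h5⟩ := hlt
    refine ⟨hD lam h4, hD' lam h5, fun kap A1 A2 Ab1 Ab2 h => ?_⟩
    obtain ⟨-, -, e1, e2, e3⟩ := h.formulas hF hFbar hk hlam (hD' lam h5)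
    refine ⟨?_, ?_, ?_⟩
    · obtain ⟨R, hR, hRe⟩ := ha lam h1
      rwa [e1, ← hRe, mul_div_cancel_left₀ _ (hD lam h4)]
    · obtain ⟨R, hR, hRe⟩ := hb lam h2
      rwa [e2, hRe, one_div_mul_eq_div, mul_div_cancel_right₀ _ (hD' lam h5)]
    · obtain ⟨R, hR, hRe⟩ := hd lam h3
      have h6 : extDet lam (kernelG (scatFbar c) (scatF c)) (n + 1) ≠ 0 := by
        rw [extDet_kernelG_swap]
        exact hD' lam h5
      rwa [e3, hRe, one_div_mul_eq_div, mul_div_cancel_right₀ _ h6]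
  · have hrec := fun n => (h n).extDet_mul hF hFbar hk
    exact ⟨extDet_ne_zero_of_recurrence hF hFbar hrec n, extToeplitz_eq hF hFbar hk I0 hrec n⟩
  · have hI' : ∀ n, toeplitzDet w n ≠ 0 := by
      intro n
      rcases Nat.eq_zero_or_pos n with rfl | hn
      · simp [toeplitzDet]
      · exact hI n hn
    -- Here `I_n / I_{n+1}` plays the role of `κ_n²`, so the nonvanishing argument for solutions
    -- applies without constructing a solution.
    have hrec : ∀ n, extDet 1 (kernelG (scatF c) (scatFbar c)) n *
        (kappaInf c ^ 2 * toeplitzDet w (n + 1) / toeplitzDet w n) =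
          extDet 1 (kernelG (scatF c) (scatFbar c)) (n + 1) := by
      intro n
      have h1 := toeplitzDet_extDet hc hszego hw n
      have h2 := hI' n
      field_simp at h1 ⊢
      exact h1
    have hne := extDet_ne_zero_of_recurrence hF hFbar hrec
    refine ⟨hne n, ?_⟩
    induction n with
    | zero =>
      have := hne 0
      simp [this]
    | succ n ih =>
      have h1 := hne 0
      have h2 := hI' n
      have h3 : toeplitzDet w n * kappaInf c ^ (2 * n) *
          extDet 1 (kernelG (scatF c) (scatFbar c)) 0 =
            toeplitzDet w 0 * extDet 1 (kernelG (scatF c) (scatFbar c)) n := by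
        rw [ih]
        field_simp
      have h4 : kappaInf c ^ (2 * (n + 1)) = kappaInf c ^ (2 * n) * kappaInf c ^ 2 := by
        rw [← pow_add]
        ring_nf
      rw [← hrec n, h4]
      field_simp
      linear_combination toeplitzDet w (n + 1) * h3
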